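/- Let $L,s\ge 0$ be integers with $d:=2L+s\ge 2$, and put $\alpha:=\frac{2}{d-1}$. Let $\vartheta=(\vartheta_1,\dots,\vartheta_L)\in\mathbb R^L$, let $R_p:=\operatorname{diag}\bigl(r(p\vartheta_1),\dots,r(p\vartheta_L),1,\dots,1\bigr)$ ($s$ ones) for $p\in\mathbb Z$, where $r(\phi)=\begin{pmatrix}\cos\phi&-\sin\phi\\ \sin\phi&\cos\phi\end{pmatrix}$, fix $q\in\mathbb S^{d-1}$, and put $u_i:=R_i^{\top}q$ for $i\in\mathbb Z$. Let $\mathcal O_q:=\overline{\{u_i:i\in\mathbb Z\}}\subset\mathbb S^{d-1}$. With $\mathbb T=\mathbb R/\mathbb Z$ and $\theta:=\bigl(\frac{\vartheta_1}{2\pi},\dots,\frac{\vartheta_L}{2\pi}\bigr)\in\mathbb T^L$, let $\mathcal H_q:=\overline{\{i\theta \bmod 1:i\in\mathbb Z\}}\subset\mathbb T^L$, a closed subgroup with Haar probability measure $m_{\mathcal H_q}$, let $\Phi_q(x):=\operatorname{diag}\bigl(r(-2\pi x_1),\dots,r(-2\pi x_L),1,\dots,1\bigr)q$, and let $\pi_q:=(\Phi_q)_{\#}m_{\mathcal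 H_q}$. Let $(x_i)_{i\in\mathbb Z}$ be a stationary sequence of random variables with values in $\mathbb S^{d-1}$ such that, for some integer $m\ge 0$: (i) $(x_i)$ is $m$-dependent: for all $I,J\subset\mathbb Z$ with $|i-j|>m$ for every $i\in I$, $j\in J$, the families $(x_i)_{i\in I}$ and $(x_j)_{j\in J}$ are independent; (ii) the common law of the $x_i$ has a density $\rho$ with respect to surface measure on $\mathbb S^{d-1}$, and $\rho$ is continuous and strictly positive on a neighborhood of $\mathcal O_q$; (iii) for each $1\le\ell\le m$, the pair $(x_0,x_\ell)$ has a density with respect to product surface measure that is bounded on a neighborhood of $\mathcal O_q\times\mathcal O_q$. Let $U_i:=1-\langle u_i,x_i\rangle$. For real numbers $\beta_n$ and $1\le i\le n$ let $A_i:=e^{-\beta_nU_i}\big/\sum_{j=1}^n e^{-\beta_nU_j}$, and let $A_{(1)}\ge\dots\ge A_{(n)}$ be their decreasing rearrangement (with $A_{(i)}:=0$ for $i>n$). Let $$\overline C(q):=\frac{2^{1/\alpha}\sigma_{d-2}}{d-1}\int_{\mathbb S^{d-1}}\rho(u)\,\pi_q(du),$$ where $\sigma_{d-2}$ is the surface area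 of the unit sphere $\mathbb S^{d-2}\subset\mathbb R^{d-1}$. Assume that $\beta_nn^{-\alpha}\to\gamma\in(0,\infty)$ as $n\to\infty$, and let $\mathcal X$ be a Poisson point process on $\mathbb R_+=[0,\infty)$ with intensity measure $\overline\Lambda([0,y])=\overline C(q)(y/\gamma)^{1/\alpha}$, $y\ge 0$. Then, almost surely, the atoms of $\mathcal X$ are all simple and can be arranged in an infinite increasing sequence $0<Y_1<Y_2<\cdots$ with $\mathcal X=\sum_{j\ge1}\delta_{Y_j}$ and $\sum_{j\ge 1}e^{-Y_j}<\infty$, and for every fixed $k\ge 1$, $$\bigl(A_{(1)},\dots,A_{(k)}\bigr)\longrightarrow\bigl(W_1,\dots,W_k\bigr)\quad\text{in distribution as } n\to\infty,\qquad W_i:=\frac{e^{-Y_i}}{\sum_{j\ge1}e^{-Y_j}}.$$ -/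

import Mathlib

open MeasureTheory ProbabilityTheory Filter Topology
open scoped NNReal ENNReal Matrix

noncomputable section

namespace RopeAttention

/-! ### The rotary position embedding and its orbit

The ambient space is `ℝ^d = (ℝ²)^L ⊕ ℝ^s` with `d = 2 L + s`: there are `L` rotated planes and `s`
unrotated coordinates. The purely rotated case is `s = 0`. -/

/-- Coordinates of `ℝ^d`: the coordinate `(a, l)` is the `a`-th coordinate of the `l`-th plane. -/
abbrev Coord (L s : ℕ) : Type := (Fin 2 × Fin L) ⊕ Fin s

/-- The Euclidean space `ℝ^d`, `d = 2 L + s`. -/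
abbrev Space (L s : ℕ) : Type := EuclideanSpace ℝ (Coord L s)

/-- The unit sphere `S^(d-1)` of `ℝ^d`. -/
abbrev USphere (L s : ℕ) : Type := Metric.sphere (0 : Space L s) 1

/-- The plane rotation `r(φ)`. -/
def planeRot (φ : Real.Angle) : Matrix (Fin 2) (Fin 2) ℝ :=
  !![φ.cos, -φ.sin; φ.sin, φ.cos]

/-- The matrix `diag(r(φ_1), …, r(φ_L), 1, …, 1)`. -/
def blockRot {L : ℕ} (s : ℕ) (φ : Fin L → Real.Angle) : Matrix (Coord L s) (Coord L s) ℝ :=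
  Matrix.fromBlocks (Matrix.blockDiagonal fun l => planeRot (φ l)) 0 0 1

theorem planeRot_transpose (φ : Real.Angle) : (planeRot φ)ᵀ = planeRot (-φ) := by
  ext i j
  fin_cases i <;> fin_cases j <;> simp [planeRot]

theorem planeRot_neg_mul (φ : Real.Angle) : planeRot (-φ) * planeRot φ = 1 := by
  have h := Real.Angle.cos_sq_add_sin_sq φ
  ext i j
  fin_cases i <;> fin_cases j <;>
    simp [planeRot, Matrix.mul_apply, Fin.sum_univ_two] <;> linarith

theorem blockRot_transpose {L s : ℕ} (φ : Fin L → Real.Angle) :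
    (blockRot s φ)ᵀ = blockRot s (-φ) := by
  simp [blockRot, Matrix.fromBlocks_transpose, Matrix.blockDiagonal_transpose,
    planeRot_transpose]

theorem blockRot_transpose_mul {L s : ℕ} (φ : Fin L → Real.Angle) :
    (blockRot s φ)ᵀ * blockRot s φ = 1 := by
  rw [blockRot_transpose, blockRot, blockRot, Matrix.fromBlocks_multiply]
  simp only [Matrix.mul_zero, Matrix.zero_mul, add_zero, zero_add, Matrix.mul_one,
    ← Matrix.blockDiagonal_mul, Pi.neg_apply, planeRot_neg_mul]
  rw [show (fun _ : Fin L => (1 : Matrix (Fin 2) (Fin 2) ℝ)) = 1 from rfl,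
    Matrix.blockDiagonal_one, Matrix.fromBlocks_one]

/-- Block rotations act on the unit sphere. -/
theorem blockRot_mulVec_mem {L s : ℕ} (φ : Fin L → Real.Angle) (q : USphere L s) :
    WithLp.toLp 2 (blockRot s φ *ᵥ WithLp.ofLp (q : Space L s)) ∈
      Metric.sphere (0 : Space L s) 1 := by
  have hq : ‖(q : Space L s)‖ = 1 := mem_sphere_zero_iff_norm.1 q.2
  have key : ‖WithLp.toLp 2 (blockRot s φ *ᵥ WithLp.ofLp (q : Space L s))‖ ^ 2
      = ‖(q : Space L s)‖ ^ 2 := by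
    have h1 : ∀ v : Space L s, ‖v‖ ^ 2 = WithLp.ofLp v ⬝ᵥ WithLp.ofLp v := by
      intro v
      rw [EuclideanSpace.real_norm_sq_eq]
      simp [dotProduct, sq]
    rw [h1, h1]
    change (blockRot s φ *ᵥ WithLp.ofLp (q : Space L s)) ⬝ᵥ
      (blockRot s φ *ᵥ WithLp.ofLp (q : Space L s)) = _
    rw [Matrix.dotProduct_mulVec, Matrix.vecMul_mulVec, blockRot_transpose_mul, Matrix.vecMul_one]
  rw [mem_sphere_zero_iff_norm]
  rw [hq] at key
  nlinarith [norm_nonneg (WithLp.toLp 2 (blockRot s φ *ᵥ WithLp.ofLp (q : Space L s)))]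

/-- The RoPE matrix `R_p = diag(r(p ϑ_1), …, r(p ϑ_L), 1, …, 1)` at position `p`. -/
def ropeMatrix {L : ℕ} (s : ℕ) (ϑ : Fin L → ℝ) (p : ℤ) : Matrix (Coord L s) (Coord L s) ℝ :=
  blockRot s fun l => (((p : ℝ) * ϑ l : ℝ) : Real.Angle)

/-- The RoPE target direction `u_i = R_iᵀ q`. -/
def target {L s : ℕ} (ϑ : Fin L → ℝ) (q : USphere L s) (i : ℤ) : USphere L s :=
  ⟨WithLp.toLp 2 ((ropeMatrix s ϑ i)ᵀ *ᵥ WithLp.ofLp (q : Space L s)), by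
    rw [ropeMatrix, blockRot_transpose]
    exact blockRot_mulVec_mem _ q⟩

/-- The orbit closure `𝒪_q` of the targets in the sphere. -/
def orbitClosure {L s : ℕ} (ϑ : Fin L → ℝ) (q : USphere L s) : Set (USphere L s) :=
  closure (Set.range (target ϑ q))

/-- The torus `𝕋^L = (ℝ/ℤ)^L`. -/
abbrev Torus (L : ℕ) : Type := Fin L → UnitAddCircle

/-- The rotation vector `θ = (ϑ_1 / 2π, …, ϑ_L / 2π)` in the torus. -/
def torusFreq {L : ℕ} (ϑ : Fin L → ℝ) : Torus L :=
  fun l => ((ϑ l / (2 * Real.pi) : ℝ) : UnitAddCircle)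

/-- The isomorphism `ℝ/ℤ → ℝ/2πℤ`, `x ↦ 2π x`. -/
def turn : UnitAddCircle ≃+ Real.Angle :=
  AddCircle.equivAddCircle (1 : ℝ) (2 * Real.pi) one_ne_zero Real.two_pi_pos.ne'

theorem turn_coe (x : ℝ) : turn (x : UnitAddCircle) = ((2 * Real.pi * x : ℝ) : Real.Angle) := by
  rw [turn]
  erw [AddCircle.equivAddCircle_apply_mk]
  congr 1
  ring

/-- The map `Φ_q(x) = diag(r(-2π x_1), …, r(-2π x_L), 1, …, 1) q` from the torus to the sphere. -/
def phaseMap {L s : ℕ} (q : USphere L s) (x : Torus L) : USphere L s :=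
  ⟨WithLp.toLp 2 (blockRot s (fun l => turn (-x l)) *ᵥ WithLp.ofLp (q : Space L s)),
    blockRot_mulVec_mem _ q⟩

/-- The targets are the images of the multiples of `θ`. -/
theorem target_eq_phaseMap {L s : ℕ} (ϑ : Fin L → ℝ) (q : USphere L s) (i : ℤ) :
    target ϑ q i = phaseMap q (i • torusFreq ϑ) := by
  apply Subtype.ext
  simp only [target, phaseMap, ropeMatrix, blockRot_transpose]
  have h : (-fun l => (((i : ℝ) * ϑ l : ℝ) : Real.Angle)) =
      fun l => turn (-(i • torusFreq ϑ) l) := by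
    funext l
    rw [Pi.neg_apply, map_neg, Pi.smul_apply, map_zsmul, torusFreq, turn_coe,
      mul_div_cancel₀ _ Real.two_pi_pos.ne', ← Real.Angle.coe_zsmul, zsmul_eq_mul]
  rw [h]

/-- The closed subgroup `ℋ_q`, the closure of `{i θ mod 1 : i ∈ ℤ}` in the torus. -/
def phaseGroup {L : ℕ} (ϑ : Fin L → ℝ) : AddSubgroup (Torus L) :=
  (AddSubgroup.zmultiples (torusFreq ϑ)).topologicalClosure

instance {L : ℕ} (ϑ : Fin L → ℝ) : CompactSpace (phaseGroup ϑ) :=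
  isCompact_iff_compactSpace.mp
    (AddSubgroup.isClosed_topologicalClosure (AddSubgroup.zmultiples (torusFreq ϑ))).isCompact

/-- The Haar probability measure on `ℋ_q`: the Haar measure of total mass one. -/
def phaseHaar {L : ℕ} (ϑ : Fin L → ℝ) : Measure (phaseGroup ϑ) :=
  Measure.addHaarMeasure ⊤

/-- The phase law `π_q`, the image of the Haar probability measure of `ℋ_q` under `Φ_q`. -/
def phaseLaw {L s : ℕ} (ϑ : Fin L → ℝ) (q : USphere L s) : Measure (USphere L s) :=
  (phaseHaar ϑ).map fun h : phaseGroup ϑ => phaseMap q (h : Torus L)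

/-! ### Constants -/

/-- The critical exponent `α = 2 / (d - 1)`. -/
def critExp (d : ℕ) : ℝ := 2 / ((d : ℝ) - 1)

/-- Surface measure on the unit sphere of `ℝ^d`. -/
def surface (L s : ℕ) : Measure (USphere L s) := (volume : Measure (Space L s)).toSphere

instance (L s : ℕ) : IsFiniteMeasure (surface L s) := by
  unfold surface; infer_instance

/-- The surface area of the unit sphere `S^(k-1)` of `ℝ^k`. -/
def sphereArea (k : ℕ) : ℝ := (volume : Measure (EuclideanSpace ℝ (Fin k))).toSphere.real Set.univ

/-- The orbit average `C̄(q) = 2^(1/α) σ_(d-2) / (d - 1) ∫ ρ dπ_q`, where `σ_(d-2)` is the surface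
area of the unit sphere `S^(d-2)` of `ℝ^(d-1)`. -/
def orbitConst {L s : ℕ} (ϑ : Fin L → ℝ) (q : USphere L s) (ρ : USphere L s → ℝ≥0) : ℝ :=
  (2 : ℝ) ^ (1 / critExp (2 * L + s)) * sphereArea (2 * L + s - 1) / (((2 * L + s : ℕ) : ℝ) - 1) *
    ∫ u, (ρ u : ℝ) ∂(phaseLaw ϑ q)

theorem critExp_pos {d : ℕ} (hd : 2 ≤ d) : 0 < critExp d := by
  have : (2 : ℝ) ≤ d := by exact_mod_cast hd
  unfold critExp
  apply div_pos <;> linarith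

theorem orbitConst_nonneg {L s : ℕ} (hd : 2 ≤ 2 * L + s) (ϑ : Fin L → ℝ) (q : USphere L s)
    (ρ : USphere L s → ℝ≥0) : 0 ≤ orbitConst ϑ q ρ := by
  have h2 : (2 : ℝ) ≤ ((2 * L + s : ℕ) : ℝ) := by exact_mod_cast hd
  have h3 : (0 : ℝ) ≤ ((2 * L + s : ℕ) : ℝ) - 1 := by linarith
  have h4 : 0 ≤ sphereArea (2 * L + s - 1) := measureReal_nonneg
  have h5 : 0 ≤ ∫ u, (ρ u : ℝ) ∂(phaseLaw ϑ q) := integral_nonneg fun u => (ρ u).2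
  unfold orbitConst
  positivity

/-! ### Point processes on `ℝ₊` -/

/-- The measure `Λ` on `ℝ₊ = [0, ∞)` with `Λ([0, y]) = c (y / γ)^a`. -/
def powerIntensity (c γ a : ℝ) (hc : 0 ≤ c) (hγ : 0 < γ) (ha : 0 < a) : Measure ℝ≥0 :=
  StieltjesFunction.measure
    { toFun := fun y : ℝ≥0 => c * ((y : ℝ) / γ) ^ a
      mono' := fun x y hxy => by
        have hxy' : (x : ℝ) ≤ y := hxy
        dsimp only
        gcongr
      right_continuous' := fun x => by
        apply Continuous.continuousWithinAt
        exact continuous_const.mul ((Real.continuous_rpow_const ha.le).comp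
          (NNReal.continuous_coe.div_const γ)) }

theorem powerIntensity_Iic (c γ a : ℝ) (hc : 0 ≤ c) (hγ : 0 < γ) (ha : 0 < a) (y : ℝ≥0) :
    powerIntensity c γ a hc hγ ha (Set.Iic y) = ENNReal.ofReal (c * ((y : ℝ) / γ) ^ a) := by
  have h : (Set.Iic y : Set ℝ≥0) = Set.Icc 0 y := by ext; simp
  have hbot : 𝓝[<] (0 : ℝ≥0) = ⊥ := by
    rw [show Set.Iio (0 : ℝ≥0) = ∅ by ext; simp, nhdsWithin_empty]
  rw [h, powerIntensity, StieltjesFunction.measure_Icc, leftLim_eq_of_eq_bot _ hbot]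
  congr 1
  change c * ((y : ℝ) / γ) ^ a - c * (((0 : ℝ≥0) : ℝ) / γ) ^ a = _
  simp [Real.zero_rpow ha.ne']

/-- `𝒳` is a Poisson point process on `ℝ₊` with intensity measure `Λ`: a random boundedly finite
counting measure whose value on a measurable set `B` with `Λ(B) < ∞` has the Poisson law of mean
`Λ(B)`, and whose values on disjoint such sets are independent. -/
structure IsPoissonPointProcess {Ω : Type*} [MeasurableSpace Ω] (𝒳 : Ω → Measure ℝ≥0)
    (Λ : Measure ℝ≥0) (P : Measure Ω) : Prop where
  measurable : Measurable 𝒳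
  counting : ∀ ω, ∀ B : Set ℝ≥0, MeasurableSet B → Bornology.IsBounded B → ∃ k : ℕ, 𝒳 ω B = k
  law : ∀ B : Set ℝ≥0, MeasurableSet B → Λ B < ∞ →
    P.map (fun ω => 𝒳 ω B) = (poissonMeasure (Λ B).toNNReal).map (fun k : ℕ => (k : ℝ≥0∞))
  indep : ∀ (k : ℕ) (B : Fin k → Set ℝ≥0), (∀ i, MeasurableSet (B i)) → (∀ i, Λ (B i) < ∞) →
    Pairwise (fun i j => Disjoint (B i) (B j)) → iIndepFun (fun i ω => 𝒳 ω (B i)) P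

/-- The `j`-th arrival of a measure on `ℝ₊`, counting from `j = 0` and with multiplicity: the least
`y` such that `[0, y]` has mass at least `j + 1`. -/
def arrival (μ : Measure ℝ≥0) (j : ℕ) : ℝ≥0 := sInf {y : ℝ≥0 | (j : ℝ≥0∞) + 1 ≤ μ (Set.Iic y)}

/-- The limiting weights `e^(-Y_j) / ∑_l e^(-Y_l)`, where `Y_0, Y_1, …` are the arrivals. -/
def limitWeight (μ : Measure ℝ≥0) (j : ℕ) : ℝ :=
  Real.exp (-(arrival μ j : ℝ)) / ∑' l : ℕ, Real.exp (-(arrival μ l : ℝ))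

/-! ### Attention weights -/

/-- The distance `U_i = 1 - ⟨u_i, x_i⟩` of the key `x_i` to its target. -/
def dist2target {L s : ℕ} (ϑ : Fin L → ℝ) (q : USphere L s) (x : ℤ → USphere L s) (i : ℤ) : ℝ :=
  1 - inner ℝ (target ϑ q i : Space L s) (x i : Space L s)

/-- The attention weights `A_1, …, A_n` at inverse temperature `b`; `A_(i+1)` is the value at
`i : Fin n`. -/
def weight {L s : ℕ} (ϑ : Fin L → ℝ) (q : USphere L s) (x : ℤ → USphere L s) (b : ℝ) (n : ℕ)
    (i : Fin n) : ℝ :=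
  Real.exp (-b * dist2target ϑ q x ((i : ℤ) + 1)) /
    ∑ j : Fin n, Real.exp (-b * dist2target ϑ q x ((j : ℤ) + 1))

/-- The `j`-th largest entry of a finite family, counting from `j = 0` and with multiplicity; it is
`0` if the family has at most `j` entries. -/
def nthLargest {n : ℕ} (a : Fin n → ℝ) (j : ℕ) : ℝ :=
  if h : j < n then a (Tuple.sort (fun i => -a i) ⟨j, h⟩) else 0

/-! ### Assumptions on the keys -/

/-- The keys `(x_i)_{i ∈ ℤ}` form a stationary `m`-dependent sequence in the sphere, their common
law has density `ρ` with respect to surface measure, and the local density and anti-clustering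
bounds hold near the orbit closure. -/
structure CorrelatedKeys {L s : ℕ} (ϑ : Fin L → ℝ) (q : USphere L s) {Ω : Type*}
    [MeasurableSpace Ω] (P : Measure Ω) (x : ℤ → Ω → USphere L s) (m : ℕ)
    (ρ : USphere L s → ℝ≥0) : Prop where
  measurable : ∀ i, Measurable (x i)
  stationary : ∀ (r : ℕ) (κ : Fin r → ℤ) (h : ℤ),
    P.map (fun ω j => x (κ j) ω) = P.map (fun ω j => x (κ j + h) ω)
  m_dependent : ∀ I J : Set ℤ, (∀ i ∈ I, ∀ j ∈ J, (m : ℤ) < |i - j|) →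
    IndepFun (fun ω (i : I) => x i ω) (fun ω (j : J) => x j ω) P
  density_measurable : Measurable ρ
  density : ∀ i, P.map (x i) = (surface L s).withDensity fun u => (ρ u : ℝ≥0∞)
  density_local : ∃ V : Set (USphere L s), IsOpen V ∧ orbitClosure ϑ q ⊆ V ∧
    ContinuousOn ρ V ∧ ∀ u ∈ V, 0 < ρ u
  anti_clustering : ∀ l : ℕ, 1 ≤ l → l ≤ m → ∃ g : USphere L s × USphere L s → ℝ≥0∞,
    Measurable g ∧
    P.map (fun ω => (x 0 ω, x l ω)) = ((surface L s).prod (surface L s)).withDensity g ∧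
    ∃ V : Set (USphere L s × USphere L s), IsOpen V ∧ orbitClosure ϑ q ×ˢ orbitClosure ϑ q ⊆ V ∧
      ∃ M : ℝ≥0, ∀ p ∈ V, g p ≤ M

end RopeAttention

end

noncomputable section

namespace RopeAttention

/-! The attention weights are the normalized exponentials of the rescaled distances `β n * U_i`, so
they depend only on the point process that these form on the half-line. It is enough to show that
this process converges to a Poisson process and that distant points carry little exponential mass,
uniformly in `n`.

Poisson limit. A point falls in [0, y] when its key lies in the spherical cap of height y / β n
around its target. To first order this cap has area ballVol (d-1) * (2y / β n)^((d-1)/2), by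
`surface_cap_bounds`, which is of order 1/n at the critical scaling. By continuity of ρ near the
orbit closure, the probability is about ρ(u_i) times that area, uniformly in i. Summation over i
produces the average of ρ along the targets, an orbit average in the compact group generated by θ;
equidistribution (`tendsto_orbit_average`) identifies its limit as the integral against π_q. The
characteristic function of the counts in finitely many cells is the expectation of a product of
factors 1 + X_i in the unit disc, where X_i vanishes unless the i-th point lies in a bounded window.
Replacing the expectation of the product by the product of expectations involves, for each factor,
only its m predecessors. The bounded joint densities make this cost O(1/n²) per factor, and the
limit is exp(lim ∑ E X_i), the Poisson characteristic function (`tendsto_integral_prod_exp`).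

From points to weights. The weights are approximated by a function of the counts on a grid of mesh
1/r in [0, r]. Rounding changes an exponential by a factor at most e^(1/r); the mean mass beyond r
is the tail of a convergent series, because mean counts in [0, y] grow polynomially, uniformly in n;
and the denominator is at least e^(-K) unless [0, K] is empty, which is unlikely for large K
(`HasWeights.enorm_sub_le`). The approximation is discontinuous, but count vectors live on a closed
discrete lattice, where every bounded function is a valid test function
(`tendsto_integral_of_lattice`). `tendstoInDistribution_weights` combines these estimates.

Structure of the limit. Positivity of ρ makes the intensity infinite in total, so there are
infinitely many points; two points in a small cell have probability of second order, so all are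
simple; a finite mean of the exponential mass on (0, ∞) gives summability. -/

/-! ### Equidistribution in compact monothetic groups -/

/-- Along a dense cyclic subgroup of a compact group, orbit averages of a continuous function
converge to its Haar integral. -/
theorem tendsto_orbit_average {G : Type*} [NormedAddCommGroup G] [CompactSpace G]
    [MeasurableSpace G] [BorelSpace G] (μ : Measure G) [IsProbabilityMeasure μ]
    [μ.IsAddLeftInvariant] {g : G} (hg : Dense (AddSubgroup.zmultiples g : Set G))
    {f : G → ℝ} (hf : Continuous f) :
    Tendsto (fun n : ℕ => (∑ i : Fin n, f ((((i : ℕ) : ℤ) + 1) • g)) / n) atTop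
      (𝓝 (∫ h, f h ∂μ)) := by
  obtain ⟨M, hM⟩ : ∃ M, ∀ h, |f h| ≤ M := by
    obtain ⟨M, hM⟩ := (isCompact_univ (X := G)).exists_bound_of_continuousOn hf.continuousOn
    exact ⟨M, fun h => hM h (Set.mem_univ h)⟩
  have hint : ∀ a : G, Integrable (fun h => f (h + a)) μ := fun a =>
    Integrable.of_bound (hf.comp (continuous_add_const a)).aestronglyMeasurable M
      (ae_of_all _ fun h => hM _)
  -- Orbit sums started at an arbitrary `h`. Their Haar mean is exactly `n * ∫ f`, so it suffices
  -- that `S n h` varies with `h` by o(n).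
  let S : ℕ → G → ℝ := fun n h => ∑ i ∈ Finset.range n, f (h + (((i : ℤ) + 1) • g))
  have hSint : ∀ n, ∫ h, S n h ∂μ = n * ∫ h, f h ∂μ := by
    intro n
    rw [integral_finsetSum _ fun i _ => hint _]
    have : ∀ a : G, ∫ h, f (h + a) ∂μ = ∫ h, f h ∂μ := fun a => by
      simp_rw [add_comm _ a]
      exact integral_add_left_eq_self f a
    simp [this]
  -- A shift of the start by `g` telescopes to two boundary terms, so the bound does not grow with
  -- `n`.
  have hShift : ∀ n h, |S n (h + g) - S n h| ≤ 2 * M := by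
    intro n h
    have : S n (h + g) - S n h =
        f (h + ((n : ℤ) + 1) • g) - f (h + ((0 : ℤ) + 1) • g) := by
      have := Finset.sum_range_sub (fun i : ℕ => f (h + ((i : ℤ) + 1) • g)) n
      simp only [S]
      rw [← Finset.sum_sub_distrib]
      convert this using 1
      · refine Finset.sum_congr rfl fun i _ => ?_
        congr 2
        push_cast
        module
      · simp
    rw [this]
    calc _ ≤ _ := abs_sub _ _
      _ ≤ 2 * M := by linarith [hM (h + ((n : ℤ) + 1) • g), hM (h + ((0 : ℤ) + 1) • g)]
  have hM0 : 0 ≤ M := (abs_nonneg _).trans (hM 0)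
  have hShiftNat : ∀ (k : ℕ) n h, |S n (h + (k : ℤ) • g) - S n h| ≤ k * (2 * M) := by
    intro k n h
    induction k with
    | zero => simp
    | succ k ih =>
      have h1 := hShift n (h + (k : ℤ) • g)
      have h2 : h + (k : ℤ) • g + g = h + ((k + 1 : ℕ) : ℤ) • g := by
        push_cast
        rw [add_smul _ _ g, one_smul, add_assoc]
      rw [h2] at h1
      have h3 := abs_sub_le (S n (h + ((k + 1 : ℕ) : ℤ) • g)) (S n (h + (k : ℤ) • g)) (S n h)
      push_cast at *
      linarith
  have hShiftInt : ∀ (k : ℤ) n, |S n (k • g) - S n 0| ≤ k.natAbs * (2 * M) := by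
    intro k n
    rcases Int.natAbs_eq k with hk | hk
    · have := hShiftNat k.natAbs n 0
      rwa [← hk, zero_add] at this
    · have := hShiftNat k.natAbs n (k • g)
      have h0 : k • g + (k.natAbs : ℤ) • g = 0 := by
        nth_rewrite 1 [hk]
        rw [← add_smul, neg_add_cancel, zero_smul]
      rw [h0, abs_sub_comm] at this
      exact this
  have huc := CompactSpace.uniformContinuous_of_continuous hf
  rw [Metric.tendsto_atTop]
  intro ε hε
  obtain ⟨δ, hδ, hfδ⟩ := Metric.uniformContinuous_iff.1 huc (ε / 4) (by positivity)
  -- Density and compactness give a finite δ-net of multiples of `g`. Moving `h` to the net costs `n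
  -- * (ε / 4)` by uniform continuity, and moving along the net to 0 costs at most the constant `B`.
  have hcover : (Set.univ : Set G) ⊆ ⋃ k : ℤ, Metric.ball (k • g) δ := by
    intro h _
    obtain ⟨_, ⟨k, rfl⟩, hk⟩ := hg.exists_dist_lt h hδ
    exact Set.mem_iUnion.2 ⟨k, hk⟩
  obtain ⟨J, hJ⟩ := isCompact_univ.elim_finite_subcover _ (fun _ => Metric.isOpen_ball) hcover
  let B : ℝ := ∑ k ∈ J, k.natAbs * (2 * M)
  have hB0 : 0 ≤ B := Finset.sum_nonneg fun k _ => by positivity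
  have hclose : ∀ n h, |S n h - S n 0| ≤ n * (ε / 4) + B := by
    intro n h
    obtain ⟨k, hk, hkh⟩ := Set.mem_iUnion₂.1 (hJ (Set.mem_univ h))
    have h1 : |S n h - S n (k • g)| ≤ n * (ε / 4) := by
      simp only [S]
      rw [← Finset.sum_sub_distrib]
      refine (Finset.abs_sum_le_sum_abs _ _).trans ?_
      refine (Finset.sum_le_card_nsmul _ _ (ε / 4) fun i _ => ?_).trans (by simp)
      have := hfδ (a := h + ((i : ℤ) + 1) • g) (b := k • g + ((i : ℤ) + 1) • g)
        (by rw [dist_add_right]; exact hkh)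
      exact this.le
    have h2 : (k.natAbs : ℝ) * (2 * M) ≤ B :=
      Finset.single_le_sum (f := fun k : ℤ => (k.natAbs : ℝ) * (2 * M))
        (fun k _ => by positivity) hk
    linarith [hShiftInt k n, abs_sub_le (S n h) (S n (k • g)) (S n 0)]
  obtain ⟨N, hN⟩ := exists_nat_gt (4 * B / ε)
  refine ⟨N + 1, fun n hn => ?_⟩
  have hn0 : (0 : ℝ) < n := by exact_mod_cast (by omega : 0 < n)
  have hnB : B < n * (ε / 4) := by
    have h1 : (N : ℝ) ≤ n := by exact_mod_cast (by omega : N ≤ n)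
    have h2 := hN.trans_le h1
    rw [div_lt_iff₀ hε] at h2
    linarith
  -- Averaging `hclose` over `h` compares the orbit sum started at 0 with its Haar mean.
  have hmain : |n * ∫ h, f h ∂μ - S n 0| ≤ n * (ε / 4) + B := by
    have h1 : n * ∫ h, f h ∂μ - S n 0 = ∫ h, (S n h - S n 0) ∂μ := by
      rw [integral_sub (integrable_finsetSum _ fun i _ => hint _) (integrable_const _), hSint]
      simp
    rw [h1]
    have := norm_integral_le_of_norm_le_const (μ := μ) (f := fun h => S n h - S n 0)
      (ae_of_all _ fun h => hclose n h)
    simpa using this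
  have hsum : ∑ i : Fin n, f ((((i : ℕ) : ℤ) + 1) • g) = S n 0 := by
    simp only [S, zero_add]
    exact Fin.sum_univ_eq_sum_range (fun i : ℕ => f (((i : ℤ) + 1) • g)) n
  rw [hsum, Real.dist_eq, div_sub' hn0.ne', abs_div, abs_of_pos hn0, div_lt_iff₀ hn0,
    abs_sub_comm]
  nlinarith

/-! ### The phase map and averages along the targets -/

theorem continuous_turn : Continuous turn :=
  (AddCircle.homeomorphAddCircle (1 : ℝ) (2 * Real.pi) one_ne_zero Real.two_pi_pos.ne').continuous

theorem continuous_phaseMap {L s : ℕ} (q : USphere L s) :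
    Continuous (phaseMap q : Torus L → USphere L s) := by
  refine Continuous.subtype_mk ((PiLp.continuous_toLp 2 _).comp
    (Continuous.matrix_mulVec ?_ continuous_const)) _
  refine Continuous.matrix_fromBlocks (Continuous.matrix_blockDiagonal ?_) continuous_const
    continuous_const continuous_const
  refine continuous_pi fun l => continuous_matrix fun i j => ?_
  have h : Continuous fun x : Torus L => turn (-x l) :=
    continuous_turn.comp (continuous_apply l).neg
  have hc := Real.Angle.continuous_cos.comp h
  have hs := Real.Angle.continuous_sin.comp h
  fin_cases i <;> fin_cases j
  exacts [hc, hs.neg, hs, hc]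

theorem phaseMap_mem_orbitClosure {L s : ℕ} (ϑ : Fin L → ℝ) (q : USphere L s)
    (h : phaseGroup ϑ) : phaseMap q (h : Torus L) ∈ orbitClosure ϑ q := by
  refine map_mem_closure (continuous_phaseMap q) h.2 ?_
  rintro _ ⟨i, rfl⟩
  exact ⟨i, target_eq_phaseMap ϑ q i⟩

theorem target_mem_orbitClosure {L s : ℕ} (ϑ : Fin L → ℝ) (q : USphere L s) (i : ℤ) :
    target ϑ q i ∈ orbitClosure ϑ q :=
  subset_closure ⟨i, rfl⟩

theorem isCompact_orbitClosure {L s : ℕ} (ϑ : Fin L → ℝ) (q : USphere L s) :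
    IsCompact (orbitClosure ϑ q) :=
  isClosed_closure.isCompact

instance {L : ℕ} (ϑ : Fin L → ℝ) : IsProbabilityMeasure (phaseHaar ϑ) :=
  ⟨Measure.addHaarMeasure_self⟩

instance {L : ℕ} (ϑ : Fin L → ℝ) : (phaseHaar ϑ).IsAddLeftInvariant := by
  unfold phaseHaar; infer_instance

/-- The generator of `ℋ_q`. -/
def phaseGen {L : ℕ} (ϑ : Fin L → ℝ) : phaseGroup ϑ :=
  ⟨torusFreq ϑ, AddSubgroup.le_topologicalClosure _ (AddSubgroup.mem_zmultiples _)⟩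

theorem dense_zmultiples_phaseGen {L : ℕ} (ϑ : Fin L → ℝ) :
    Dense (AddSubgroup.zmultiples (phaseGen ϑ) : Set (phaseGroup ϑ)) := by
  refine Subtype.dense_iff.2 fun x hx => closure_mono ?_ hx
  rintro _ ⟨i, rfl⟩
  exact ⟨i • phaseGen ϑ, ⟨i, rfl⟩, rfl⟩

/-- A continuous function on the orbit closure averages along the targets to its integral
against the phase law. -/
theorem tendsto_target_average {L s : ℕ} (ϑ : Fin L → ℝ) (q : USphere L s) {ρ : USphere L s → ℝ}
    (hm : Measurable ρ) (hρ : ContinuousOn ρ (orbitClosure ϑ q)) :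
    Tendsto (fun n : ℕ => (∑ i : Fin n, ρ (target ϑ q (((i : ℕ) : ℤ) + 1))) / n) atTop
      (𝓝 (∫ u, ρ u ∂(phaseLaw ϑ q))) := by
  have hcont : Continuous fun h : phaseGroup ϑ => phaseMap q (h : Torus L) :=
    (continuous_phaseMap q).comp continuous_subtype_val
  have hf : Continuous fun h : phaseGroup ϑ => ρ (phaseMap q (h : Torus L)) :=
    hρ.comp_continuous hcont (phaseMap_mem_orbitClosure ϑ q)
  have := tendsto_orbit_average (phaseHaar ϑ) (dense_zmultiples_phaseGen ϑ) hf
  rw [phaseLaw, integral_map hcont.measurable.aemeasurable hm.aestronglyMeasurable]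
  simp_rw [target_eq_phaseMap]
  exact this

/-! ### The area of spherical caps -/

/-- The volume of the unit ball of `ℝ^k`. -/
def ballVol (k : ℕ) : ℝ := (volume : Measure (EuclideanSpace ℝ (Fin k))).real (Metric.ball 0 1)

theorem ballVol_pos (k : ℕ) : 0 < ballVol k :=
  ENNReal.toReal_pos (Metric.measure_ball_pos _ _ one_pos).ne' measure_ball_lt_top.ne

theorem sphereArea_eq (k : ℕ) : sphereArea k = k * ballVol k := by
  simp [sphereArea, ballVol]

theorem volume_sum_sq_le (k : ℕ) {R : ℝ} (hR : 0 ≤ R) :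
    volume {w : Fin k → ℝ | ∑ i, w i ^ 2 ≤ R ^ 2} = ENNReal.ofReal (R ^ k * ballVol k) := by
  have hpre : (WithLp.toLp 2 : (Fin k → ℝ) → EuclideanSpace ℝ (Fin k)) ⁻¹' Metric.closedBall 0 R =
      {w : Fin k → ℝ | ∑ i, w i ^ 2 ≤ R ^ 2} := by
    ext w
    simp only [Set.mem_preimage, mem_closedBall_zero_iff, Set.mem_ofPred_eq]
    rw [← abs_of_nonneg hR, ← abs_of_nonneg (norm_nonneg (WithLp.toLp 2 w)), ← sq_le_sq,
      EuclideanSpace.real_norm_sq_eq, abs_of_nonneg hR]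
  rw [← hpre, (PiLp.volume_preserving_toLp (Fin k)).measure_preimage
    Metric.isClosed_closedBall.measurableSet.nullMeasurableSet,
    Measure.addHaar_closedBall _ _ hR, ENNReal.ofReal_mul (by positivity), ballVol,
    ofReal_measureReal measure_ball_lt_top.ne, finrank_euclideanSpace_fin]

/-- Fubini along the axis: the slice at height `a` is a ball of radius `τ * a`. -/
theorem volume_cone (k : ℕ) {τ h : ℝ} (hτ : 0 ≤ τ) (hh : 0 ≤ h) :
    volume {z : ℝ × (Fin k → ℝ) | (0 < z.1 ∧ z.1 < h) ∧ ∑ i, z.2 i ^ 2 ≤ (τ * z.1) ^ 2} =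
      ENNReal.ofReal (ballVol k * τ ^ k * h ^ (k + 1) / (k + 1)) := by
  have hmeas : MeasurableSet
      {z : ℝ × (Fin k → ℝ) | (0 < z.1 ∧ z.1 < h) ∧ ∑ i, z.2 i ^ 2 ≤ (τ * z.1) ^ 2} := by
    measurability
  have hκ := ballVol_pos k
  rw [Measure.volume_eq_prod, Measure.prod_apply hmeas]
  have hfib : ∀ a : ℝ, volume (Prod.mk a ⁻¹'
      {z : ℝ × (Fin k → ℝ) | (0 < z.1 ∧ z.1 < h) ∧ ∑ i, z.2 i ^ 2 ≤ (τ * z.1) ^ 2}) =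
      (Set.Ioo 0 h).indicator (fun a => ENNReal.ofReal ((τ * a) ^ k * ballVol k)) a := by
    intro a
    by_cases ha : a ∈ Set.Ioo 0 h
    · rw [Set.indicator_of_mem ha, ← volume_sum_sq_le k (mul_nonneg hτ ha.1.le)]
      congr 1
      ext w
      simp [ha.1, ha.2]
    · rw [Set.indicator_of_notMem ha]
      convert measure_empty (μ := volume)
      ext w
      simp only [Set.mem_preimage, Set.mem_ofPred_eq, Set.mem_empty_iff_false, iff_false, not_and]
      exact fun h' => absurd h' ha
  simp_rw [hfib]
  rw [lintegral_indicator measurableSet_Ioo,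
    ← ofReal_integral_eq_lintegral_ofReal, ← integral_Ioc_eq_integral_Ioo,
    ← intervalIntegral.integral_of_le hh]
  · congr 1
    simp_rw [mul_pow]
    rw [intervalIntegral.integral_mul_const, intervalIntegral.integral_const_mul, integral_pow]
    simp
    ring
  · exact (Continuous.integrableOn_Icc (by fun_prop)).mono_set Set.Ioo_subset_Icc_self
  · refine (ae_restrict_iff' measurableSet_Ioo).2 (ae_of_all _ fun a ha => ?_)
    have := ha.1
    positivity

/-- Orthonormal coordinates adapted to a unit vector preserve volume. -/
theorem exists_adapted_coords {E : Type*} [NormedAddCommGroup E] [InnerProductSpace ℝ E]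
    [FiniteDimensional ℝ E] [MeasurableSpace E] [BorelSpace E] {k : ℕ}
    (hk : Module.finrank ℝ E = k + 1) {u : E} (hu : ‖u‖ = 1) :
    ∃ Ψ : E → ℝ × (Fin k → ℝ), MeasurePreserving Ψ ∧ (∀ v, (Ψ v).1 = inner ℝ u v) ∧
      ∀ v, ∑ i, (Ψ v).2 i ^ 2 = ‖v‖ ^ 2 - inner ℝ u v ^ 2 := by
  obtain ⟨b, hb⟩ := Orthonormal.exists_orthonormalBasis_extension_of_card_eq (𝕜 := ℝ)
    (ι := Fin (k + 1)) (E := E) (by simp [hk]) (v := fun _ => u) (s := {0})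
    (by
      rw [orthonormal_iff_ite]
      rintro ⟨i, rfl⟩ ⟨j, rfl⟩
      simp [hu])
  have hb0 : b 0 = u := hb 0 rfl
  let e := MeasurableEquiv.piFinSuccAbove (fun _ : Fin (k + 1) => ℝ) 0
  have he : ∀ v : E, e (WithLp.ofLp (b.repr v)) = (inner ℝ u v, fun i => b.repr v i.succ) := by
    intro v
    ext i
    · change b.repr v 0 = _
      rw [b.repr_apply_apply, hb0]
    · rfl
  refine ⟨fun v => e (WithLp.ofLp (b.repr v)), ?_, fun v => congrArg Prod.fst (he v), fun v => ?_⟩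
  · exact (volume_preserving_piFinSuccAbove (fun _ : Fin (k + 1) => ℝ) 0).comp
      ((PiLp.volume_preserving_ofLp (Fin (k + 1))).comp b.measurePreserving_repr)
  · beta_reduce
    rw [he, ← b.repr.norm_map v, EuclideanSpace.real_norm_sq_eq, Fin.sum_univ_succ]
    have : b.repr v 0 = inner ℝ u v := by rw [b.repr_apply_apply, hb0]
    rw [this]
    simp

/-- The spherical cap of height `t` around `u`. -/
def cap {L s : ℕ} (u : USphere L s) (t : ℝ) : Set (USphere L s) :=
  {x | 1 - inner ℝ (u : Space L s) (x : Space L s) ≤ t}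

theorem isClosed_cap {L s : ℕ} (u : USphere L s) (t : ℝ) : IsClosed (cap u t) :=
  isClosed_le (by fun_prop) continuous_const

open scoped Pointwise in
-- Surface measure is the dimension times the volume of the radial sector, so describing the sector
-- by inequalities turns cap areas into volumes.
theorem smul_cap_eq {L s : ℕ} (u : USphere L s) (t : ℝ) :
    (Set.Ioo (0 : ℝ) 1 • ((↑) '' cap u t : Set (Space L s))) =
      {v | (0 < ‖v‖ ∧ ‖v‖ < 1) ∧ (1 - t) * ‖v‖ ≤ inner ℝ (u : Space L s) v} := by
  ext v
  simp only [Set.mem_smul, Set.mem_image, Set.mem_ofPred_eq]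
  constructor
  · rintro ⟨r, ⟨hr0, hr1⟩, _, ⟨x, hx, rfl⟩, rfl⟩
    have hx1 : ‖(x : Space L s)‖ = 1 := mem_sphere_zero_iff_norm.1 x.2
    have hx' : 1 - inner ℝ (u : Space L s) (x : Space L s) ≤ t := hx
    rw [norm_smul, hx1, mul_one, Real.norm_of_nonneg hr0.le, inner_smul_right]
    exact ⟨⟨hr0, hr1⟩, by nlinarith⟩
  · rintro ⟨⟨h0, h1⟩, h⟩
    refine ⟨‖v‖, ⟨h0, h1⟩, ‖v‖⁻¹ • v, ⟨⟨‖v‖⁻¹ • v, ?_⟩, ?_, rfl⟩, ?_⟩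
    · rw [mem_sphere_zero_iff_norm, norm_smul, norm_inv, norm_norm, inv_mul_cancel₀ h0.ne']
    · change 1 - inner ℝ (u : Space L s) (‖v‖⁻¹ • v) ≤ t
      rw [inner_smul_right]
      have : 1 - t ≤ ‖v‖⁻¹ * inner ℝ (u : Space L s) v := by
        rw [inv_mul_eq_div, le_div_iff₀ h0]
        exact h
      linarith
    · rw [smul_smul, mul_inv_cancel₀ h0.ne', one_smul]

/-- The sector over the cap is a solid cone cut off by the unit sphere. It contains the cone cut off
at axial height `1 - t` and is contained in the cone cut off at axial height 1. The two volumes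
agree to leading order as `t → 0` and do not depend on `u`, which is the source of all later
uniformity. -/
theorem surface_cap_bounds {L s k : ℕ} (hk : 2 * L + s = k + 1) (u : USphere L s) {t : ℝ}
    (ht0 : 0 ≤ t) (ht1 : t < 1) :
    ballVol k * (√(1 - (1 - t) ^ 2)) ^ k * (1 - t) ≤ (surface L s).real (cap u t) ∧
      (surface L s).real (cap u t) ≤ ballVol k * (√(1 - (1 - t) ^ 2)) ^ k / (1 - t) ^ k := by
  have hu : ‖(u : Space L s)‖ = 1 := mem_sphere_zero_iff_norm.1 u.2
  have hdim : Module.finrank ℝ (Space L s) = k + 1 := by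
    rw [finrank_euclideanSpace]
    simp
    omega
  obtain ⟨Ψ, hΨ, hΨ1, hΨ2⟩ := exists_adapted_coords hdim hu
  set c := 1 - t with hc
  have hc0 : 0 < c := by linarith
  have hc1 : c ≤ 1 := by linarith
  -- The tangent of the angular radius of the cap, whose cosine is `c`.
  set τ := √(1 - c ^ 2) / c with hτ
  have hτ0 : 0 ≤ τ := by positivity
  have hτ2 : τ ^ 2 * c ^ 2 = 1 - c ^ 2 := by
    rw [hτ, div_pow, Real.sq_sqrt (by nlinarith), div_mul_cancel₀ _ (by positivity)]
  have hκ := ballVol_pos k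
  have hcone : ∀ h : ℝ, 0 ≤ h → volume {v : Space L s |
      (0 < inner ℝ (u : Space L s) v ∧ inner ℝ (u : Space L s) v < h) ∧
        ‖v‖ ^ 2 - inner ℝ (u : Space L s) v ^ 2 ≤ (τ * inner ℝ (u : Space L s) v) ^ 2} =
      ENNReal.ofReal (ballVol k * τ ^ k * h ^ (k + 1) / (k + 1)) := by
    intro h hh
    rw [← volume_cone k hτ0 hh, ← hΨ.measure_preimage]
    · congr 1
      ext v
      simp only [Set.mem_preimage, Set.mem_ofPred_eq, hΨ1, hΨ2]
    · apply MeasurableSet.nullMeasurableSet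
      measurability
  have hsurf : (surface L s).real (cap u t) = (k + 1) *
      volume.real {v : Space L s | (0 < ‖v‖ ∧ ‖v‖ < 1) ∧ c * ‖v‖ ≤ inner ℝ (u : Space L s) v} := by
    rw [measureReal_def, surface, Measure.toSphere_apply' _ (isClosed_cap u t).measurableSet,
      smul_cap_eq, hdim, ENNReal.toReal_mul, measureReal_def,
      ENNReal.toReal_natCast, Nat.cast_add_one, ← hc]
  have hcs : ∀ v : Space L s, inner ℝ (u : Space L s) v ≤ ‖v‖ := fun v => by
    simpa [hu] using real_inner_le_norm (u : Space L s) v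
  have hfin : volume {v : Space L s | (0 < ‖v‖ ∧ ‖v‖ < 1) ∧
      c * ‖v‖ ≤ inner ℝ (u : Space L s) v} ≠ ∞ := by
    refine ((measure_mono ?_).trans_lt (measure_ball_lt_top (x := (0 : Space L s)) (r := 1))).ne
    intro v hv
    simpa using hv.1.2
  rw [hsurf]
  have hk1 : (0 : ℝ) < k + 1 := by positivity
  constructor
  · have h1 := ENNReal.toReal_mono hfin ((hcone c hc0.le).symm.le.trans (measure_mono (by
      rintro v ⟨⟨h0, h1⟩, h2⟩
      have h3 : (c * ‖v‖) ^ 2 ≤ inner ℝ (u : Space L s) v ^ 2 := by nlinarith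
      have h4 : c * ‖v‖ ≤ inner ℝ (u : Space L s) v := by
        have := abs_le_of_sq_le_sq' h3 h0.le
        exact this.2
      refine ⟨⟨h0.trans_le (hcs v), ?_⟩, h4⟩
      nlinarith)))
    rw [ENNReal.toReal_ofReal (by positivity)] at h1
    rw [measureReal_def]
    have h2 : ballVol k * √(1 - c ^ 2) ^ k * c =
        (k + 1) * (ballVol k * τ ^ k * c ^ (k + 1) / (k + 1)) := by
      rw [hτ, div_pow]
      field_simp
      ring
    rw [h2]
    gcongr
  · have h1 := ENNReal.toReal_mono (ENNReal.ofReal_ne_top) ((measure_mono (show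
        {v : Space L s | (0 < ‖v‖ ∧ ‖v‖ < 1) ∧ c * ‖v‖ ≤ inner ℝ (u : Space L s) v} ⊆ _ by
      rintro v ⟨⟨h0, h1⟩, h2⟩
      have h3 : 0 < inner ℝ (u : Space L s) v := (mul_pos hc0 h0).trans_le h2
      refine ⟨⟨h3, (hcs v).trans_lt h1⟩, ?_⟩
      have h4 : c ^ 2 * ‖v‖ ^ 2 ≤ inner ℝ (u : Space L s) v ^ 2 := by
        rw [← mul_pow]
        gcongr
      have h5 : c ^ 2 * (‖v‖ ^ 2 - inner ℝ (u : Space L s) v ^ 2) ≤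
          c ^ 2 * (τ * inner ℝ (u : Space L s) v) ^ 2 := by nlinarith
      exact le_of_mul_le_mul_left h5 (by positivity))).trans (hcone 1 zero_le_one).le)
    rw [ENNReal.toReal_ofReal (by positivity)] at h1
    rw [measureReal_def]
    have h2 : ballVol k * √(1 - c ^ 2) ^ k / c ^ k =
        (k + 1) * (ballVol k * τ ^ k * 1 ^ (k + 1) / (k + 1)) := by
      rw [hτ, div_pow, one_pow]
      field_simp
    rw [h2]
    gcongr

/-! ### Products of `m`-dependent factors close to one -/

/-- Telescoping: partial products stay in the unit disc, so appending the factor `1 + x i` moves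
them by at most `‖x i‖`. -/
theorem norm_prod_one_add_sub_le {x : ℕ → ℂ} (hx : ∀ i, ‖1 + x i‖ ≤ 1) {l j : ℕ} (hlj : l ≤ j) :
    ‖∏ i ∈ Finset.range j, (1 + x i) - ∏ i ∈ Finset.range l, (1 + x i)‖ ≤
      ∑ i ∈ Finset.Ico l j, ‖x i‖ := by
  induction j, hlj using Nat.le_induction with
  | base => simp
  | succ j hj ih =>
    rw [Finset.prod_range_succ, Finset.sum_Ico_succ_top hj]
    have h1 : ‖∏ i ∈ Finset.range j, (1 + x i)‖ ≤ 1 := by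
      rw [norm_prod]
      exact Finset.prod_le_one (fun _ _ => norm_nonneg _) fun i _ => hx i
    calc _ = ‖(∏ i ∈ Finset.range j, (1 + x i) - ∏ i ∈ Finset.range l, (1 + x i)) +
          (∏ i ∈ Finset.range j, (1 + x i)) * x j‖ := by ring_nf
      _ ≤ _ := (norm_add_le _ _).trans (add_le_add ih (by
        rw [norm_mul]
        exact mul_le_of_le_one_left (norm_nonneg _) h1))

/-- Since `‖1 + e i‖ ≤ 1` forces Re(e i) ≤ 0, the exponentials lie in the unit disc as well. Factors
can then be exchanged one at a time, each at cost |exp z - 1 - z| ≤ |z|². -/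
theorem norm_prod_sub_exp_sum_le {e : ℕ → ℂ} {n : ℕ} (he : ∀ i < n, ‖1 + e i‖ ≤ 1)
    (he1 : ∀ i < n, ‖e i‖ ≤ 1) :
    ‖∏ i ∈ Finset.range n, (1 + e i) - Complex.exp (∑ i ∈ Finset.range n, e i)‖ ≤
      ∑ i ∈ Finset.range n, ‖e i‖ ^ 2 := by
  induction n with
  | zero => simp
  | succ n ih =>
    have ih' := ih (fun i hi => he i (by omega)) (fun i hi => he1 i (by omega))
    have hexp : ∀ i < n + 1, ‖Complex.exp (e i)‖ ≤ 1 := fun i hi => by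
      rw [Complex.norm_exp, Real.exp_le_one_iff]
      have := (Complex.re_le_norm (1 + e i)).trans (he i hi)
      simpa using this
    rw [Finset.prod_range_succ, Finset.sum_range_succ, Finset.sum_range_succ, Complex.exp_add]
    have h1 : ‖Complex.exp (∑ i ∈ Finset.range n, e i)‖ ≤ 1 := by
      rw [Complex.exp_sum, norm_prod]
      exact Finset.prod_le_one (fun _ _ => norm_nonneg _) fun i hi =>
        hexp i (by have := Finset.mem_range.1 hi; omega)
    have h2 := Complex.norm_exp_sub_one_sub_id_le (he1 n (by omega))
    calc _ = ‖(∏ i ∈ Finset.range n, (1 + e i) - Complex.exp (∑ i ∈ Finset.range n, e i)) *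
            (1 + e n) -
          Complex.exp (∑ i ∈ Finset.range n, e i) * (Complex.exp (e n) - 1 - e n)‖ := by ring_nf
      _ ≤ _ := (norm_sub_le _ _).trans (add_le_add
        ((norm_mul_le _ _).trans ((mul_le_of_le_one_right (norm_nonneg _) (he n (by omega))).trans
          ih'))
        ((norm_mul_le _ _).trans ((mul_le_of_le_one_left (norm_nonneg _) h1).trans h2)))

/-- Let Q_j be the product of the first j factors. As Q_(j-m) is independent of X_j, the covariance
of Q_j and X_j equals that of Q_j - Q_(j-m) and X_j, and the difference is at most the sum of the
preceding m values |X_i|. One step thus costs `m * η + m * δ ^ 2`, and earlier errors are not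
amplified because later factors have norm at most one. -/
theorem norm_integral_prod_sub_prod_le {Ω : Type*} [MeasurableSpace Ω] {P : Measure Ω}
    [IsProbabilityMeasure P] {X : ℕ → Ω → ℂ} (hX : ∀ i, Measurable (X i))
    (hX1 : ∀ i ω, ‖1 + X i ω‖ ≤ 1) {m n : ℕ}
    (hind : ∀ j < n, IndepFun (fun ω => ∏ i ∈ Finset.range (j - m), (1 + X i ω)) (X j) P)
    {δ η : ℝ} (hδ : ∀ i < n, ∫ ω, ‖X i ω‖ ∂P ≤ δ) (hη0 : 0 ≤ η)
    (hη : ∀ i j, i < j → j ≤ i + m → j < n → ∫ ω, ‖X i ω‖ * ‖X j ω‖ ∂P ≤ η) :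
    ‖∫ ω, ∏ i ∈ Finset.range n, (1 + X i ω) ∂P - ∏ i ∈ Finset.range n, (1 + ∫ ω, X i ω ∂P)‖ ≤
      n * (m * η + m * δ ^ 2) := by
  have hX2 : ∀ i ω, ‖X i ω‖ ≤ 2 := fun i ω => by
    calc ‖X i ω‖ = ‖(1 + X i ω) - 1‖ := by ring_nf
      _ ≤ ‖1 + X i ω‖ + ‖(1 : ℂ)‖ := norm_sub_le _ _
      _ ≤ 2 := by rw [norm_one]; linarith [hX1 i ω]
  let Q : ℕ → Ω → ℂ := fun j ω => ∏ i ∈ Finset.range j, (1 + X i ω)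
  have hQm : ∀ j, Measurable (Q j) := fun j => by fun_prop
  have hQ1 : ∀ j ω, ‖Q j ω‖ ≤ 1 := fun j ω => by
    simp only [Q]
    rw [norm_prod]
    exact Finset.prod_le_one (fun _ _ => norm_nonneg _) fun i _ => hX1 i ω
  have hQi : ∀ j, Integrable (Q j) P := fun j =>
    Integrable.of_bound (hQm j).aestronglyMeasurable 1 (ae_of_all _ (hQ1 j))
  have hXi : ∀ j, Integrable (X j) P := fun j =>
    Integrable.of_bound (hX j).aestronglyMeasurable 2 (ae_of_all _ (hX2 j))
  have hXXi : ∀ i j, Integrable (fun ω => ‖X i ω‖ * ‖X j ω‖) P := fun i j =>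
    Integrable.of_bound (by fun_prop) (2 * 2) (ae_of_all _ fun ω => by
      rw [norm_mul, norm_norm, norm_norm]
      exact mul_le_mul (hX2 i ω) (hX2 j ω) (norm_nonneg _) zero_le_two)
  have hQX : ∀ i j, Integrable (fun ω => Q i ω * X j ω) P := fun i j =>
    (hXi j).bdd_mul (hQm i).aestronglyMeasurable (ae_of_all _ (hQ1 i))
  have hE1 : ∀ j, ‖1 + ∫ ω, X j ω ∂P‖ ≤ 1 := fun j => by
    have h1 : 1 + ∫ ω, X j ω ∂P = ∫ ω, (1 + X j ω) ∂P := by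
      rw [integral_add (integrable_const _) (hXi j)]
      simp
    rw [h1]
    simpa using norm_integral_le_of_norm_le_const (μ := P) (ae_of_all _ (hX1 j))
  have hEX : ∀ j < n, ‖∫ ω, X j ω ∂P‖ ≤ δ := fun j hj =>
    (norm_integral_le_integral_norm _).trans (hδ j hj)
  have hstep : ∀ j < n, ‖∫ ω, Q (j + 1) ω ∂P - (∫ ω, Q j ω ∂P) * (1 + ∫ ω, X j ω ∂P)‖ ≤
      m * η + m * δ ^ 2 := by
    intro j hj
    -- The subtraction is truncated: for `j ≤ m` the window is everything before `j` and `Q (j - m)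
    -- = 1`.
    have hcard : ((Finset.Ico (j - m) j).card : ℝ) ≤ m := by
      rw [Nat.card_Ico]
      exact_mod_cast (by omega : j - (j - m) ≤ m)
    have hδ0 : 0 ≤ δ := (integral_nonneg fun _ => norm_nonneg _).trans (hδ j hj)
    have hdec : ∫ ω, Q (j + 1) ω ∂P - (∫ ω, Q j ω ∂P) * (1 + ∫ ω, X j ω ∂P) =
        ∫ ω, (Q j ω - Q (j - m) ω) * X j ω ∂P -
          (∫ ω, (Q j ω - Q (j - m) ω) ∂P) * ∫ ω, X j ω ∂P := by
      have e1 : ∀ ω, Q (j + 1) ω = Q j ω + Q j ω * X j ω := fun ω => by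
        simp only [Q]
        rw [Finset.prod_range_succ]
        ring
      have e2 : ∫ ω, Q (j - m) ω * X j ω ∂P = (∫ ω, Q (j - m) ω ∂P) * ∫ ω, X j ω ∂P :=
        (hind j hj).integral_fun_mul_eq_mul_integral (hQm _).aestronglyMeasurable
          (hX j).aestronglyMeasurable
      simp_rw [e1, sub_mul]
      rw [integral_add (hQi j) (hQX j j), integral_sub (hQX j j) (hQX _ j), e2,
        integral_sub (hQi j) (hQi _)]
      ring
    have hA : ‖∫ ω, (Q j ω - Q (j - m) ω) * X j ω ∂P‖ ≤ m * η := by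
      calc _ ≤ ∫ ω, ∑ i ∈ Finset.Ico (j - m) j, ‖X i ω‖ * ‖X j ω‖ ∂P := by
            refine norm_integral_le_of_norm_le (integrable_finsetSum _ fun i _ => hXXi i j)
              (ae_of_all _ fun ω => ?_)
            rw [norm_mul, ← Finset.sum_mul]
            gcongr
            exact norm_prod_one_add_sub_le (fun i => hX1 i ω) (Nat.sub_le j m)
        _ = ∑ i ∈ Finset.Ico (j - m) j, ∫ ω, ‖X i ω‖ * ‖X j ω‖ ∂P :=
            integral_finsetSum _ fun i _ => hXXi i j
        _ ≤ (Finset.Ico (j - m) j).card • η := Finset.sum_le_card_nsmul _ _ _ fun i hi => by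
            rw [Finset.mem_Ico] at hi
            exact hη i j hi.2 (by omega) hj
        _ ≤ m * η := by
            rw [nsmul_eq_mul]
            gcongr
    have hB : ‖∫ ω, (Q j ω - Q (j - m) ω) ∂P‖ ≤ m * δ := by
      calc _ ≤ ∫ ω, ∑ i ∈ Finset.Ico (j - m) j, ‖X i ω‖ ∂P :=
            norm_integral_le_of_norm_le (integrable_finsetSum _ fun i _ => (hXi i).norm)
              (ae_of_all _ fun ω =>
                norm_prod_one_add_sub_le (fun i => hX1 i ω) (Nat.sub_le j m))
        _ = ∑ i ∈ Finset.Ico (j - m) j, ∫ ω, ‖X i ω‖ ∂P :=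
            integral_finsetSum _ fun i _ => (hXi i).norm
        _ ≤ (Finset.Ico (j - m) j).card • δ := Finset.sum_le_card_nsmul _ _ _ fun i hi => by
            rw [Finset.mem_Ico] at hi
            exact hδ i (by omega)
        _ ≤ m * δ := by
            rw [nsmul_eq_mul]
            gcongr
    rw [hdec]
    calc _ ≤ _ := norm_sub_le _ _
      _ ≤ m * η + (m * δ) * δ := by
        rw [norm_mul]
        gcongr
        exact hEX j hj
      _ = _ := by ring
  have hind : ∀ j ≤ n, ‖∫ ω, Q j ω ∂P - ∏ i ∈ Finset.range j, (1 + ∫ ω, X i ω ∂P)‖ ≤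
      j * (m * η + m * δ ^ 2) := by
    intro j
    induction j with
    | zero => simp [Q]
    | succ j ih =>
      intro hj
      have ih' := ih (by omega)
      rw [Finset.prod_range_succ]
      calc _ = ‖(∫ ω, Q (j + 1) ω ∂P - (∫ ω, Q j ω ∂P) * (1 + ∫ ω, X j ω ∂P)) +
            (∫ ω, Q j ω ∂P - ∏ i ∈ Finset.range j, (1 + ∫ ω, X i ω ∂P)) *
              (1 + ∫ ω, X j ω ∂P)‖ := by ring_nf
        _ ≤ _ := norm_add_le _ _
        _ ≤ (m * η + m * δ ^ 2) + j * (m * η + m * δ ^ 2) := by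
            refine add_le_add (hstep j (by omega)) ?_
            rw [norm_mul]
            exact (mul_le_of_le_one_right (norm_nonneg _) (hE1 j)).trans ih'
        _ = _ := by push_cast; ring
  exact hind n le_rfl

/-- Poisson limit for products of `m`-dependent factors close to one. -/
theorem tendsto_integral_prod_exp {Ω : Type*} [MeasurableSpace Ω] {P : Measure Ω}
    [IsProbabilityMeasure P] {X : ℕ → ℕ → Ω → ℂ} (hX : ∀ n i, Measurable (X n i))
    (hX1 : ∀ n i ω, ‖1 + X n i ω‖ ≤ 1) {m : ℕ}
    (hind : ∀ n, ∀ j < n,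
      IndepFun (fun ω => ∏ i ∈ Finset.range (j - m), (1 + X n i ω)) (X n j) P)
    {C : ℝ} (hC : ∀ᶠ n : ℕ in atTop, ∀ i < n, ∫ ω, ‖X n i ω‖ ∂P ≤ C / n)
    (hCC : ∀ᶠ n : ℕ in atTop, ∀ i j, i < j → j ≤ i + m → j < n →
      ∫ ω, ‖X n i ω‖ * ‖X n j ω‖ ∂P ≤ C / n ^ 2)
    (hC0 : 0 ≤ C) {z : ℂ}
    (hz : Tendsto (fun n => ∑ i ∈ Finset.range n, ∫ ω, X n i ω ∂P) atTop (𝓝 z)) :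
    Tendsto (fun n => ∫ ω, ∏ i ∈ Finset.range n, (1 + X n i ω) ∂P) atTop
      (𝓝 (Complex.exp z)) := by
  have hlim : Tendsto (fun n : ℕ => (m * C + m * C ^ 2 + C ^ 2) / (n : ℝ)) atTop (𝓝 0) :=
    tendsto_const_div_atTop_nhds_zero_nat _
  have hCn : Tendsto (fun n : ℕ => C / (n : ℝ)) atTop (𝓝 0) :=
    tendsto_const_div_atTop_nhds_zero_nat _
  have hexp := (Complex.continuous_exp.tendsto z).comp hz
  refine (tendsto_iff_of_dist (squeeze_zero' (Eventually.of_forall fun _ => dist_nonneg) ?_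
    hlim)).1 hexp
  filter_upwards [hC, hCC, eventually_gt_atTop 0, hCn.eventually (Iic_mem_nhds zero_lt_one)]
    with n h1 h2 hn0 hn1
  have hn : (0 : ℝ) < n := by exact_mod_cast hn0
  have hE : ∀ i < n, ‖∫ ω, X n i ω ∂P‖ ≤ C / n := fun i hi =>
    (norm_integral_le_integral_norm _).trans (h1 i hi)
  have hXi : ∀ j, Integrable (X n j) P := fun j =>
    Integrable.of_bound (hX n j).aestronglyMeasurable 2 (ae_of_all _ fun ω => by
      calc ‖X n j ω‖ = ‖(1 + X n j ω) - 1‖ := by ring_nf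
        _ ≤ ‖1 + X n j ω‖ + ‖(1 : ℂ)‖ := norm_sub_le _ _
        _ ≤ 2 := by rw [norm_one]; linarith [hX1 n j ω])
  have hE1 : ∀ j, ‖1 + ∫ ω, X n j ω ∂P‖ ≤ 1 := fun j => by
    have h1 : 1 + ∫ ω, X n j ω ∂P = ∫ ω, (1 + X n j ω) ∂P := by
      rw [integral_add (integrable_const _) (hXi j)]
      simp
    rw [h1]
    simpa using norm_integral_le_of_norm_le_const (μ := P) (ae_of_all _ (hX1 n j))
  -- With δ = C / n and η = C / n², the `n` steps cost O(1/n) altogether.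
  have hA := norm_integral_prod_sub_prod_le (hX n) (hX1 n) (hind n) h1 (by positivity) h2
  have hB := norm_prod_sub_exp_sum_le (e := fun i => ∫ ω, X n i ω ∂P) (n := n)
    (fun i _ => hE1 i) (fun i hi => (hE i hi).trans hn1)
  have hB' : ∑ i ∈ Finset.range n, ‖∫ ω, X n i ω ∂P‖ ^ 2 ≤ n * (C / n) ^ 2 := by
    refine (Finset.sum_le_card_nsmul _ _ ((C / n) ^ 2) fun i hi => ?_).trans (by simp)
    have := hE i (Finset.mem_range.1 hi)
    gcongr
  rw [dist_comm, dist_eq_norm]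
  calc _ ≤ _ := norm_sub_le_norm_sub_add_norm_sub _
        (∏ i ∈ Finset.range n, (1 + ∫ ω, X n i ω ∂P)) _
    _ ≤ n * (m * (C / n ^ 2) + m * (C / n) ^ 2) + n * (C / n) ^ 2 :=
        add_le_add hA (hB.trans hB')
    _ = _ := by
        field_simp

/-! ### Discretization of weights -/

/-- The grid cell `((c - 1) / r, c / r]`, which is `{0}` for `c = 0`. -/
def cell (r c : ℕ) : Set ℝ≥0 := {y | ⌈(r : ℝ≥0) * y⌉₊ = c}

theorem measurableSet_cell (r c : ℕ) : MeasurableSet (cell r c) :=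
  (Nat.measurable_ceil.comp (measurable_const.mul measurable_id)) (measurableSet_singleton c)

theorem ceil_mul_le_iff {r : ℕ} (hr : 0 < r) (y : ℝ≥0) (c : ℕ) :
    ⌈(r : ℝ≥0) * y⌉₊ ≤ c ↔ y ≤ c / r := by
  rw [Nat.ceil_le, le_div_iff₀' (by exact_mod_cast hr)]

theorem pairwise_disjoint_cell (r : ℕ) : Pairwise (Function.onFun Disjoint (cell r)) :=
  fun _ _ hcd => Set.disjoint_left.2 fun _ hy hy' => hcd (hy.symm.trans hy')

theorem biUnion_cell {r : ℕ} (hr : 0 < r) (c : ℕ) :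
    ⋃ c' ∈ Finset.range (c + 1), cell r c' = Set.Iic ((c : ℝ≥0) / r) := by
  ext y
  simp only [Set.mem_iUnion, Finset.mem_range, exists_prop, Set.mem_Iic, ← ceil_mul_le_iff hr]
  exact ⟨fun ⟨c', h, hy⟩ => by
    have : ⌈(r : ℝ≥0) * y⌉₊ = c' := hy
    omega, fun h => ⟨_, by omega, rfl⟩⟩

theorem cell_subset_Iic {r : ℕ} (hr : 0 < r) (c : ℕ) : cell r c ⊆ Set.Iic ((c : ℝ≥0) / r) :=
  fun y hy => (ceil_mul_le_iff hr y c).1 (le_of_eq hy)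

theorem exp_le_of_mem_cell {r c : ℕ} (hr : 0 < r) {y : ℝ≥0} (hy : y ∈ cell r c) :
    Real.exp (-(c / r : ℝ)) ≤ Real.exp (-(y : ℝ)) := by
  have h := cell_subset_Iic hr c hy
  have h' : (y : ℝ) ≤ c / r := by exact_mod_cast h
  exact Real.exp_le_exp.2 (neg_le_neg h')

theorem exp_le_mul_of_mem_cell {r c : ℕ} (hr : 0 < r) {y : ℝ≥0} (hy : y ∈ cell r c) :
    Real.exp (-(y : ℝ)) ≤ Real.exp (1 / r) * Real.exp (-(c / r : ℝ)) := by
  have h : ((⌈(r : ℝ≥0) * y⌉₊ : ℕ) : ℝ≥0) < r * y + 1 := Nat.ceil_lt_add_one (by positivity)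
  rw [show ⌈(r : ℝ≥0) * y⌉₊ = c from hy] at h
  have h' : (c : ℝ) < r * y + 1 := by exact_mod_cast h
  have hr' : (0 : ℝ) < r := by exact_mod_cast hr
  rw [← Real.exp_add, Real.exp_le_exp, ← sub_eq_add_neg, ← sub_div, le_div_iff₀ hr']
  linarith

theorem sum_real_cell {r : ℕ} (hr : 0 < r) {μ : Measure ℝ≥0} (hμ : ∀ y, μ (Set.Iic y) ≠ ∞)
    (c : ℕ) : ∑ c' ∈ Finset.range (c + 1), μ.real (cell r c') =
      μ.real (Set.Iic ((c : ℝ≥0) / r)) := by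
  rw [← biUnion_cell hr, measureReal_biUnion_finset
    (fun _ _ _ _ h => pairwise_disjoint_cell r h) (fun _ _ => measurableSet_cell r _)
    (fun c' _ => ((measure_mono (cell_subset_Iic hr c')).trans_lt (hμ _).lt_top).ne)]

/-- The vector of cell counts on the grid of mesh `1 / r` of `[0, r]`. -/
def counts (r : ℕ) (μ : Measure ℝ≥0) : EuclideanSpace ℝ (Fin (r ^ 2 + 1)) :=
  WithLp.toLp 2 fun c => μ.real (cell r c)

theorem measurable_counts (r : ℕ) : Measurable (counts r) :=
  (PiLp.continuous_toLp 2 _).measurable.comp (measurable_pi_lambda _ fun c =>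
    (Measure.measurable_coe (measurableSet_cell r c)).ennreal_toReal)

/-- The exponential weight of the `j`-th arrival, read off from cell counts. -/
def gridOrd (r j : ℕ) (v : EuclideanSpace ℝ (Fin (r ^ 2 + 1))) : ℝ :=
  ⨆ c, if (j : ℝ) + 1 ≤ ∑ c' ∈ Finset.Iic c, v c' then Real.exp (-((c : ℕ) / r : ℝ)) else 0

/-- The sum of the exponential weights, read off from cell counts. -/
def gridSum (r : ℕ) (v : EuclideanSpace ℝ (Fin (r ^ 2 + 1))) : ℝ :=
  ∑ c, v c * Real.exp (-((c : ℕ) / r : ℝ))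

/-- The leading normalized weights, read off from cell counts. -/
def gridWeight (r k : ℕ) (v : EuclideanSpace ℝ (Fin (r ^ 2 + 1))) : Fin k → ℝ :=
  fun j => gridOrd r j v / gridSum r v

theorem measurable_gridWeight (r k : ℕ) : Measurable (gridWeight r k) := by
  refine measurable_pi_lambda _ fun j => Measurable.div (Measurable.iSup fun c => ?_) ?_
  · refine Measurable.ite (measurableSet_le measurable_const ?_) measurable_const measurable_const
    fun_prop
  · unfold gridSum
    fun_prop

theorem sum_Iic_counts {r : ℕ} (hr : 0 < r) {μ : Measure ℝ≥0} (hμ : ∀ y, μ (Set.Iic y) ≠ ∞)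
    (c : Fin (r ^ 2 + 1)) :
    ∑ c' ∈ Finset.Iic c, counts r μ c' = μ.real (Set.Iic (((c : ℕ) : ℝ≥0) / r)) := by
  rw [← sum_real_cell hr hμ]
  have h := Finset.sum_map (Finset.Iic c) Fin.valEmbedding (fun c' : ℕ => μ.real (cell r c'))
  rw [Fin.map_valEmbedding_Iic] at h
  rw [show Finset.range ((c : ℕ) + 1) = Finset.Iic (c : ℕ) by ext; simp, h]
  rfl

section Deterministic

variable {μ : Measure ℝ≥0} (hμ : ∀ y, μ (Set.Iic y) ≠ ∞)

/-- The total exponential mass. -/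
def expMass (μ : Measure ℝ≥0) : ℝ≥0∞ := ∫⁻ y, ENNReal.ofReal (Real.exp (-(y : ℝ))) ∂μ

/-- The exponential mass beyond `r`. -/
def expTail (r : ℕ) (μ : Measure ℝ≥0) : ℝ≥0∞ :=
  ∫⁻ y in Set.Ioi (r : ℝ≥0), ENNReal.ofReal (Real.exp (-(y : ℝ))) ∂μ

theorem exp_neg_le_expMass {y : ℝ≥0} (hy : 1 ≤ μ (Set.Iic y)) :
    ENNReal.ofReal (Real.exp (-(y : ℝ))) ≤ expMass μ := by
  calc _ ≤ ENNReal.ofReal (Real.exp (-(y : ℝ))) * μ (Set.Iic y) := le_mul_of_one_le_right' hy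
    _ = ∫⁻ _ in Set.Iic y, ENNReal.ofReal (Real.exp (-(y : ℝ))) ∂μ := by
        rw [setLIntegral_const]
    _ ≤ ∫⁻ z in Set.Iic y, ENNReal.ofReal (Real.exp (-(z : ℝ))) ∂μ :=
        setLIntegral_mono' measurableSet_Iic fun z hz => by
          have : (z : ℝ) ≤ y := hz
          gcongr
    _ ≤ _ := setLIntegral_le_lintegral _ _

/-- Cover the tail by unit intervals. Enlarging each interval to a half-line from 0 leaves only the
cumulative counts to be controlled. -/
theorem expTail_le_tsum (r : ℕ) (μ : Measure ℝ≥0) :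
    expTail r μ ≤ ∑' i : ℕ, ENNReal.ofReal (Real.exp (-((i + r : ℕ) : ℝ))) *
      μ (Set.Iic (((i + r : ℕ) : ℝ≥0) + 1)) := by
  have hcov : Set.Ioi (r : ℝ≥0) ⊆
      ⋃ i : ℕ, Set.Icc ((i + r : ℕ) : ℝ≥0) (((i + r : ℕ) : ℝ≥0) + 1) := by
    intro y hy
    have h1 : r ≤ ⌊y⌋₊ := Nat.le_floor (le_of_lt hy)
    refine Set.mem_iUnion.2 ⟨⌊y⌋₊ - r, ?_⟩
    rw [Nat.sub_add_cancel h1]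
    exact ⟨Nat.floor_le (by positivity), (Nat.lt_floor_add_one y).le⟩
  calc expTail r μ ≤ ∫⁻ y in ⋃ i : ℕ, Set.Icc ((i + r : ℕ) : ℝ≥0) (((i + r : ℕ) : ℝ≥0) + 1),
        ENNReal.ofReal (Real.exp (-(y : ℝ))) ∂μ := lintegral_mono_set hcov
    _ ≤ ∑' i : ℕ, ∫⁻ y in Set.Icc ((i + r : ℕ) : ℝ≥0) (((i + r : ℕ) : ℝ≥0) + 1),
        ENNReal.ofReal (Real.exp (-(y : ℝ))) ∂μ := lintegral_iUnion_le _ _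
    _ ≤ _ := ENNReal.tsum_le_tsum fun i => by
        calc _ ≤ ∫⁻ _ in Set.Icc ((i + r : ℕ) : ℝ≥0) (((i + r : ℕ) : ℝ≥0) + 1),
              ENNReal.ofReal (Real.exp (-((i + r : ℕ) : ℝ))) ∂μ :=
              setLIntegral_mono' measurableSet_Icc fun y hy => by
                have : ((i + r : ℕ) : ℝ) ≤ y := by exact_mod_cast hy.1
                gcongr
          _ ≤ _ := by
            rw [setLIntegral_const]
            gcongr
            exact Set.Icc_subset_Iic_self

include hμ

theorem ofReal_gridSum {r : ℕ} (hr : 0 < r) :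
    ENNReal.ofReal (gridSum r (counts r μ)) =
      ∑ c ∈ Finset.range (r ^ 2 + 1),
        ENNReal.ofReal (Real.exp (-(c / r : ℝ))) * μ (cell r c) := by
  rw [gridSum, ENNReal.ofReal_sum_of_nonneg
    fun c _ => mul_nonneg (show 0 ≤ counts r μ c from measureReal_nonneg) (Real.exp_pos _).le,
    ← Fin.sum_univ_eq_sum_range (fun c : ℕ =>
      ENNReal.ofReal (Real.exp (-(c / r : ℝ))) * μ (cell r c))]
  refine Finset.sum_congr rfl fun c _ => ?_
  rw [mul_comm, ENNReal.ofReal_mul (Real.exp_pos _).le]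
  congr 1
  exact ofReal_measureReal ((measure_mono (cell_subset_Iic hr c)).trans_lt (hμ _).lt_top).ne

omit hμ in
theorem setLIntegral_grid {r : ℕ} (hr : 0 < r) (f : ℝ≥0 → ℝ≥0∞) :
    ∫⁻ y in Set.Iic (r : ℝ≥0), f y ∂μ =
      ∑ c ∈ Finset.range (r ^ 2 + 1), ∫⁻ y in cell r c, f y ∂μ := by
  have h : Set.Iic (r : ℝ≥0) = ⋃ c ∈ Finset.range (r ^ 2 + 1), cell r c := by
    rw [biUnion_cell hr]
    congr 1
    push_cast
    field_simp
  rw [h, lintegral_biUnion_finset (fun _ _ _ _ h => pairwise_disjoint_cell r h)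
    (fun _ _ => measurableSet_cell r _)]

/-- Points are rounded up to the right end of their cell, so the grid undershoots. Together with
`expMass_le` this pins the mass down to a factor e^(1/r) and the tail. -/
theorem gridSum_le_expMass {r : ℕ} (hr : 0 < r) :
    ENNReal.ofReal (gridSum r (counts r μ)) ≤ expMass μ := by
  rw [ofReal_gridSum hμ hr]
  calc _ ≤ ∑ c ∈ Finset.range (r ^ 2 + 1),
        ∫⁻ y in cell r c, ENNReal.ofReal (Real.exp (-(y : ℝ))) ∂μ :=
        Finset.sum_le_sum fun c _ => by
          rw [← setLIntegral_const]
          exact setLIntegral_mono' (measurableSet_cell r c) fun y hy =>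
            ENNReal.ofReal_le_ofReal (exp_le_of_mem_cell hr hy)
    _ ≤ _ := by
      rw [← setLIntegral_grid hr]
      exact setLIntegral_le_lintegral _ _

theorem expMass_le {r : ℕ} (hr : 0 < r) :
    expMass μ ≤ ENNReal.ofReal (Real.exp (1 / r) * gridSum r (counts r μ)) + expTail r μ := by
  rw [ENNReal.ofReal_mul (Real.exp_pos _).le, ofReal_gridSum hμ hr, Finset.mul_sum]
  have h := lintegral_add_compl (μ := μ) (fun y : ℝ≥0 => ENNReal.ofReal (Real.exp (-(y : ℝ))))
    (measurableSet_Iic (a := (r : ℝ≥0)))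
  rw [Set.compl_Iic, setLIntegral_grid hr] at h
  rw [expMass, ← h]
  refine add_le_add (Finset.sum_le_sum fun c _ => ?_) le_rfl
  rw [← mul_assoc, ← ENNReal.ofReal_mul (Real.exp_pos _).le, ← setLIntegral_const]
  exact setLIntegral_mono' (measurableSet_cell r c) fun y hy =>
    ENNReal.ofReal_le_ofReal (exp_le_mul_of_mem_cell hr hy)

theorem natCast_add_one_le_real_iff {y : ℝ≥0} {j : ℕ} :
    (j : ℝ) + 1 ≤ μ.real (Set.Iic y) ↔ (j : ℝ≥0∞) + 1 ≤ μ (Set.Iic y) := by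
  rw [measureReal_def, ← ENNReal.ofReal_le_iff_le_toReal (hμ y),
    ENNReal.ofReal_add (by positivity) zero_le_one]
  simp

omit hμ in
theorem gridOrd_nonneg (r j : ℕ) (v : EuclideanSpace ℝ (Fin (r ^ 2 + 1))) : 0 ≤ gridOrd r j v :=
  Real.iSup_nonneg fun c => by
    split_ifs
    · exact (Real.exp_pos _).le
    · exact le_rfl

omit hμ in
theorem gridSum_nonneg (r : ℕ) (μ : Measure ℝ≥0) : 0 ≤ gridSum r (counts r μ) :=
  Finset.sum_nonneg fun _ _ => mul_nonneg measureReal_nonneg (Real.exp_pos _).le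

omit hμ in
theorem gridOrd_le_gridSum (r j : ℕ) (μ : Measure ℝ≥0) :
    gridOrd r j (counts r μ) ≤ gridSum r (counts r μ) := by
  refine ciSup_le fun c => ?_
  split_ifs with h
  · have hnn : ∀ c, 0 ≤ counts r μ c := fun c => measureReal_nonneg
    calc Real.exp (-((c : ℕ) / r : ℝ))
        ≤ (∑ c' ∈ Finset.Iic c, counts r μ c') * Real.exp (-((c : ℕ) / r : ℝ)) := by
          refine le_mul_of_one_le_left (Real.exp_pos _).le (le_trans ?_ h)
          linarith [(Nat.cast_nonneg j : (0 : ℝ) ≤ j)]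
      _ ≤ ∑ c' ∈ Finset.Iic c, counts r μ c' * Real.exp (-((c' : ℕ) / r : ℝ)) := by
          rw [Finset.sum_mul]
          refine Finset.sum_le_sum fun c' hc' => ?_
          have hc : ((c' : ℕ) : ℝ) ≤ (c : ℕ) := by exact_mod_cast Finset.mem_Iic.1 hc'
          have := hnn c'
          gcongr
      _ ≤ _ := Finset.sum_le_sum_of_subset_of_nonneg (Finset.subset_univ _)
          fun c' _ _ => mul_nonneg (hnn c') (Real.exp_pos _).le
  · exact gridSum_nonneg r μ

variable {j : ℕ} {a : ℝ≥0} (ha : ∀ y, (j : ℝ≥0∞) + 1 ≤ μ (Set.Iic y) ↔ a ≤ y)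

include ha

theorem gridOrd_le_exp {r : ℕ} (hr : 0 < r) :
    gridOrd r j (counts r μ) ≤ Real.exp (-(a : ℝ)) := by
  refine ciSup_le fun c => ?_
  split_ifs with h
  · rw [sum_Iic_counts hr hμ, natCast_add_one_le_real_iff hμ, ha] at h
    have h' : (a : ℝ) ≤ (c : ℕ) / r := by exact_mod_cast h
    exact Real.exp_le_exp.2 (neg_le_neg h')
  · exact (Real.exp_pos _).le

/-- If `a ≤ r`, the cell of `a` competes in the supremum and only rounding is lost; if `a > r`, the
additive term e^(-r) already dominates. -/
theorem exp_le_gridOrd {r : ℕ} (hr : 0 < r) :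
    Real.exp (-(a : ℝ)) ≤ Real.exp (1 / r) * gridOrd r j (counts r μ) + Real.exp (-r) := by
  have hg := gridOrd_nonneg r j (counts r μ)
  have hr' : (0 : ℝ) < r := by exact_mod_cast hr
  rcases le_or_gt a r with har | har
  · have hc : ⌈(r : ℝ≥0) * a⌉₊ ≤ r ^ 2 := by
      rw [ceil_mul_le_iff hr]
      refine har.trans (le_of_eq ?_)
      push_cast
      field_simp
    let c : Fin (r ^ 2 + 1) := ⟨⌈(r : ℝ≥0) * a⌉₊, by omega⟩
    have hle : Real.exp (-((c : ℕ) / r : ℝ)) ≤ gridOrd r j (counts r μ) := by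
      have := le_ciSup (Set.finite_range fun c : Fin (r ^ 2 + 1) =>
        if (j : ℝ) + 1 ≤ ∑ c' ∈ Finset.Iic c, counts r μ c'
          then Real.exp (-((c : ℕ) / r : ℝ)) else 0).bddAbove c
      rwa [if_pos] at this
      rw [sum_Iic_counts hr hμ, natCast_add_one_le_real_iff hμ, ha, ← ceil_mul_le_iff hr]
    have h := exp_le_mul_of_mem_cell (r := r) (c := c) hr (y := a) rfl
    have : Real.exp (1 / r) * Real.exp (-((c : ℕ) / r : ℝ)) ≤
        Real.exp (1 / r) * gridOrd r j (counts r μ) := by gcongr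
    linarith [Real.exp_pos (-(r : ℝ))]
  · have h' : (r : ℝ) ≤ a := by exact_mod_cast har.le
    have := Real.exp_le_exp.2 (neg_le_neg h')
    have h2 := mul_nonneg (Real.exp_pos (1 / (r : ℝ))).le hg
    linarith

-- Think of `g / s` as the grid version of `A / S`. Because `g ≤ s`, the ratio is at most one, so
-- the relative error `δ` turns into an absolute one; the additive errors `κ` and `τ` are divided by
-- the true denominator.
omit hμ ha in
theorem abs_div_sub_div_le {A S g s δ τ κ : ℝ} (hS : 0 < S) (hg : 0 ≤ g) (hgs : g ≤ s)
    (hgA : g ≤ A) (hA : A ≤ (1 + δ) * g + κ) (hsS : s ≤ S) (hSs : S ≤ (1 + δ) * s + τ)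
    (hδ : 0 ≤ δ) (hτ : 0 ≤ τ) (hκ : 0 ≤ κ) :
    |A / S - g / s| ≤ δ + (κ + τ) / S := by
  have hs : 0 ≤ s := hg.trans hgs
  rcases hs.eq_or_lt with hs0 | hs0
  · have hg0 : g = 0 := le_antisymm (hgs.trans hs0.ge) hg
    rw [← hs0, div_zero, sub_zero, abs_of_nonneg (div_nonneg (hg.trans hgA) hS.le)]
    rw [hg0] at hA
    have : A / S ≤ (κ + τ) / S := by gcongr; linarith
    linarith
  · have hq1 : g / s ≤ 1 := (div_le_one hs0).2 hgs
    have hq0 : 0 ≤ g / s := by positivity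
    have hgq : g = g / s * s := by field_simp
    set w := g / s
    have hτS : 0 ≤ τ / S := by positivity
    have hκS : 0 ≤ κ / S := by positivity
    rw [add_div, abs_le]
    constructor
    · have h1 : w - A / S ≤ δ + τ / S := by
        rw [sub_le_iff_le_add, ← sub_le_iff_le_add', ← sub_sub, ← sub_nonneg]
        have : A / S - (w - δ - τ / S) = (A - (w - δ) * S + τ) / S := by field_simp; ring
        rw [this]
        refine div_nonneg ?_ hS.le
        nlinarith [mul_nonneg (mul_nonneg hq0 hδ) hs, mul_nonneg (sub_nonneg.2 hq1) hτ,
          mul_nonneg hq0 (sub_nonneg.2 hSs), mul_nonneg hδ (sub_nonneg.2 hsS),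
          mul_nonneg (sub_nonneg.2 hq1) (mul_nonneg hδ hs)]
      linarith
    · have h1 : A / S ≤ (1 + δ) * w + κ / S := by
        rw [div_le_iff₀ hS, add_mul, div_mul_cancel₀ _ hS.ne']
        refine hA.trans ?_
        rw [hgq]
        have : 0 ≤ (1 + δ) * w := by positivity
        nlinarith [mul_le_mul_of_nonneg_left hsS this]
      nlinarith

end Deterministic

/-! ### Convergence of weights from convergence of cell counts -/

/-- A boundedly finite counting measure with finite exponential mass whose leading normalized
exponential weights are `w`. -/
structure HasWeights {k : ℕ} (μ : Measure ℝ≥0) (w : Fin k → ℝ) : Prop where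
  counting : ∀ B : Set ℝ≥0, MeasurableSet B → Bornology.IsBounded B → ∃ n : ℕ, μ B = n
  expMass_ne_top : expMass μ ≠ ∞
  -- The equivalence determines `a j` as the arrival of index `j` without fixing a construction, so
  -- that sorted samples and Poisson arrivals are treated alike.
  weights : ∃ a : Fin k → ℝ≥0, ∀ j : Fin k, (∀ y, ((j : ℕ) : ℝ≥0∞) + 1 ≤ μ (Set.Iic y) ↔ a j ≤ y) ∧
    w j = Real.exp (-(a j : ℝ)) / (expMass μ).toReal

theorem isBounded_Iic_nnreal (y : ℝ≥0) : Bornology.IsBounded (Set.Iic y) :=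
  (Metric.isBounded_Icc 0 y).subset fun _ hz => ⟨bot_le, hz⟩

theorem HasWeights.Iic_ne_top {k : ℕ} {μ : Measure ℝ≥0} {w : Fin k → ℝ} (h : HasWeights μ w)
    (y : ℝ≥0) : μ (Set.Iic y) ≠ ∞ := by
  obtain ⟨n, hn⟩ := h.counting _ measurableSet_Iic (isBounded_Iic_nnreal y)
  simp [hn]

theorem HasWeights.counts_mem {k : ℕ} {μ : Measure ℝ≥0} {w : Fin k → ℝ} (h : HasWeights μ w)
    {r : ℕ} (hr : 0 < r) :
    counts r μ ∈ Set.range fun v : Fin (r ^ 2 + 1) → ℕ =>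
      (WithLp.toLp 2 fun c => (v c : ℝ) : EuclideanSpace ℝ (Fin (r ^ 2 + 1))) := by
  have : ∀ c : Fin (r ^ 2 + 1), ∃ n : ℕ, μ (cell r c) = n := fun c =>
    h.counting _ (measurableSet_cell r c) ((isBounded_Iic_nnreal _).subset (cell_subset_Iic hr c))
  choose v hv using this
  exact ⟨v, by simp [counts, measureReal_def, hv]⟩

/-- The discretization error of the leading weights. -/
theorem HasWeights.enorm_sub_le {k : ℕ} {μ : Measure ℝ≥0} {w : Fin k → ℝ} (h : HasWeights μ w)
    {r : ℕ} (hr : 0 < r) (K : ℕ) :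
    ‖w - gridWeight r k (counts r μ)‖ₑ ≤ ENNReal.ofReal (Real.exp (1 / r) - 1) +
      ENNReal.ofReal (Real.exp K) * (ENNReal.ofReal (Real.exp (-r)) + expTail r μ) +
      {μ : Measure ℝ≥0 | ¬ 1 ≤ μ (Set.Iic (K : ℝ≥0))}.indicator 1 μ := by
  obtain ⟨a, ha⟩ := h.weights
  have hμ := h.Iic_ne_top
  have hS := h.expMass_ne_top
  have hT : expTail r μ ≠ ∞ := ne_top_of_le_ne_top hS (setLIntegral_le_lintegral _ _)
  have hr' : (0 : ℝ) < r := by exact_mod_cast hr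
  have hδ : 0 ≤ Real.exp (1 / r) - 1 := by
    have : 0 ≤ 1 / (r : ℝ) := by positivity
    linarith [Real.one_le_exp this]
  set R := (Real.exp (1 / r) - 1) + Real.exp K * (Real.exp (-r) + (expTail r μ).toReal) with hR
  have hR0 : 0 ≤ Real.exp K * (Real.exp (-r) + (expTail r μ).toReal) := by positivity
  have hRe : ENNReal.ofReal (Real.exp (1 / r) - 1) +
      ENNReal.ofReal (Real.exp K) * (ENNReal.ofReal (Real.exp (-r)) + expTail r μ) =
      ENNReal.ofReal R := by
    rw [hR, ENNReal.ofReal_add hδ hR0, ENNReal.ofReal_mul (Real.exp_pos _).le,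
      ENNReal.ofReal_add (Real.exp_pos _).le ENNReal.toReal_nonneg, ENNReal.ofReal_toReal hT]
  have hSpos : ∀ y, 1 ≤ μ (Set.Iic y) → Real.exp (-(y : ℝ)) ≤ (expMass μ).toReal := fun y hy => by
    rw [← ENNReal.ofReal_le_iff_le_toReal hS]
    exact exp_neg_le_expMass hy
  have haS : ∀ j, Real.exp (-(a j : ℝ)) ≤ (expMass μ).toReal := fun j =>
    hSpos _ (le_trans (by simp) (((ha j).1 _).2 le_rfl))
  have hsum := gridSum_nonneg r μ
  -- A point in [0, K] keeps the denominator above e^(-K). Without one, both weight vectors have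
  -- entries in [0, 1] and the error 1 is charged to the indicator.
  by_cases hK : 1 ≤ μ (Set.Iic (K : ℝ≥0))
  · rw [Set.indicator_of_notMem (by simpa using hK), add_zero, hRe, ← ofReal_norm]
    refine ENNReal.ofReal_le_ofReal ((pi_norm_le_iff_of_nonneg (by positivity)).2 fun j => ?_)
    have hA := exp_le_gridOrd hμ (ha j).1 hr
    have hS0 := (Real.exp_pos _).trans_le (haS j)
    have h1 := abs_div_sub_div_le (A := Real.exp (-(a j : ℝ))) (S := (expMass μ).toReal)
      (g := gridOrd r j (counts r μ)) (s := gridSum r (counts r μ))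
      (δ := Real.exp (1 / r) - 1) (τ := (expTail r μ).toReal) (κ := Real.exp (-r))
      hS0 (gridOrd_nonneg _ _ _) (gridOrd_le_gridSum r j μ) (gridOrd_le_exp hμ (ha j).1 hr)
      (by rwa [add_sub_cancel])
      ((ENNReal.ofReal_le_iff_le_toReal hS).1 (gridSum_le_expMass hμ hr))
      (by
        rw [add_sub_cancel]
        have := ENNReal.toReal_mono (ENNReal.add_ne_top.2 ⟨ENNReal.ofReal_ne_top, hT⟩)
          (expMass_le hμ hr)
        rwa [ENNReal.toReal_add ENNReal.ofReal_ne_top hT,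
          ENNReal.toReal_ofReal (mul_nonneg (Real.exp_pos _).le hsum)] at this)
      hδ ENNReal.toReal_nonneg (Real.exp_pos _).le
    rw [Pi.sub_apply, (ha j).2, Real.norm_eq_abs]
    refine h1.trans ?_
    rw [hR]
    gcongr
    rw [div_le_iff₀ hS0]
    have h2 := hSpos _ hK
    have h3 : 1 ≤ Real.exp K * (expMass μ).toReal := by
      calc (1 : ℝ) = Real.exp K * Real.exp (-(K : ℝ)) := by rw [← Real.exp_add]; simp
        _ ≤ _ := mul_le_mul_of_nonneg_left (by simpa using h2) (Real.exp_pos _).le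
    have h4 : 0 ≤ Real.exp (-(r : ℝ)) + (expTail r μ).toReal := by positivity
    nlinarith
  · rw [Set.indicator_of_mem (by simpa using hK)]
    refine le_trans ?_ le_add_self
    rw [← ofReal_norm, Pi.one_apply, ← ENNReal.ofReal_one]
    refine ENNReal.ofReal_le_ofReal ((pi_norm_le_iff_of_nonneg zero_le_one).2 fun j => ?_)
    rw [Pi.sub_apply, (ha j).2, Real.norm_eq_abs, gridWeight]
    have h1 := (div_le_one ((Real.exp_pos _).trans_le (haS j))).2 (haS j)
    have h2 : 0 ≤ Real.exp (-(a j : ℝ)) / (expMass μ).toReal := by positivity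
    have h3 := div_le_one_of_le₀ (gridOrd_le_gridSum r j μ) hsum
    have h4 := div_nonneg (gridOrd_nonneg r j (counts r μ)) hsum
    rw [abs_le]
    constructor <;> linarith

/-- A bound for the expected exponential mass beyond `r`, given polynomial mean growth. -/
def tailBound (C : ℝ≥0) (q r : ℕ) : ℝ≥0∞ :=
  ∑' i : ℕ, ENNReal.ofReal (Real.exp (-((i + r : ℕ) : ℝ))) * (C * ((i + r : ℕ) + 1) ^ q)

theorem tailBound_zero_ne_top (C : ℝ≥0) (q : ℕ) : tailBound C q 0 ≠ ∞ := by
  have hs : Summable fun i : ℕ => Real.exp (-(i : ℝ)) * (C * ((i : ℝ) + 1) ^ q) := by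
    have h1 := (summable_nat_add_iff 1).2 (Real.summable_pow_mul_exp_neg_nat_mul q one_pos)
    refine (h1.mul_left (C * Real.exp 1)).congr fun i => ?_
    have : Real.exp (-1 * ((i + 1 : ℕ) : ℝ)) = Real.exp (-(i : ℝ)) * Real.exp (-1) := by
      rw [← Real.exp_add]
      congr 1
      push_cast
      ring
    rw [this]
    have h2 : Real.exp 1 * Real.exp (-1) = 1 := by rw [← Real.exp_add]; simp
    push_cast
    linear_combination (C * ((i : ℝ) + 1) ^ q * Real.exp (-(i : ℝ))) * h2
  have h := hs.tsum_ofReal_ne_top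
  rw [tailBound]
  convert h using 4 with i
  rw [ENNReal.ofReal_mul (Real.exp_pos _).le, ENNReal.ofReal_mul NNReal.zero_le_coe,
    ENNReal.ofReal_pow (by positivity), ENNReal.ofReal_add (by positivity) zero_le_one]
  simp

theorem tendsto_tailBound (C : ℝ≥0) (q : ℕ) :
    Tendsto (tailBound C q) atTop (𝓝 0) :=
  ENNReal.tendsto_sum_nat_add
    (fun i : ℕ => ENNReal.ofReal (Real.exp (-(i : ℝ))) * (C * ((i : ℝ≥0∞) + 1) ^ q))
    (by simpa [tailBound] using tailBound_zero_ne_top C q)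

theorem lintegral_expTail_le {Ω : Type*} [MeasurableSpace Ω] {P : Measure Ω}
    {M : Ω → Measure ℝ≥0} (hM : Measurable M) {C : ℝ≥0} {q : ℕ}
    (hmom : ∀ y : ℕ, ∫⁻ ω, M ω (Set.Iic ((y : ℝ≥0) + 1)) ∂P ≤ C * ((y : ℝ≥0∞) + 1) ^ q) (r : ℕ) :
    ∫⁻ ω, expTail r (M ω) ∂P ≤ tailBound C q r := by
  have hMm : ∀ y, Measurable fun ω => M ω (Set.Iic y) := fun y =>
    (Measure.measurable_coe measurableSet_Iic).comp hM
  refine (lintegral_mono fun ω => expTail_le_tsum r (M ω)).trans ?_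
  rw [lintegral_tsum fun i => ((hMm _).const_mul _).aemeasurable]
  refine ENNReal.tsum_le_tsum fun i => ?_
  rw [lintegral_const_mul _ (hMm _)]
  gcongr
  exact_mod_cast hmom (i + r)

/-- Integrals of bounded functions of lattice-valued random vectors pass to the limit. -/
theorem tendsto_integral_of_lattice {N : ℕ} {Ω Ω' : Type*} [MeasurableSpace Ω]
    [MeasurableSpace Ω'] {P : Measure Ω} [IsProbabilityMeasure P] {P' : Measure Ω'}
    [IsProbabilityMeasure P'] {V : ℕ → Ω → EuclideanSpace ℝ (Fin N)}
    {V' : Ω' → EuclideanSpace ℝ (Fin N)}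
    (hV : TendstoInDistribution V atTop V' (fun _ => P) P')
    (hlat : ∀ᶠ n in atTop, ∀ᵐ ω ∂P, V n ω ∈ Set.range fun v : Fin N → ℕ =>
      (WithLp.toLp 2 fun c => (v c : ℝ) : EuclideanSpace ℝ (Fin N)))
    (hlat' : ∀ᵐ ω ∂P', V' ω ∈ Set.range fun v : Fin N → ℕ =>
      (WithLp.toLp 2 fun c => (v c : ℝ) : EuclideanSpace ℝ (Fin N)))
    (h : EuclideanSpace ℝ (Fin N) → ℝ) {B : ℝ} (hB : ∀ v, |h v| ≤ B) :
    Tendsto (fun n => ∫ ω, h (V n ω) ∂P) atTop (𝓝 (∫ ω, h (V' ω) ∂P')) := by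
  let e : (Fin N → ℕ) → EuclideanSpace ℝ (Fin N) := fun v => WithLp.toLp 2 fun c => (v c : ℝ)
  have he : IsClosedEmbedding e :=
    (PiLp.homeomorph 2 fun _ : Fin N => ℝ).symm.isClosedEmbedding.comp
      (IsClosedEmbedding.piMap fun _ => Nat.isClosedEmbedding_coe_real)
  let f : BoundedContinuousFunction (Fin N → ℕ) ℝ :=
    BoundedContinuousFunction.ofNormedAddCommGroup (fun v => h (e v)) continuous_of_discreteTopology
      B fun v => hB _
  obtain ⟨g, -, hg⟩ := BoundedContinuousFunction.exists_extension_norm_eq_of_isClosedEmbedding f he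
  have hgh : ∀ v ∈ Set.range e, g v = h v := by
    rintro _ ⟨v, rfl⟩
    exact congrFun hg v
  have hlim := (ProbabilityMeasure.tendsto_iff_forall_integral_tendsto.1 hV.tendsto) g
  simp only [ProbabilityMeasure.coe_mk] at hlim
  rw [integral_map hV.aemeasurable_limit g.continuous.aestronglyMeasurable] at hlim
  rw [integral_congr_ae (hlat'.mono fun ω hω => (hgh _ hω).symm)]
  refine hlim.congr' ?_
  filter_upwards [hlat] with n hn
  rw [integral_map (hV.forall_aemeasurable n) g.continuous.aestronglyMeasurable]
  exact integral_congr_ae (hn.mono fun ω hω => hgh _ hω)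

/-- The mean discretization error of a Lipschitz function of the leading weights. -/
theorem enorm_integral_sub_gridWeight_le {k : ℕ} {Ω : Type*} [MeasurableSpace Ω] {P : Measure Ω}
    [IsProbabilityMeasure P] {M : Ω → Measure ℝ≥0} (hM : Measurable M) {C : ℝ≥0} {q : ℕ}
    (hmom : ∀ y : ℕ, ∫⁻ ω, M ω (Set.Iic ((y : ℝ≥0) + 1)) ∂P ≤ C * ((y : ℝ≥0∞) + 1) ^ q)
    {w : Ω → Fin k → ℝ} (hw : AEMeasurable w P) (hgood : ∀ᵐ ω ∂P, HasWeights (M ω) (w ω))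
    {f : (Fin k → ℝ) → ℝ} {B : ℝ} (hB : ∀ x, |f x| ≤ B) {l : ℝ≥0} (hf : LipschitzWith l f)
    {r : ℕ} (hr : 0 < r) (K : ℕ) :
    ‖∫ ω, f (w ω) ∂P - ∫ ω, f (gridWeight r k (counts r (M ω))) ∂P‖ₑ ≤
      l * (ENNReal.ofReal (Real.exp (1 / r) - 1) + ENNReal.ofReal (Real.exp K) *
        (ENNReal.ofReal (Real.exp (-r)) + tailBound C q r) +
        P {ω | ¬ 1 ≤ M ω (Set.Iic (K : ℝ≥0))}) := by
  have hG : Measurable fun ω => gridWeight r k (counts r (M ω)) :=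
    (measurable_gridWeight r k).comp ((measurable_counts r).comp hM)
  have hi1 : Integrable (fun ω => f (w ω)) P :=
    Integrable.of_bound (hf.continuous.measurable.comp_aemeasurable hw).aestronglyMeasurable B
      (ae_of_all _ fun _ => hB _)
  have hi2 : Integrable (fun ω => f (gridWeight r k (counts r (M ω)))) P :=
    Integrable.of_bound (hf.continuous.measurable.comp hG).aestronglyMeasurable B
      (ae_of_all _ fun _ => hB _)
  have hset : MeasurableSet {ω | ¬ 1 ≤ M ω (Set.Iic (K : ℝ≥0))} :=
    (measurableSet_le measurable_const ((Measure.measurable_coe measurableSet_Iic).comp hM)).compl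
  rw [← integral_sub hi1 hi2]
  calc _ ≤ ∫⁻ ω, ‖f (w ω) - f (gridWeight r k (counts r (M ω)))‖ₑ ∂P :=
        enorm_integral_le_lintegral_enorm _
    _ ≤ ∫⁻ ω, l * ((ENNReal.ofReal (Real.exp (1 / r) - 1) + ENNReal.ofReal (Real.exp K) *
          (ENNReal.ofReal (Real.exp (-r)) + expTail r (M ω))) +
          {ω | ¬ 1 ≤ M ω (Set.Iic (K : ℝ≥0))}.indicator 1 ω) ∂P := by
        refine lintegral_mono_ae (hgood.mono fun ω hω => ?_)
        have h1 := hf (w ω) (gridWeight r k (counts r (M ω)))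
        rw [edist_eq_enorm_sub, edist_eq_enorm_sub] at h1
        refine h1.trans ?_
        gcongr
        exact hω.enorm_sub_le hr K
    _ = l * ((ENNReal.ofReal (Real.exp (1 / r) - 1) + ENNReal.ofReal (Real.exp K) *
          (ENNReal.ofReal (Real.exp (-r)) + ∫⁻ ω, expTail r (M ω) ∂P)) +
          P {ω | ¬ 1 ≤ M ω (Set.Iic (K : ℝ≥0))}) := by
        rw [lintegral_const_mul' _ _ ENNReal.coe_ne_top,
          lintegral_add_right _ (measurable_one.indicator hset), lintegral_indicator_one hset,
          lintegral_add_left measurable_const, lintegral_const_mul' _ _ ENNReal.ofReal_ne_top,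
          lintegral_add_left measurable_const]
        simp
    _ ≤ _ := by
        gcongr
        exact lintegral_expTail_le hM hmom r

/-- The indicator that the window `[0, K]` is empty, read off from cell counts. -/
def emptyTest (K : ℕ) (v : EuclideanSpace ℝ (Fin (K ^ 2 + 1))) : ℝ :=
  if 1 ≤ ∑ c ∈ Finset.Iic (Fin.last (K ^ 2)), v c then 0 else 1

theorem abs_emptyTest_le (K : ℕ) (v : EuclideanSpace ℝ (Fin (K ^ 2 + 1))) :
    |emptyTest K v| ≤ 1 := by
  unfold emptyTest
  split_ifs <;> simp

theorem HasWeights.emptyTest_counts {k : ℕ} {μ : Measure ℝ≥0} {w : Fin k → ℝ}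
    (hμ : HasWeights μ w) {K : ℕ} (hK : 0 < K) :
    emptyTest K (counts K μ) = if 1 ≤ μ (Set.Iic (K : ℝ≥0)) then 0 else 1 := by
  have h1 := natCast_add_one_le_real_iff hμ.Iic_ne_top (y := K) (j := 0)
  have h2 : (((Fin.last (K ^ 2) : Fin (K ^ 2 + 1)) : ℕ) : ℝ≥0) / K = K := by
    rw [Fin.val_last]
    push_cast
    field_simp
  simp only [Nat.cast_zero, zero_add] at h1
  rw [emptyTest, sum_Iic_counts hK hμ.Iic_ne_top, h2]
  exact if_congr h1 rfl rfl

theorem ofReal_integral_emptyTest {k : ℕ} {Ω : Type*} [MeasurableSpace Ω] {P : Measure Ω}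
    [IsProbabilityMeasure P] {M : Ω → Measure ℝ≥0} (hM : Measurable M) {w : Ω → Fin k → ℝ}
    (hw : ∀ᵐ ω ∂P, HasWeights (M ω) (w ω)) {K : ℕ} (hK : 0 < K) :
    ENNReal.ofReal (∫ ω, emptyTest K (counts K (M ω)) ∂P) =
      P {ω | ¬ 1 ≤ M ω (Set.Iic (K : ℝ≥0))} := by
  have hset : MeasurableSet {ω | ¬ 1 ≤ M ω (Set.Iic (K : ℝ≥0))} :=
    (measurableSet_le measurable_const ((Measure.measurable_coe measurableSet_Iic).comp hM)).compl
  rw [integral_congr_ae (g := {ω | ¬ 1 ≤ M ω (Set.Iic (K : ℝ≥0))}.indicator 1)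
    (hw.mono fun ω hω => ?_), integral_indicator_one hset, ofReal_measureReal]
  rw [hω.emptyTest_counts hK]
  by_cases h : 1 ≤ M ω (Set.Iic (K : ℝ≥0))
  · rw [if_pos h, Set.indicator_of_notMem (by simpa using h)]
  · rw [if_neg h, Set.indicator_of_mem (by simpa using h), Pi.one_apply]

theorem tendstoInDistribution_weights {k : ℕ} {Ω Ω' : Type*} [MeasurableSpace Ω]
    [MeasurableSpace Ω'] {P : Measure Ω} [IsProbabilityMeasure P] {P' : Measure Ω'}
    [IsProbabilityMeasure P'] {M : ℕ → Ω → Measure ℝ≥0} (hM : ∀ n, Measurable (M n))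
    {M' : Ω' → Measure ℝ≥0} (hM' : Measurable M') {w : ℕ → Ω → Fin k → ℝ}
    (hw : ∀ n, AEMeasurable (w n) P) {w' : Ω' → Fin k → ℝ} (hw' : AEMeasurable w' P')
    (hgood : ∀ᶠ n in atTop, ∀ᵐ ω ∂P, HasWeights (M n ω) (w n ω))
    (hgood' : ∀ᵐ ω ∂P', HasWeights (M' ω) (w' ω)) {C : ℝ≥0} {q : ℕ}
    (hmom : ∀ᶠ n in atTop, ∀ y : ℕ,
      ∫⁻ ω, M n ω (Set.Iic ((y : ℝ≥0) + 1)) ∂P ≤ C * ((y : ℝ≥0∞) + 1) ^ q)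
    (hmom' : ∀ y : ℕ, ∫⁻ ω, M' ω (Set.Iic ((y : ℝ≥0) + 1)) ∂P' ≤ C * ((y : ℝ≥0∞) + 1) ^ q)
    (hcell : ∀ r, 0 < r → TendstoInDistribution (fun n ω => counts r (M n ω)) atTop
      (fun ω => counts r (M' ω)) (fun _ => P) P')
    (hinf : Tendsto (fun K : ℕ => P' {ω | ¬ 1 ≤ M' ω (Set.Iic (K : ℝ≥0))}) atTop (𝓝 0)) :
    TendstoInDistribution w atTop w' (fun _ => P) P' where
  forall_aemeasurable := hw
  aemeasurable_limit := hw'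
  tendsto := by
    refine tendsto_iff_forall_lipschitz_integral_tendsto.2 ?_
    rintro f ⟨B₀, hB₀⟩ ⟨l, hf⟩
    have hB : ∀ x, |f x| ≤ B₀ + |f 0| := fun x => by
      have := hB₀ x 0
      rw [Real.dist_eq] at this
      linarith [abs_sub_abs_le_abs_sub (f x) (f 0)]
    simp only [ProbabilityMeasure.coe_mk]
    rw [integral_map hw' hf.continuous.aestronglyMeasurable]
    simp_rw [fun n => integral_map (hw n) (f := f) hf.continuous.aestronglyMeasurable]
    have hlat : ∀ r, 0 < r → ∀ h : EuclideanSpace ℝ (Fin (r ^ 2 + 1)) → ℝ, ∀ B : ℝ,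
        (∀ v, |h v| ≤ B) → Tendsto (fun n => ∫ ω, h (counts r (M n ω)) ∂P) atTop
          (𝓝 (∫ ω, h (counts r (M' ω)) ∂P')) := fun r hr h B hB =>
      tendsto_integral_of_lattice (hcell r hr)
        (hgood.mono fun n hn => hn.mono fun ω hω => hω.counts_mem hr)
        (hgood'.mono fun ω hω => hω.counts_mem hr) h hB
    -- Emptiness of [0, K] can be read off the counts on the grid of index `K`, so its probability
    -- converges; this carries the lower bound on the denominator from the limit to large `n`.
    have hempty : ∀ K : ℕ, 0 < K → Tendsto (fun n => P {ω | ¬ 1 ≤ M n ω (Set.Iic (K : ℝ≥0))})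
        atTop (𝓝 (P' {ω | ¬ 1 ≤ M' ω (Set.Iic (K : ℝ≥0))})) := by
      intro K hK
      have := ENNReal.tendsto_ofReal (hlat K hK (emptyTest K) 1 (abs_emptyTest_le K))
      rw [ofReal_integral_emptyTest hM' hgood' hK] at this
      exact this.congr' (hgood.mono fun n hn => ofReal_integral_emptyTest (hM n) hn hK)
    let err : ℕ → ℕ → ℝ≥0∞ := fun r K => ENNReal.ofReal (Real.exp (1 / r) - 1) +
      ENNReal.ofReal (Real.exp K) * (ENNReal.ofReal (Real.exp (-r)) + tailBound C q r)
    have herr : ∀ K, Tendsto (fun r => err r K) atTop (𝓝 0) := by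
      intro K
      have h1 : Tendsto (fun r : ℕ => ENNReal.ofReal (Real.exp (1 / r) - 1)) atTop (𝓝 0) := by
        rw [← ENNReal.ofReal_zero]
        refine ENNReal.tendsto_ofReal ?_
        have := (Real.continuous_exp.tendsto 0).comp (tendsto_one_div_atTop_nhds_zero_nat (𝕜 := ℝ))
        simpa using this.sub_const 1
      have h2 : Tendsto (fun r : ℕ => ENNReal.ofReal (Real.exp (-r))) atTop (𝓝 0) := by
        rw [← ENNReal.ofReal_zero]
        exact ENNReal.tendsto_ofReal
          (Real.tendsto_exp_neg_atTop_nhds_zero.comp tendsto_natCast_atTop_atTop)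
      have h3 := ENNReal.Tendsto.const_mul (a := ENNReal.ofReal (Real.exp K))
        (h2.add (tendsto_tailBound C q)) (Or.inr ENNReal.ofReal_ne_top)
      rw [zero_add, mul_zero] at h3
      simpa only [zero_add] using h1.add h3
    rw [tendsto_iff_edist_tendsto_0]
    rw [ENNReal.tendsto_nhds_zero]
    intro ε hε
    -- The three summands are the discretization error at `n`, the convergence error on a fixed
    -- grid, and the discretization error of the limit.
    obtain ⟨δ, hδ, hδε⟩ : ∃ δ : ℝ≥0∞, 0 < δ ∧ l * (δ + δ) + δ + l * (δ + δ) ≤ ε := by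
      have : Tendsto (fun δ : ℝ≥0∞ => l * (δ + δ) + δ + l * (δ + δ)) (𝓝[>] 0) (𝓝 0) := by
        have hid : Tendsto (fun δ : ℝ≥0∞ => δ) (𝓝[>] 0) (𝓝 0) :=
          tendsto_id.mono_left nhdsWithin_le_nhds
        have h1 := ENNReal.Tendsto.const_mul (a := (l : ℝ≥0∞)) (hid.add hid)
          (Or.inr ENNReal.coe_ne_top)
        simpa using (h1.add hid).add h1
      obtain ⟨δ, h1, h2⟩ := ((this.eventually (Iic_mem_nhds hε)).and self_mem_nhdsWithin).exists
      exact ⟨δ, h2, h1⟩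
    -- `K` must be chosen before `r`, since the discretization error contains the factor e^K.
    obtain ⟨K, hKδ, hK0⟩ := ((hinf.eventually (Iio_mem_nhds hδ)).and
      (eventually_gt_atTop 0)).exists
    obtain ⟨r, hrδ, hr0⟩ := (((herr K).eventually (Iic_mem_nhds hδ)).and
      (eventually_gt_atTop 0)).exists
    have hlim := hlat r hr0 (fun v => f (gridWeight r k v)) _ fun v => hB _
    rw [tendsto_iff_edist_tendsto_0, ENNReal.tendsto_nhds_zero] at hlim
    filter_upwards [hgood, hmom, hlim δ hδ, (hempty K hK0).eventually (Iio_mem_nhds hKδ)]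
      with n h1 h2 h3 h4
    refine (edist_triangle4 _ (∫ ω, f (gridWeight r k (counts r (M n ω))) ∂P)
      (∫ ω, f (gridWeight r k (counts r (M' ω))) ∂P') _).trans (le_trans ?_ hδε)
    refine add_le_add (add_le_add ?_ h3) ?_
    · rw [edist_eq_enorm_sub]
      refine (enorm_integral_sub_gridWeight_le (hM n) h2 (hw n) h1 hB hf hr0 K).trans ?_
      gcongr
    · rw [edist_comm, edist_eq_enorm_sub]
      refine (enorm_integral_sub_gridWeight_le hM' hmom' hw' hgood' hB hf hr0 K).trans ?_
      gcongr

/-! ### Poisson limit of cell counts -/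

/-- The counting measure of the first `n` points of a sequence. -/
def pointMeasure (n : ℕ) (y : ℕ → ℝ≥0) : Measure ℝ≥0 := ∑ i ∈ Finset.range n, Measure.dirac (y i)

theorem pointMeasure_apply (n : ℕ) (y : ℕ → ℝ≥0) {B : Set ℝ≥0} (hB : MeasurableSet B) :
    pointMeasure n y B = ∑ i ∈ Finset.range n, B.indicator 1 (y i) := by
  simp [pointMeasure, Measure.finsetSum_apply, hB]

theorem measurable_pointMeasure {Ω : Type*} [MeasurableSpace Ω] (n : ℕ) {Y : ℕ → Ω → ℝ≥0}
    (hY : ∀ i, Measurable (Y i)) : Measurable fun ω => pointMeasure n fun i => Y i ω := by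
  refine Measure.measurable_of_measurable_coe _ fun B hB => ?_
  simp_rw [pointMeasure_apply _ _ hB]
  exact Finset.measurable_sum _ fun i _ => (measurable_one.indicator hB).comp (hY i)

theorem sum_indicator_cell {E : Type*} [AddCommMonoid E] (r : ℕ) {N : ℕ} (g : Fin N → E)
    (y : ℝ≥0) : ∑ c : Fin N, (cell r c).indicator (fun _ => g c) y =
      if h : ⌈(r : ℝ≥0) * y⌉₊ < N then g ⟨_, h⟩ else 0 := by
  split_ifs with h
  · rw [Finset.sum_eq_single ⟨_, h⟩]
    · exact Set.indicator_of_mem (show y ∈ cell r _ from rfl) _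
    · intro c _ hc
      refine Set.indicator_of_notMem (fun hy => hc (Fin.ext ?_)) _
      exact (show ⌈(r : ℝ≥0) * y⌉₊ = c from hy).symm
    · simp
  · refine Finset.sum_eq_zero fun c _ => Set.indicator_of_notMem (fun hy => h ?_) _
    rw [show ⌈(r : ℝ≥0) * y⌉₊ = c from hy]
    exact c.2

theorem counts_pointMeasure (r n : ℕ) (y : ℕ → ℝ≥0) (c : Fin (r ^ 2 + 1)) :
    counts r (pointMeasure n y) c =
      ∑ i ∈ Finset.range n, (cell r c).indicator (fun _ => (1 : ℝ)) (y i) := by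
  change (pointMeasure n y (cell r c)).toReal = _
  rw [pointMeasure_apply _ _ (measurableSet_cell r c), ENNReal.toReal_sum]
  · refine Finset.sum_congr rfl fun i _ => ?_
    by_cases h : y i ∈ cell r c <;> simp [h]
  · intro i _
    by_cases h : y i ∈ cell r c <;> simp [h]

/-- The factor `e^(i t_c) - 1` of a point in the cell `c`. -/
def cellFactor (r : ℕ) (t : EuclideanSpace ℝ (Fin (r ^ 2 + 1))) (y : ℝ≥0) : ℂ :=
  ∑ c : Fin (r ^ 2 + 1), (cell r c).indicator (fun _ => Complex.exp (t c * Complex.I) - 1) y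

theorem measurable_cellFactor (r : ℕ) (t : EuclideanSpace ℝ (Fin (r ^ 2 + 1))) :
    Measurable (cellFactor r t) :=
  Finset.measurable_sum _ fun c _ => measurable_const.indicator (measurableSet_cell r c)

/-- Cells are disjoint, so at most one term of the sum is present, and none for a point beyond the
grid. Multiplied over the points, these factors give the integrand of the characteristic function of
the counts. -/
theorem one_add_cellFactor (r : ℕ) (t : EuclideanSpace ℝ (Fin (r ^ 2 + 1))) (y : ℝ≥0) :
    1 + cellFactor r t y = Complex.exp (((∑ c : Fin (r ^ 2 + 1),
      (cell r c).indicator (fun _ => t c) y : ℝ) : ℂ) * Complex.I) := by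
  rw [cellFactor, sum_indicator_cell, sum_indicator_cell r (fun c => t c)]
  split_ifs <;> simp

theorem norm_one_add_cellFactor (r : ℕ) (t : EuclideanSpace ℝ (Fin (r ^ 2 + 1))) (y : ℝ≥0) :
    ‖1 + cellFactor r t y‖ = 1 := by
  rw [one_add_cellFactor, Complex.norm_exp_ofReal_mul_I]

theorem norm_cellFactor_le {r : ℕ} (hr : 0 < r) (t : EuclideanSpace ℝ (Fin (r ^ 2 + 1)))
    (y : ℝ≥0) : ‖cellFactor r t y‖ ≤ (Set.Iic (r : ℝ≥0)).indicator (fun _ => 2) y := by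
  by_cases hy : y ∈ Set.Iic (r : ℝ≥0)
  · rw [Set.indicator_of_mem hy]
    calc ‖cellFactor r t y‖ = ‖(1 + cellFactor r t y) - 1‖ := by ring_nf
      _ ≤ ‖1 + cellFactor r t y‖ + ‖(1 : ℂ)‖ := norm_sub_le _ _
      _ = 2 := by rw [norm_one_add_cellFactor, norm_one]; norm_num
  · rw [Set.indicator_of_notMem hy, cellFactor, sum_indicator_cell, dif_neg, norm_zero]
    intro h
    apply hy
    have h2 := (ceil_mul_le_iff hr y (r ^ 2)).1 (by omega)
    refine h2.trans (le_of_eq ?_)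
    push_cast
    field_simp

theorem real_cell_zero {r : ℕ} (hr : 0 < r) {μ : Measure ℝ≥0} (hμ : ∀ y, μ (Set.Iic y) ≠ ∞) :
    μ.real (cell r 0) = μ.real (Set.Iic 0) := by
  simpa using sum_real_cell hr hμ 0

theorem real_cell_succ {r : ℕ} (hr : 0 < r) {μ : Measure ℝ≥0} (hμ : ∀ y, μ (Set.Iic y) ≠ ∞)
    (c : ℕ) : μ.real (cell r (c + 1)) =
      μ.real (Set.Iic (((c + 1 : ℕ) : ℝ≥0) / r)) - μ.real (Set.Iic ((c : ℝ≥0) / r)) := by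
  rw [← sum_real_cell hr hμ, ← sum_real_cell hr hμ, Finset.sum_range_succ _ (c + 1)]
  ring

/-- Cells are differences of two half-lines, except for the cell of index 0, which is the half-line
ending at 0. -/
theorem tendsto_sum_real_cell {Ω : Type*} [MeasurableSpace Ω] {P : Measure Ω}
    [IsProbabilityMeasure P] {Y : ℕ → ℕ → Ω → ℝ≥0} (hY : ∀ n i, Measurable (Y n i))
    {Λ : Measure ℝ≥0} (hΛ : ∀ y, Λ (Set.Iic y) ≠ ∞)
    (hlim : ∀ y, Tendsto (fun n => ∑ i ∈ Finset.range n, P.real {ω | Y n i ω ≤ y}) atTop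
      (𝓝 (Λ.real (Set.Iic y)))) {r : ℕ} (hr : 0 < r) (c : ℕ) :
    Tendsto (fun n => ∑ i ∈ Finset.range n, P.real (Y n i ⁻¹' cell r c)) atTop
      (𝓝 (Λ.real (cell r c))) := by
  have hmap : ∀ n i, ∀ B, MeasurableSet B → P.real (Y n i ⁻¹' B) = (P.map (Y n i)).real B :=
    fun n i B hB => (map_measureReal_apply (hY n i) hB).symm
  have hIic : ∀ n i y, P.real {ω | Y n i ω ≤ y} = (P.map (Y n i)).real (Set.Iic y) :=
    fun n i y => hmap n i _ measurableSet_Iic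
  have hfin : ∀ n i y, P.map (Y n i) (Set.Iic y) ≠ ∞ := fun n i y => by
    have := Measure.isProbabilityMeasure_map (μ := P) (hY n i).aemeasurable
    exact measure_ne_top _ _
  simp_rw [hIic] at hlim
  simp_rw [fun n i => hmap n i _ (measurableSet_cell r c)]
  cases c with
  | zero =>
    simp_rw [fun n i => real_cell_zero hr (hfin n i)]
    rw [real_cell_zero hr hΛ]
    exact hlim 0
  | succ c =>
    simp_rw [fun n i => real_cell_succ hr (hfin n i), Finset.sum_sub_distrib]
    rw [real_cell_succ hr hΛ]
    exact (hlim _).sub (hlim _)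

theorem IsPoissonPointProcess.map_real {Ω : Type*} [MeasurableSpace Ω] {𝒳 : Ω → Measure ℝ≥0}
    {Λ : Measure ℝ≥0} {P : Measure Ω} (h : IsPoissonPointProcess 𝒳 Λ P) {B : Set ℝ≥0}
    (hB : MeasurableSet B) (hΛ : Λ B < ∞) :
    P.map (fun ω => (𝒳 ω).real B) = (poissonMeasure (Λ B).toNNReal).map (Nat.cast : ℕ → ℝ) := by
  have hm : Measurable fun ω => 𝒳 ω B := (Measure.measurable_coe hB).comp h.measurable
  have h1 : (fun ω => (𝒳 ω).real B) = ENNReal.toReal ∘ fun ω => 𝒳 ω B := rfl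
  rw [h1, ← Measure.map_map ENNReal.measurable_toReal hm, h.law B hB hΛ,
    Measure.map_map ENNReal.measurable_toReal .of_discrete]
  congr 1

theorem IsPoissonPointProcess.charFun_counts {Ω : Type*} [MeasurableSpace Ω]
    {𝒳 : Ω → Measure ℝ≥0} {Λ : Measure ℝ≥0} {P : Measure Ω} [IsProbabilityMeasure P]
    (h : IsPoissonPointProcess 𝒳 Λ P) (hΛ : ∀ y, Λ (Set.Iic y) ≠ ∞) {r : ℕ} (hr : 0 < r)
    (t : EuclideanSpace ℝ (Fin (r ^ 2 + 1))) :
    charFun (P.map fun ω => counts r (𝒳 ω)) t =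
      Complex.exp (∑ c : Fin (r ^ 2 + 1), (Λ.real (cell r c) : ℂ) * (Complex.exp (t c * Complex.I) - 1)) := by
  have hfin : ∀ c : ℕ, Λ (cell r c) < ∞ := fun c =>
    (measure_mono (cell_subset_Iic hr c)).trans_lt (hΛ _).lt_top
  have hind : iIndepFun (fun (c : Fin (r ^ 2 + 1)) ω => (𝒳 ω).real (cell r c)) P :=
    (h.indep _ (fun c => cell r c) (fun c => measurableSet_cell r c) (fun c => hfin c)
      (fun c c' hcc => pairwise_disjoint_cell r (by simpa [Fin.ext_iff] using hcc))).comp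
      (fun _ => ENNReal.toReal) fun _ => ENNReal.measurable_toReal
  have hm : ∀ c : Fin (r ^ 2 + 1), Measurable fun ω => (𝒳 ω).real (cell r c) := fun c =>
    ((Measure.measurable_coe (measurableSet_cell r c)).comp h.measurable).ennreal_toReal
  have := (iIndepFun_iff_charFun_pi fun c => (hm c).aemeasurable).1 hind t
  rw [Complex.exp_sum]
  refine this.trans (Finset.prod_congr rfl fun c _ => ?_)
  rw [h.map_real (measurableSet_cell r c) (hfin c), charFun_map_cast_poissonMeasure]
  rfl

theorem charFun_counts_pointMeasure {Ω : Type*} [MeasurableSpace Ω] {P : Measure Ω}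
    {Y : ℕ → Ω → ℝ≥0} (hY : ∀ i, Measurable (Y i)) (r n : ℕ)
    (t : EuclideanSpace ℝ (Fin (r ^ 2 + 1))) :
    charFun (P.map fun ω => counts r (pointMeasure n fun i => Y i ω)) t =
      ∫ ω, ∏ i ∈ Finset.range n, (1 + cellFactor r t (Y i ω)) ∂P := by
  have hm : Measurable fun ω => counts r (pointMeasure n fun i => Y i ω) :=
    (measurable_counts r).comp (measurable_pointMeasure n hY)
  rw [charFun_apply, integral_map hm.aemeasurable (by fun_prop)]
  refine integral_congr_ae (ae_of_all _ fun ω => ?_)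
  dsimp only
  simp_rw [one_add_cellFactor]
  rw [← Complex.exp_sum, ← Finset.sum_mul, ← Complex.ofReal_sum, Finset.sum_comm]
  congr 3
  rw [PiLp.inner_apply]
  refine Finset.sum_congr rfl fun c _ => ?_
  rw [counts_pointMeasure, Real.inner_apply, mul_comm, Finset.mul_sum]
  refine Finset.sum_congr rfl fun i _ => ?_
  by_cases h : Y i ω ∈ cell r c <;> simp [h]

/-- Cell counts of an `m`-dependent triangular array converge to those of a Poisson process. -/
theorem tendstoInDistribution_counts {Ω Ω' : Type*} [MeasurableSpace Ω] [MeasurableSpace Ω']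
    {P : Measure Ω} [IsProbabilityMeasure P] {P' : Measure Ω'} [IsProbabilityMeasure P']
    {Y : ℕ → ℕ → Ω → ℝ≥0} (hY : ∀ n i, Measurable (Y n i)) {m : ℕ}
    (hind : ∀ n j, IndepFun (fun ω (i : Fin (j - m)) => Y n i ω) (Y n j) P)
    (hC : ∀ y : ℝ≥0, ∃ C : ℝ, 0 ≤ C ∧ ∀ᶠ n : ℕ in atTop, ∀ i < n,
      P.real {ω | Y n i ω ≤ y} ≤ C / n)
    (hCC : ∀ y : ℝ≥0, ∃ C : ℝ, 0 ≤ C ∧ ∀ᶠ n : ℕ in atTop, ∀ i j, i < j → j ≤ i + m → j < n →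
      P.real {ω | Y n i ω ≤ y ∧ Y n j ω ≤ y} ≤ C / n ^ 2)
    {Λ : Measure ℝ≥0} (hΛ : ∀ y, Λ (Set.Iic y) ≠ ∞)
    (hlim : ∀ y, Tendsto (fun n => ∑ i ∈ Finset.range n, P.real {ω | Y n i ω ≤ y}) atTop
      (𝓝 (Λ.real (Set.Iic y))))
    {𝒳 : Ω' → Measure ℝ≥0} (h𝒳 : IsPoissonPointProcess 𝒳 Λ P') {r : ℕ} (hr : 0 < r) :
    TendstoInDistribution (fun n ω => counts r (pointMeasure n fun i => Y n i ω)) atTop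
      (fun ω => counts r (𝒳 ω)) (fun _ => P) P' where
  forall_aemeasurable n :=
    ((measurable_counts r).comp (measurable_pointMeasure n (hY n))).aemeasurable
  aemeasurable_limit := ((measurable_counts r).comp h𝒳.measurable).aemeasurable
  tendsto := by
    refine ProbabilityMeasure.tendsto_of_tendsto_charFun fun t => ?_
    change Tendsto (fun n => charFun (P.map fun ω => counts r (pointMeasure n fun i => Y n i ω)) t)
      atTop (𝓝 (charFun (P'.map fun ω => counts r (𝒳 ω)) t))
    rw [h𝒳.charFun_counts hΛ hr]
    refine Tendsto.congr (fun n => (charFun_counts_pointMeasure (hY n) r n t).symm) ?_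
    obtain ⟨C₁, hC₁0, hC₁⟩ := hC r
    obtain ⟨C₂, hC₂0, hC₂⟩ := hCC r
    have hset : ∀ n i (y : ℝ≥0), MeasurableSet {ω | Y n i ω ≤ y} := fun n i y =>
      measurableSet_le (hY n i) measurable_const
    have hcomp : ∀ n i, Measurable fun ω => cellFactor r t (Y n i ω) := fun n i =>
      (measurable_cellFactor r t).comp (hY n i)
    -- A single constant must serve both bounds. On the window one factor is at most 2 and a product
    -- of two at most 4, which gives `2 * C₁` and `4 * C₂`.
    refine tendsto_integral_prod_exp (X := fun n i ω => cellFactor r t (Y n i ω)) (m := m)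
      (C := 2 * C₁ + 4 * C₂) hcomp
      (fun n i ω => (norm_one_add_cellFactor r t _).le) (fun n j _ => ?_) ?_ ?_ (by positivity) ?_
    · have h1 : (fun ω => ∏ i ∈ Finset.range (j - m), (1 + cellFactor r t (Y n i ω))) =
          (fun y : Fin (j - m) → ℝ≥0 => ∏ i, (1 + cellFactor r t (y i))) ∘
            fun ω (i : Fin (j - m)) => Y n i ω := by
        funext ω
        exact (Fin.prod_univ_eq_prod_range
          (fun i => 1 + cellFactor r t (Y n i ω)) (j - m)).symm
      rw [h1]
      refine (hind n j).comp (Finset.measurable_prod _ fun i _ => measurable_const.add ?_)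
        (measurable_cellFactor r t)
      exact (measurable_cellFactor r t).comp (measurable_pi_apply i)
    · filter_upwards [hC₁] with n hn i hi
      calc ∫ ω, ‖cellFactor r t (Y n i ω)‖ ∂P
          ≤ ∫ ω, {ω | Y n i ω ≤ r}.indicator (fun _ => (2 : ℝ)) ω ∂P :=
            integral_mono_of_nonneg (ae_of_all _ fun _ => norm_nonneg _)
              ((integrable_const _).indicator (hset n i r))
              (ae_of_all _ fun ω => norm_cellFactor_le hr t _)
        _ = 2 * P.real {ω | Y n i ω ≤ r} := by
            rw [integral_indicator_const _ (hset n i r), smul_eq_mul, mul_comm]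
        _ ≤ 2 * (C₁ / n) := by gcongr; exact hn i hi
        _ ≤ (2 * C₁ + 4 * C₂) / n := by
            rw [← mul_div_assoc]
            gcongr
            linarith
    · filter_upwards [hC₂] with n hn i j hij hjm hjn
      have hset2 : MeasurableSet {ω | Y n i ω ≤ r ∧ Y n j ω ≤ r} := (hset n i r).inter (hset n j r)
      calc ∫ ω, ‖cellFactor r t (Y n i ω)‖ * ‖cellFactor r t (Y n j ω)‖ ∂P
          ≤ ∫ ω, {ω | Y n i ω ≤ r ∧ Y n j ω ≤ r}.indicator (fun _ => (4 : ℝ)) ω ∂P := by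
            refine integral_mono_of_nonneg
              (ae_of_all _ fun _ => mul_nonneg (norm_nonneg _) (norm_nonneg _))
              ((integrable_const _).indicator hset2)
              (ae_of_all _ fun ω => ?_)
            have h1 := norm_cellFactor_le hr t (Y n i ω)
            have h2 := norm_cellFactor_le hr t (Y n j ω)
            have h1' := norm_nonneg (cellFactor r t (Y n i ω))
            have h2' := norm_nonneg (cellFactor r t (Y n j ω))
            simp only [Set.indicator_apply, Set.mem_Iic, Set.mem_ofPred_eq] at h1 h2 ⊢
            split_ifs at h1 h2 ⊢ with h3 h4 h5 <;> first | nlinarith | (exfalso; tauto)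
        _ = 4 * P.real {ω | Y n i ω ≤ r ∧ Y n j ω ≤ r} := by
            rw [integral_indicator_const _ hset2, smul_eq_mul, mul_comm]
        _ ≤ 4 * (C₂ / n ^ 2) := by gcongr; exact hn i j hij hjm hjn
        _ ≤ (2 * C₁ + 4 * C₂) / n ^ 2 := by
            rw [← mul_div_assoc]
            gcongr
            linarith
    · have h1 : ∀ n i, ∫ ω, cellFactor r t (Y n i ω) ∂P =
          ∑ c : Fin (r ^ 2 + 1), (P.real (Y n i ⁻¹' cell r c) : ℂ) *
            (Complex.exp (t c * Complex.I) - 1) := by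
        intro n i
        have hpre : ∀ c : ℕ, MeasurableSet (Y n i ⁻¹' cell r c) := fun c =>
          hY n i (measurableSet_cell r c)
        simp only [cellFactor]
        rw [integral_finsetSum]
        · refine Finset.sum_congr rfl fun c _ => ?_
          have := integral_indicator_const (μ := P) (Complex.exp (t c * Complex.I) - 1) (hpre c)
          rw [Complex.real_smul] at this
          exact this
        · intro c _
          exact (integrable_const (Complex.exp (t c * Complex.I) - 1)).indicator (hpre c)
      simp_rw [h1]
      simp_rw [Finset.sum_comm (s := Finset.range _), ← Finset.sum_mul, ← Complex.ofReal_sum]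
      refine tendsto_finsetSum _ fun c _ => Tendsto.mul_const _ ?_
      exact (Complex.continuous_ofReal.tendsto _).comp (tendsto_sum_real_cell hY hΛ hlim hr c)

/-! ### Arrivals of a counting measure -/

section Arrival

variable {μ : Measure ℝ≥0} (hμ : ∀ B : Set ℝ≥0, MeasurableSet B → Bornology.IsBounded B →
  ∃ n : ℕ, μ B = n)

include hμ

theorem counting_Iic_ne_top (y : ℝ≥0) : μ (Set.Iic y) ≠ ∞ := by
  obtain ⟨n, hn⟩ := hμ _ measurableSet_Iic (isBounded_Iic_nnreal y)
  simp [hn]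

/-- The infimum is attained because y ↦ μ [0, y] is right-continuous, by continuity from above for
finite masses. The hypothesis excludes the infimum of the empty set. -/
theorem arrival_le_iff {j : ℕ} (hj : ∃ y, (j : ℝ≥0∞) + 1 ≤ μ (Set.Iic y)) (y : ℝ≥0) :
    (j : ℝ≥0∞) + 1 ≤ μ (Set.Iic y) ↔ arrival μ j ≤ y := by
  refine ⟨fun h => csInf_le (OrderBot.bddBelow _) h, fun h => ?_⟩
  have hlim : Tendsto (fun n : ℕ => μ (Set.Iic (y + 1 / ((n : ℝ≥0) + 1)))) atTop
      (𝓝 (μ (Set.Iic y))) := by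
    have hI : Set.Iic y = ⋂ n : ℕ, Set.Iic (y + 1 / ((n : ℝ≥0) + 1)) := by
      ext z
      simp only [Set.mem_Iic, Set.mem_iInter]
      refine ⟨fun hz n => hz.trans le_self_add, fun hz => ?_⟩
      refine ge_of_tendsto' (x := atTop) ?_ hz
      have h0 : Tendsto (fun n : ℕ => 1 / ((n : ℝ≥0) + 1)) atTop (𝓝 0) :=
        tendsto_one_div_add_atTop_nhds_zero_nat
      simpa using tendsto_const_nhds (x := y).add h0
    rw [hI]
    refine tendsto_measure_iInter_atTop (fun n => measurableSet_Iic.nullMeasurableSet) ?_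
      ⟨0, counting_Iic_ne_top hμ _⟩
    intro n k hnk
    refine Set.Iic_subset_Iic.2 ?_
    gcongr
  refine ge_of_tendsto' hlim fun n => ?_
  have hlt : arrival μ j < y + 1 / ((n : ℝ≥0) + 1) :=
    h.trans_lt (lt_add_of_pos_right _ (by positivity))
  obtain ⟨z, hz, hzy⟩ := exists_lt_of_csInf_lt hj hlt
  exact le_trans hz (measure_mono (Set.Iic_subset_Iic.2 hzy.le))

/-- The second alternative is the degenerate case of too few points, where the infimum of the empty
set is 0. It ranges over integers only, so that it defines a measurable event. -/
theorem arrival_le_iff' (j : ℕ) (y : ℝ≥0) : arrival μ j ≤ y ↔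
    (j : ℝ≥0∞) + 1 ≤ μ (Set.Iic y) ∨ ∀ n : ℕ, ¬ (j : ℝ≥0∞) + 1 ≤ μ (Set.Iic (n : ℝ≥0)) := by
  by_cases hj : ∃ y, (j : ℝ≥0∞) + 1 ≤ μ (Set.Iic y)
  · rw [arrival_le_iff hμ hj, or_iff_left]
    intro h
    obtain ⟨n, hn⟩ := exists_nat_ge (arrival μ j)
    exact h n ((arrival_le_iff hμ hj _).2 hn)
  · have h0 : arrival μ j = 0 := by
      rw [arrival, Set.eq_empty_of_forall_notMem (s := {y | (j : ℝ≥0∞) + 1 ≤ μ (Set.Iic y)})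
        fun y hy => hj ⟨y, hy⟩]
      exact NNReal.sInf_empty
    rw [h0]
    exact ⟨fun _ => Or.inr fun n hn => hj ⟨_, hn⟩, fun _ => bot_le⟩

variable (hinf : ∀ j : ℕ, ∃ y, (j : ℝ≥0∞) + 1 ≤ μ (Set.Iic y))

include hinf

/-- Half-lines form a generating π-system. If [0, y] has mass `n`, exactly the arrivals of index
below `n` lie in it. -/
theorem eq_sum_dirac_arrival : μ = Measure.sum fun j : ℕ => Measure.dirac (arrival μ j) := by
  refine Measure.ext_of_generateFrom_of_iUnion (Set.range Set.Iic) (fun n : ℕ => Set.Iic (n : ℝ≥0))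
    (BorelSpace.measurable_eq.trans (borel_eq_generateFrom_Iic ℝ≥0)) isPiSystem_Iic ?_
    (fun n => ⟨_, rfl⟩) (fun n => counting_Iic_ne_top hμ _) ?_
  · refine Set.eq_univ_of_forall fun y => ?_
    obtain ⟨n, hn⟩ := exists_nat_ge y
    exact Set.mem_iUnion.2 ⟨n, hn⟩
  · rintro _ ⟨y, rfl⟩
    obtain ⟨n, hn⟩ := hμ _ measurableSet_Iic (isBounded_Iic_nnreal y)
    have h1 : ∀ j : ℕ, Measure.dirac (arrival μ j) (Set.Iic y) =
        if j ∈ Finset.range n then 1 else 0 := by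
      intro j
      have h2 : arrival μ j ≤ y ↔ j ∈ Finset.range n := by
        rw [← arrival_le_iff hμ (hinf j), hn, Finset.mem_range, ← Nat.succ_le_iff]
        exact_mod_cast Iff.rfl
      rw [Measure.dirac_apply' _ measurableSet_Iic, Set.indicator_apply]
      exact if_congr h2 rfl rfl
    rw [Measure.sum_apply _ measurableSet_Iic, hn]
    simp_rw [h1]
    rw [tsum_eq_sum (s := Finset.range n) fun j hj => if_neg hj,
      Finset.sum_congr rfl fun j hj => if_pos hj]
    simp

/-- Two equal consecutive arrivals would put mass at least 2 on one point. -/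
theorem strictMono_arrival (hsimple : ∀ y, μ {y} ≤ 1) : StrictMono (arrival μ) := by
  refine strictMono_nat_of_lt_succ fun j => lt_of_le_of_ne ?_ fun heq => ?_
  · rw [← arrival_le_iff hμ (hinf j)]
    refine le_trans ?_ ((arrival_le_iff hμ (hinf (j + 1)) _).2 le_rfl)
    gcongr
    simp
  · have h1 := hsimple (arrival μ j)
    rw [eq_sum_dirac_arrival hμ hinf, Measure.sum_apply _ (measurableSet_singleton _)] at h1
    have h2 := ENNReal.sum_le_tsum (f := fun i : ℕ => Measure.dirac (arrival μ i)
      {arrival (Measure.sum fun j : ℕ => Measure.dirac (arrival μ j)) j}) {j, j + 1}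
    rw [← eq_sum_dirac_arrival hμ hinf] at h1 h2
    have h3 := h2.trans h1
    rw [Finset.sum_pair (by omega), ← heq] at h3
    simp at h3
    exact absurd h3 (by norm_num)

theorem expMass_eq_tsum :
    expMass μ = ∑' j : ℕ, ENNReal.ofReal (Real.exp (-(arrival μ j : ℝ))) := by
  have h : Measurable fun y : ℝ≥0 => ENNReal.ofReal (Real.exp (-(y : ℝ))) := by fun_prop
  have h1 := eq_sum_dirac_arrival hμ hinf
  have h2 := lintegral_sum_measure (fun y : ℝ≥0 => ENNReal.ofReal (Real.exp (-(y : ℝ))))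
    fun j : ℕ => Measure.dirac (arrival μ j)
  rw [← h1] at h2
  rw [expMass, h2]
  exact tsum_congr fun j => lintegral_dirac' _ h

theorem summable_exp_arrival (hS : expMass μ ≠ ∞) :
    Summable fun j : ℕ => Real.exp (-(arrival μ j : ℝ)) := by
  rw [expMass_eq_tsum hμ hinf] at hS
  exact (ENNReal.summable_toReal hS).congr fun j => ENNReal.toReal_ofReal (Real.exp_pos _).le

theorem tsum_exp_arrival (hS : expMass μ ≠ ∞) :
    ∑' j : ℕ, Real.exp (-(arrival μ j : ℝ)) = (expMass μ).toReal := by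
  rw [expMass_eq_tsum hμ hinf, ← ENNReal.ofReal_tsum_of_nonneg (fun _ => (Real.exp_pos _).le)
    (summable_exp_arrival hμ hinf hS),
    ENNReal.toReal_ofReal (tsum_nonneg fun _ => (Real.exp_pos _).le)]

theorem hasWeights_limitWeight (hS : expMass μ ≠ ∞) (k : ℕ) :
    HasWeights μ fun j : Fin k => limitWeight μ j :=
  ⟨hμ, hS, fun j => arrival μ j, fun j => ⟨arrival_le_iff hμ (hinf j), by
    rw [limitWeight, tsum_exp_arrival hμ hinf hS]⟩⟩

end Arrival

theorem measurable_arrival {Ω : Type*} [MeasurableSpace Ω] {M : Ω → Measure ℝ≥0}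
    (hM : Measurable M) (hcount : ∀ ω, ∀ B : Set ℝ≥0, MeasurableSet B → Bornology.IsBounded B →
      ∃ n : ℕ, M ω B = n) (j : ℕ) : Measurable fun ω => arrival (M ω) j := by
  have hMm : ∀ y, Measurable fun ω => M ω (Set.Iic y) := fun y =>
    (Measure.measurable_coe measurableSet_Iic).comp hM
  refine measurable_of_Iic fun y => ?_
  have h : (fun ω => arrival (M ω) j) ⁻¹' Set.Iic y =
      {ω | (j : ℝ≥0∞) + 1 ≤ M ω (Set.Iic y)} ∪
        ⋂ n : ℕ, {ω | (j : ℝ≥0∞) + 1 ≤ M ω (Set.Iic (n : ℝ≥0))}ᶜ := by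
    ext ω
    simp only [Set.mem_preimage, Set.mem_Iic, arrival_le_iff' (hcount ω), Set.mem_union,
      Set.mem_ofPred_eq, Set.mem_iInter, Set.mem_compl_iff]
  rw [h]
  exact (measurableSet_le measurable_const (hMm y)).union
    (MeasurableSet.iInter fun n => (measurableSet_le measurable_const (hMm _)).compl)

theorem measurable_expMass : Measurable expMass :=
  Measure.measurable_lintegral (by fun_prop)

/-! ### Poisson probabilities -/

theorem poissonMeasure_lt (l : ℝ≥0) (n : ℕ) :
    poissonMeasure l {k : ℕ | (k : ℝ≥0∞) < n} =
      ENNReal.ofReal (∑ j ∈ Finset.range n, Real.exp (-l) * l ^ j / j.factorial) := by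
  have h : {k : ℕ | (k : ℝ≥0∞) < n} = (Finset.range n : Set ℕ) := by ext; simp
  rw [h, ← sum_measure_singleton, ENNReal.ofReal_sum_of_nonneg fun _ _ => by positivity]
  simp_rw [poissonMeasure_singleton]

/-- 1 - (1 + l) e^(-l) ≤ 1 - (1 + l)(1 - l) = l². -/
theorem poissonMeasure_two_le (l : ℝ≥0) :
    poissonMeasure l {k : ℕ | 2 ≤ (k : ℝ≥0∞)} ≤ ENNReal.ofReal (l ^ 2) := by
  have h := poissonMeasure_lt l 2
  have h2 : {k : ℕ | 2 ≤ (k : ℝ≥0∞)} = {k : ℕ | (k : ℝ≥0∞) < (2 : ℕ)}ᶜ := by ext; simp [Nat.succ_le_iff]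
  rw [h2, prob_compl_eq_one_sub .of_discrete, h, ← ENNReal.ofReal_one,
    ← ENNReal.ofReal_sub _ (Finset.sum_nonneg fun _ _ => by positivity)]
  refine ENNReal.ofReal_le_ofReal ?_
  simp only [Finset.sum_range_succ, Finset.sum_range_zero]
  have h3 := Real.add_one_le_exp (-(l : ℝ))
  have h4 : (0 : ℝ) ≤ l := l.2
  simp
  nlinarith

theorem lintegral_natCast_poissonMeasure (l : ℝ≥0) :
    ∫⁻ k : ℕ, (k : ℝ≥0∞) ∂poissonMeasure l = l := by
  have hterm : ∀ n : ℕ, ENNReal.ofReal (Real.exp (-l) * l ^ (n + 1) / (n + 1).factorial) *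
      ((n + 1 : ℕ) : ℝ≥0∞) = l * ENNReal.ofReal (Real.exp (-l) * l ^ n / n.factorial) := by
    intro n
    rw [← ENNReal.ofReal_natCast (n + 1), ← ENNReal.ofReal_mul (by positivity),
      ← ENNReal.ofReal_coe_nnreal (p := l), ← ENNReal.ofReal_mul NNReal.zero_le_coe]
    congr 1
    rw [Nat.factorial_succ]
    push_cast
    field_simp
    ring
  rw [poissonMeasure, lintegral_sum_measure]
  simp_rw [lintegral_smul_measure, lintegral_dirac, smul_eq_mul]
  rw [tsum_eq_zero_add' ENNReal.summable]
  simp_rw [hterm]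
  rw [ENNReal.tsum_mul_left, ← ENNReal.ofReal_tsum_of_nonneg (fun _ => by positivity)
    (hasSum_one_poissonMeasure l).summable, (hasSum_one_poissonMeasure l).tsum_eq]
  simp

/-! ### Almost sure structure of the limiting Poisson process -/

section Poisson

variable {Ω : Type*} [MeasurableSpace Ω] {𝒳 : Ω → Measure ℝ≥0} {Λ : Measure ℝ≥0} {P : Measure Ω}

theorem IsPoissonPointProcess.measure_preimage (h : IsPoissonPointProcess 𝒳 Λ P) {B : Set ℝ≥0}
    (hB : MeasurableSet B) (hΛ : Λ B < ∞) {S : Set ℝ≥0∞} (hS : MeasurableSet S) :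
    P {ω | 𝒳 ω B ∈ S} = poissonMeasure (Λ B).toNNReal {k : ℕ | (k : ℝ≥0∞) ∈ S} := by
  have hm : Measurable fun ω => 𝒳 ω B := (Measure.measurable_coe hB).comp h.measurable
  have h1 := Measure.map_apply (μ := P) hm hS
  rw [h.law B hB hΛ, Measure.map_apply .of_discrete hS] at h1
  exact h1.symm

theorem IsPoissonPointProcess.lintegral_apply (h : IsPoissonPointProcess 𝒳 Λ P) {B : Set ℝ≥0}
    (hB : MeasurableSet B) (hΛ : Λ B < ∞) : ∫⁻ ω, 𝒳 ω B ∂P = Λ B := by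
  have hm : Measurable fun ω => 𝒳 ω B := (Measure.measurable_coe hB).comp h.measurable
  have hid : Measurable fun x : ℝ≥0∞ => x := measurable_id
  rw [← lintegral_map hid hm, h.law B hB hΛ, lintegral_map hid .of_discrete,
    lintegral_natCast_poissonMeasure, ENNReal.coe_toNNReal hΛ.ne]

theorem IsPoissonPointProcess.measure_two_le (h : IsPoissonPointProcess 𝒳 Λ P) {B : Set ℝ≥0}
    (hB : MeasurableSet B) (hΛ : Λ B < ∞) :
    P {ω | 2 ≤ 𝒳 ω B} ≤ ENNReal.ofReal (Λ.real B ^ 2) := by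
  exact (h.measure_preimage (S := Set.Ici 2) hB hΛ measurableSet_Ici).le.trans
    (poissonMeasure_two_le _)

/-- A finite sum of terms e^(-λ) λ^j / j!, each vanishing as the mean λ tends to infinity. -/
theorem IsPoissonPointProcess.tendsto_measure_lt (h : IsPoissonPointProcess 𝒳 Λ P)
    (hΛ : ∀ y, Λ (Set.Iic y) ≠ ∞)
    (hinf : Tendsto (fun K : ℕ => Λ.real (Set.Iic (K : ℝ≥0))) atTop atTop) (n : ℕ) :
    Tendsto (fun K : ℕ => P {ω | 𝒳 ω (Set.Iic (K : ℝ≥0)) < n}) atTop (𝓝 0) := by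
  have h1 : ∀ K : ℕ, P {ω | 𝒳 ω (Set.Iic (K : ℝ≥0)) < n} = ENNReal.ofReal
      (∑ j ∈ Finset.range n, Real.exp (-Λ.real (Set.Iic (K : ℝ≥0))) *
        Λ.real (Set.Iic (K : ℝ≥0)) ^ j / j.factorial) := fun K => by
    exact (h.measure_preimage (S := Set.Iio (n : ℝ≥0∞)) measurableSet_Iic (hΛ _).lt_top
      measurableSet_Iio).trans (poissonMeasure_lt _ n)
  simp_rw [h1]
  rw [← ENNReal.ofReal_zero]
  refine ENNReal.tendsto_ofReal ?_
  rw [← Finset.sum_const_zero (s := Finset.range n)]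
  refine tendsto_finsetSum _ fun j _ => ?_
  have h2 := ((Real.tendsto_pow_mul_exp_neg_atTop_nhds_zero j).comp hinf).div_const
    (j.factorial : ℝ)
  rw [zero_div] at h2
  refine h2.congr fun K => ?_
  simp only [Function.comp_apply]
  ring

theorem IsPoissonPointProcess.ae_infinite (h : IsPoissonPointProcess 𝒳 Λ P)
    (hΛ : ∀ y, Λ (Set.Iic y) ≠ ∞)
    (hinf : Tendsto (fun K : ℕ => Λ.real (Set.Iic (K : ℝ≥0))) atTop atTop) :
    ∀ᵐ ω ∂P, ∀ j : ℕ, ∃ y, (j : ℝ≥0∞) + 1 ≤ 𝒳 ω (Set.Iic y) := by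
  refine ae_all_iff.2 fun j => ?_
  rw [ae_iff]
  refine le_antisymm (ge_of_tendsto' (h.tendsto_measure_lt hΛ hinf (j + 1)) fun K => ?_) bot_le
  refine measure_mono fun ω hω => ?_
  have := not_exists.1 hω (K : ℝ≥0)
  rw [not_le] at this
  exact_mod_cast this

/-- If a continuous time change turns the intensity into a multiple of Lebesgue measure, then the
process has no multiple points. -/
theorem IsPoissonPointProcess.ae_simple (h : IsPoissonPointProcess 𝒳 Λ P) {φ : ℝ≥0 → ℝ≥0}
    (hφ : Measurable φ) {c : ℝ≥0} (hΛφ : ∀ t, Λ (φ ⁻¹' Set.Iic t) = c * t) :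
    ∀ᵐ ω ∂P, ∀ y, 𝒳 ω {y} ≤ 1 := by
  have hfin : ∀ t, (Λ.map φ) (Set.Iic t) ≠ ∞ := fun t => by
    rw [Measure.map_apply hφ measurableSet_Iic, hΛφ, ← ENNReal.coe_mul]
    exact ENNReal.coe_ne_top
  have hreal : ∀ t, (Λ.map φ).real (Set.Iic t) = c * t := fun t => by
    rw [measureReal_def, Measure.map_apply hφ measurableSet_Iic, hΛφ, ← ENNReal.coe_mul]
    rfl
  have hcell : ∀ N k : ℕ, 0 < N → Λ.real (φ ⁻¹' cell N (k + 1)) = c / N := fun N k hN => by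
    rw [← map_measureReal_apply hφ (measurableSet_cell _ _), real_cell_succ hN hfin, hreal, hreal]
    push_cast
    ring
  have hcellfin : ∀ N k : ℕ, 0 < N → Λ (φ ⁻¹' cell N k) < ∞ := fun N k hN => by
    rw [← Measure.map_apply hφ (measurableSet_cell _ _)]
    exact (measure_mono (cell_subset_Iic hN k)).trans_lt (hfin _).lt_top
  -- Cells of positive index miss the fibre of `φ` over 0, which carries no intensity and hence
  -- almost surely no point.
  have hzero : ∀ᵐ ω ∂P, 𝒳 ω (φ ⁻¹' Set.Iic 0) = 0 := by
    have h0 := h.lintegral_apply (hφ (measurableSet_Iic (a := 0))) (by rw [hΛφ]; simp)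
    rw [hΛφ, ENNReal.coe_zero, mul_zero] at h0
    exact (lintegral_eq_zero_iff
      ((Measure.measurable_coe (hφ measurableSet_Iic)).comp h.measurable)).1 h0
  have hK : ∀ K : ℕ, ∀ᵐ ω ∂P, ∀ y, φ y ≠ 0 → φ y ≤ K → 𝒳 ω {y} ≤ 1 := by
    intro K
    rw [ae_iff]
    -- Union bound: `K * N` cells of mean c / N, each holding two points with probability at most (c
    -- / N)².
    have hlim : Tendsto (fun N : ℕ => ENNReal.ofReal (K * c ^ 2 / ((N : ℝ)))) atTop (𝓝 0) := by
      rw [← ENNReal.ofReal_zero]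
      exact ENNReal.tendsto_ofReal (tendsto_const_div_atTop_nhds_zero_nat _)
    refine le_antisymm (ge_of_tendsto hlim ?_) bot_le
    filter_upwards [eventually_gt_atTop 0] with N hN
    have hN' : (0 : ℝ) < N := by exact_mod_cast hN
    calc _ ≤ P (⋃ k ∈ Finset.range (K * N), {ω | 2 ≤ 𝒳 ω (φ ⁻¹' cell N (k + 1))}) := by
          refine measure_mono fun ω hω => ?_
          simp only [Set.mem_ofPred_eq, not_forall, not_le] at hω
          obtain ⟨y, hy0, hyK, hy1⟩ := hω
          have hpos : 0 < ⌈(N : ℝ≥0) * φ y⌉₊ :=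
            Nat.ceil_pos.2 (mul_pos (by exact_mod_cast hN) (pos_iff_ne_zero.2 hy0))
          have hle : ⌈(N : ℝ≥0) * φ y⌉₊ ≤ K * N := by
            rw [Nat.ceil_le]
            push_cast
            rw [mul_comm]
            gcongr
          have hmem : y ∈ φ ⁻¹' cell N (⌈(N : ℝ≥0) * φ y⌉₊ - 1 + 1) := by
            rw [Nat.sub_add_cancel hpos]
            rfl
          refine Set.mem_biUnion (x := ⌈(N : ℝ≥0) * φ y⌉₊ - 1)
            (Finset.mem_coe.2 (Finset.mem_range.2 (by omega))) ?_
          obtain ⟨n, hn⟩ := h.counting ω {y} (measurableSet_singleton y) Bornology.isBounded_singleton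
          refine le_trans ?_ (measure_mono (Set.singleton_subset_iff.2 hmem))
          rw [hn] at hy1 ⊢
          exact_mod_cast (by exact_mod_cast hy1 : 1 < n)
      _ ≤ ∑ k ∈ Finset.range (K * N), P {ω | 2 ≤ 𝒳 ω (φ ⁻¹' cell N (k + 1))} :=
          measure_biUnion_finset_le _ _
      _ ≤ ∑ k ∈ Finset.range (K * N), ENNReal.ofReal ((c / N) ^ 2) :=
          Finset.sum_le_sum fun k _ => by
            rw [← hcell N k hN]
            exact h.measure_two_le (hφ (measurableSet_cell _ _)) (hcellfin N _ hN)
      _ = _ := by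
          rw [Finset.sum_const, Finset.card_range, nsmul_eq_mul, ← ENNReal.ofReal_natCast,
            ← ENNReal.ofReal_mul (by positivity)]
          congr 1
          push_cast
          field_simp
  filter_upwards [hzero, ae_all_iff.2 hK] with ω h0 h1 y
  by_cases hy : φ y = 0
  · refine le_trans (measure_mono (t := φ ⁻¹' Set.Iic 0) ?_) (h0.le.trans zero_le_one)
    exact Set.singleton_subset_iff.2 hy.le
  · obtain ⟨K, hKy⟩ := exists_nat_ge (φ y)
    exact h1 K y hy hKy

/-- The mass on (0, ∞) has finite mean by polynomial growth; the atom at 0 is outside `expTail 0`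
and is finite by counting. -/
theorem IsPoissonPointProcess.ae_expMass_ne_top [IsProbabilityMeasure P]
    (h : IsPoissonPointProcess 𝒳 Λ P) {C : ℝ≥0} {q : ℕ}
    (hmom : ∀ y : ℕ, ∫⁻ ω, 𝒳 ω (Set.Iic ((y : ℝ≥0) + 1)) ∂P ≤ C * ((y : ℝ≥0∞) + 1) ^ q) :
    ∀ᵐ ω ∂P, expMass (𝒳 ω) ≠ ∞ := by
  have hm : Measurable (expTail 0) := by
    have hf : Measurable fun y : ℝ≥0 => ENNReal.ofReal (Real.exp (-(y : ℝ))) := by fun_prop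
    have h0 := Measure.measurable_lintegral
      (hf.indicator (measurableSet_Ioi (a := ((0 : ℕ) : ℝ≥0))))
    simp_rw [lintegral_indicator (measurableSet_Ioi (a := ((0 : ℕ) : ℝ≥0)))] at h0
    exact h0
  have h1 := ae_lt_top (hm.comp h.measurable) (ne_top_of_le_ne_top (tailBound_zero_ne_top C q)
    (lintegral_expTail_le h.measurable hmom 0))
  filter_upwards [h1] with ω hω
  have h2 := lintegral_add_compl (μ := 𝒳 ω) (fun y : ℝ≥0 => ENNReal.ofReal (Real.exp (-(y : ℝ))))
    (measurableSet_Iic (a := ((0 : ℕ) : ℝ≥0)))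
  rw [Set.compl_Iic] at h2
  rw [expMass, ← h2]
  refine ENNReal.add_ne_top.2 ⟨?_, hω.ne⟩
  refine ne_top_of_le_ne_top (counting_Iic_ne_top (h.counting ω) ((0 : ℕ) : ℝ≥0)) ?_
  rw [← setLIntegral_one]
  refine setLIntegral_mono' measurableSet_Iic fun y _ => ?_
  rw [← ENNReal.ofReal_one]
  exact ENNReal.ofReal_le_ofReal (Real.exp_le_one_iff.2 (neg_nonpos.2 y.2))

/-- The series of arrivals in the denominator agrees almost surely with `expMass`, which is a
measurable functional. -/
theorem IsPoissonPointProcess.aemeasurable_limitWeight (h : IsPoissonPointProcess 𝒳 Λ P)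
    {k : ℕ} (hw : ∀ᵐ ω ∂P, HasWeights (𝒳 ω) fun j : Fin k => limitWeight (𝒳 ω) j)
    (hinf : ∀ᵐ ω ∂P, ∀ j : ℕ, ∃ y, (j : ℝ≥0∞) + 1 ≤ 𝒳 ω (Set.Iic y)) :
    AEMeasurable (fun ω (j : Fin k) => limitWeight (𝒳 ω) j) P := by
  refine ⟨fun ω j => Real.exp (-(arrival (𝒳 ω) j : ℝ)) / (expMass (𝒳 ω)).toReal, ?_, ?_⟩
  · refine measurable_pi_lambda _ fun j => Measurable.div ?_ ?_
    · have := measurable_arrival h.measurable h.counting j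
      fun_prop
    · exact (measurable_expMass.comp h.measurable).ennreal_toReal
  · filter_upwards [hw, hinf] with ω hω hinf
    funext j
    rw [limitWeight, tsum_exp_arrival hω.counting hinf hω.expMass_ne_top]

end Poisson

/-! ### Poisson processes with power-law intensity -/

section PowerIntensity

variable {c γ a : ℝ} (hc : 0 < c) (hγ : 0 < γ) (ha : 0 < a)

theorem powerIntensity_Iic_ne_top (y : ℝ≥0) :
    powerIntensity c γ a hc.le hγ ha (Set.Iic y) ≠ ∞ := by
  rw [powerIntensity_Iic]
  exact ENNReal.ofReal_ne_top

theorem powerIntensity_real_Iic (y : ℝ≥0) :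
    (powerIntensity c γ a hc.le hγ ha).real (Set.Iic y) = c * ((y : ℝ) / γ) ^ a := by
  rw [measureReal_def, powerIntensity_Iic, ENNReal.toReal_ofReal (by positivity)]

theorem tendsto_powerIntensity_real_Iic :
    Tendsto (fun K : ℕ => (powerIntensity c γ a hc.le hγ ha).real (Set.Iic (K : ℝ≥0))) atTop
      atTop := by
  simp_rw [powerIntensity_real_Iic hc hγ ha]
  refine Tendsto.const_mul_atTop hc ((tendsto_rpow_atTop ha).comp ?_)
  simpa using (tendsto_natCast_atTop_atTop (R := ℝ)).atTop_div_const hγ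

/-- This is the time change to Lebesgue intensity required by `IsPoissonPointProcess.ae_simple`. -/
theorem powerIntensity_preimage (t : ℝ≥0) :
    powerIntensity c γ a hc.le hγ ha ((fun y : ℝ≥0 => (y / γ.toNNReal) ^ a) ⁻¹' Set.Iic t) =
      (c.toNNReal : ℝ≥0∞) * t := by
  have hγ' : 0 < γ.toNNReal := Real.toNNReal_pos.2 hγ
  have h : ((fun y : ℝ≥0 => (y / γ.toNNReal) ^ a) ⁻¹' Set.Iic t) =
      Set.Iic (t ^ a⁻¹ * γ.toNNReal) := by
    ext y
    rw [Set.mem_preimage, Set.mem_Iic, Set.mem_Iic, ← NNReal.le_rpow_inv_iff ha,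
      div_le_iff₀ hγ']
  rw [h, powerIntensity_Iic]
  push_cast
  rw [Real.coe_toNNReal _ hγ.le, mul_div_assoc, div_self hγ.ne', mul_one, ← Real.rpow_mul t.coe_nonneg,
    inv_mul_cancel₀ ha.ne', Real.rpow_one, ENNReal.ofReal_mul hc.le, ENNReal.ofReal_coe_nnreal]
  rfl

variable {Ω : Type*} [MeasurableSpace Ω] {𝒳 : Ω → Measure ℝ≥0} {P : Measure Ω}
  [IsProbabilityMeasure P]
  (h𝒳 : IsPoissonPointProcess 𝒳 (powerIntensity c γ a hc.le hγ ha) P)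

include h𝒳

omit [IsProbabilityMeasure P] in
-- The mean is c ((y + 1) / γ)^a; since y + 1 ≥ 1, the exponent may be raised to a natural number.
theorem IsPoissonPointProcess.exists_lintegral_Iic_le {q : ℕ} (haq : a ≤ q) :
    ∃ C : ℝ≥0, ∀ y : ℕ,
      ∫⁻ ω, 𝒳 ω (Set.Iic ((y : ℝ≥0) + 1)) ∂P ≤ C * ((y : ℝ≥0∞) + 1) ^ q := by
  refine ⟨(c / γ ^ a).toNNReal, fun y => ?_⟩
  rw [h𝒳.lintegral_apply measurableSet_Iic (powerIntensity_Iic_ne_top hc hγ ha _).lt_top,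
    powerIntensity_Iic]
  have h4 : ((c / γ ^ a).toNNReal : ℝ≥0∞) * ((y : ℝ≥0∞) + 1) ^ q =
      ENNReal.ofReal (c / γ ^ a * ((y : ℝ) + 1) ^ q) := by
    rw [ENNReal.ofReal_mul (by positivity), ENNReal.ofReal_pow (by positivity),
      ENNReal.ofReal_add (by positivity) zero_le_one, ENNReal.ofReal_natCast, ENNReal.ofReal_one]
    rfl
  rw [h4]
  refine ENNReal.ofReal_le_ofReal ?_
  push_cast
  rw [Real.div_rpow (by positivity) hγ.le, mul_div_assoc', mul_div_right_comm, ← Real.rpow_natCast]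
  gcongr
  simp

theorem ae_arrivals {C : ℝ≥0} {q : ℕ}
    (hmom : ∀ y : ℕ, ∫⁻ ω, 𝒳 ω (Set.Iic ((y : ℝ≥0) + 1)) ∂P ≤ C * ((y : ℝ≥0∞) + 1) ^ q) :
    ∀ᵐ ω ∂P, 0 < arrival (𝒳 ω) 0 ∧ StrictMono (arrival (𝒳 ω)) ∧
      𝒳 ω = Measure.sum (fun j : ℕ => Measure.dirac (arrival (𝒳 ω) j)) ∧
      Summable (fun j : ℕ => Real.exp (-(arrival (𝒳 ω) j : ℝ))) := by
  have hzero : ∀ᵐ ω ∂P, 𝒳 ω (Set.Iic 0) = 0 := by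
    have h0 := h𝒳.lintegral_apply measurableSet_Iic
      (powerIntensity_Iic_ne_top hc hγ ha 0).lt_top
    rw [powerIntensity_Iic] at h0
    simp only [NNReal.coe_zero, zero_div, Real.zero_rpow ha.ne', mul_zero, ENNReal.ofReal_zero]
      at h0
    exact (lintegral_eq_zero_iff
      ((Measure.measurable_coe measurableSet_Iic).comp h𝒳.measurable)).1 h0
  filter_upwards [hzero, h𝒳.ae_simple (by fun_prop) (powerIntensity_preimage hc hγ ha),
    h𝒳.ae_infinite (powerIntensity_Iic_ne_top hc hγ ha) (tendsto_powerIntensity_real_Iic hc hγ ha),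
    h𝒳.ae_expMass_ne_top hmom] with ω h0 h1 h2 h3
  refine ⟨?_, strictMono_arrival (h𝒳.counting ω) h2 h1, eq_sum_dirac_arrival (h𝒳.counting ω) h2,
    summable_exp_arrival (h𝒳.counting ω) h2 h3⟩
  rw [pos_iff_ne_zero]
  intro h
  have := (arrival_le_iff (h𝒳.counting ω) (h2 0) 0).2 h.le
  rw [h0] at this
  simp at this

end PowerIntensity

/-! ### Ordered weights of a finite sample -/

/-- The entry of index `j` in decreasing order is at least `t` exactly when `j + 1` entries are.
That count is symmetric and measurable, so the sorting permutation drops out. -/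
theorem measurable_nthLargest (n j : ℕ) : Measurable fun a : Fin n → ℝ => nthLargest a j := by
  by_cases h : j < n
  swap
  · simp only [nthLargest, h, dite_false]
    exact measurable_const
  have hiff : ∀ (a : Fin n → ℝ) (t : ℝ), t ≤ nthLargest a j ↔
      (j : ℝ) + 1 ≤ ∑ i, if t ≤ a i then (1 : ℝ) else 0 := by
    intro a t
    have hmono := Tuple.monotone_sort fun i => -a i
    set σ := Tuple.sort fun i => -a i with hσ
    have hval : nthLargest a j = a (σ ⟨j, h⟩) := by rw [nthLargest, dif_pos h]
    have hsum : (∑ i, if t ≤ a i then (1 : ℝ) else 0) =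
        (Finset.univ.filter fun i => t ≤ a (σ i)).card := by
      rw [← Equiv.sum_comp σ]
      simp
    rw [hval, hsum]
    have hcast : (j : ℝ) + 1 ≤ (Finset.univ.filter fun i => t ≤ a (σ i)).card ↔
        j + 1 ≤ (Finset.univ.filter fun i => t ≤ a (σ i)).card := by exact_mod_cast Iff.rfl
    rw [hcast]
    constructor
    · intro ht
      have hsub : Finset.Iic (⟨j, h⟩ : Fin n) ⊆ Finset.univ.filter fun i => t ≤ a (σ i) := by
        intro i hi
        have := hmono (Finset.mem_Iic.1 hi)
        simp only [Function.comp_apply, neg_le_neg_iff] at this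
        simpa using ht.trans this
      simpa using Finset.card_le_card hsub
    · intro hcard
      by_contra ht
      have hsub : (Finset.univ.filter fun i => t ≤ a (σ i)) ⊆ Finset.Iio (⟨j, h⟩ : Fin n) := by
        intro i hi
        rw [Finset.mem_Iio]
        by_contra hij
        have := hmono (not_lt.1 hij)
        simp only [Function.comp_apply, neg_le_neg_iff] at this
        exact ht ((Finset.mem_filter.1 hi).2.trans this)
      have := Finset.card_le_card hsub
      rw [Fin.card_Iio] at this
      simp only at this
      omega
  refine measurable_of_Ici fun t => ?_
  have hset : (fun a : Fin n → ℝ => nthLargest a j) ⁻¹' Set.Ici t =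
      {a | (j : ℝ) + 1 ≤ ∑ i, if t ≤ a i then (1 : ℝ) else 0} := by
    ext a
    exact hiff a t
  rw [hset]
  refine measurableSet_le measurable_const (Finset.measurable_sum _ fun i _ => ?_)
  exact Measurable.ite (measurableSet_le measurable_const (measurable_pi_apply i))
    measurable_const measurable_const

theorem pointMeasure_eq_card (n : ℕ) (y : ℕ → ℝ≥0) {B : Set ℝ≥0} (hB : MeasurableSet B)
    [DecidablePred (· ∈ B)] :
    pointMeasure n y B = ((Finset.univ.filter fun i : Fin n => y i ∈ B).card : ℕ) := by
  rw [pointMeasure_apply n y hB, ← Fin.sum_univ_eq_sum_range (fun i => B.indicator 1 (y i)),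
    Finset.card_filter]
  push_cast
  refine Finset.sum_congr rfl fun i _ => ?_
  by_cases h : y i ∈ B <;> simp [h]

theorem expMass_pointMeasure (n : ℕ) (y : ℕ → ℝ≥0) :
    expMass (pointMeasure n y) = ENNReal.ofReal (∑ i : Fin n, Real.exp (-(y i : ℝ))) := by
  have hm : Measurable fun y : ℝ≥0 => ENNReal.ofReal (Real.exp (-(y : ℝ))) := by fun_prop
  rw [ENNReal.ofReal_sum_of_nonneg fun _ _ => (Real.exp_pos _).le,
    Fin.sum_univ_eq_sum_range (fun i => ENNReal.ofReal (Real.exp (-(y i : ℝ)))), expMass,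
    pointMeasure, lintegral_finsetSum_measure]
  exact Finset.sum_congr rfl fun i _ => lintegral_dirac' _ hm

/-- The ordered softmax weights of a finite sample are its leading normalized exponential
weights. -/
theorem hasWeights_pointMeasure {n k : ℕ} (hkn : k ≤ n) (y : ℕ → ℝ≥0) :
    HasWeights (pointMeasure n y) fun j : Fin k => nthLargest
      (fun i : Fin n => Real.exp (-(y i : ℝ)) / ∑ i : Fin n, Real.exp (-(y i : ℝ))) j where
  counting B hB _ := by
    classical
    exact ⟨_, pointMeasure_eq_card n y hB⟩
  expMass_ne_top := by
    rw [expMass_pointMeasure]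
    exact ENNReal.ofReal_ne_top
  weights := by
    set S := ∑ i : Fin n, Real.exp (-(y i : ℝ)) with hS
    set σ := Tuple.sort fun i : Fin n => -(Real.exp (-(y i : ℝ)) / S) with hσ
    refine ⟨fun j => y (σ (Fin.castLE hkn j)), fun j => ?_⟩
    have hSpos : 0 < S := Finset.sum_pos (fun _ _ => Real.exp_pos _)
      ⟨Fin.castLE hkn j, Finset.mem_univ _⟩
    -- Normalized exponentials reverse the order, so sorting the weights decreasingly lists the
    -- points increasingly.
    have hmono : ∀ i l : Fin n, i ≤ l → y (σ i) ≤ y (σ l) := by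
      intro i l hil
      have := Tuple.monotone_sort (fun i : Fin n => -(Real.exp (-(y i : ℝ)) / S)) hil
      simp only [Function.comp_apply, neg_le_neg_iff] at this
      rw [div_le_div_iff_of_pos_right hSpos, Real.exp_le_exp, neg_le_neg_iff] at this
      exact_mod_cast this
    constructor
    · intro z
      classical
      rw [pointMeasure_eq_card n y measurableSet_Iic]
      have hcard : (Finset.univ.filter fun i : Fin n => y i ∈ Set.Iic z).card =
          (Finset.univ.filter fun i : Fin n => y (σ i) ≤ z).card := by
        rw [Finset.card_filter, Finset.card_filter, ← Equiv.sum_comp σ]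
        rfl
      rw [hcard]
      have hcast : (((j : ℕ) : ℝ≥0∞) + 1 ≤
          ((Finset.univ.filter fun i : Fin n => y (σ i) ≤ z).card : ℕ)) ↔
          (j : ℕ) + 1 ≤ (Finset.univ.filter fun i : Fin n => y (σ i) ≤ z).card := by
        exact_mod_cast Iff.rfl
      rw [hcast]
      constructor
      · intro hc
        by_contra hz
        have hsub : (Finset.univ.filter fun i : Fin n => y (σ i) ≤ z) ⊆
            Finset.Iio (Fin.castLE hkn j) := by
          intro i hi
          rw [Finset.mem_Iio]
          by_contra hij
          exact hz ((hmono _ _ (not_lt.1 hij)).trans (Finset.mem_filter.1 hi).2)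
        have := Finset.card_le_card hsub
        rw [Fin.card_Iio, Fin.val_castLE] at this
        omega
      · intro hz
        have hsub : Finset.Iic (Fin.castLE hkn j) ⊆
            Finset.univ.filter fun i : Fin n => y (σ i) ≤ z := by
          intro i hi
          simpa using (hmono _ _ (Finset.mem_Iic.1 hi)).trans hz
        simpa using Finset.card_le_card hsub
    · rw [nthLargest, dif_pos (j.2.trans_le hkn), expMass_pointMeasure,
        ENNReal.toReal_ofReal hSpos.le]
      rfl

/-! ### Caps around the orbit closure -/

theorem mem_cap_mono {L s : ℕ} (u : USphere L s) {t t' : ℝ} (h : t ≤ t') : cap u t ⊆ cap u t' :=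
  fun _ hx => le_trans hx h

/-- The squared chord length is 2 - 2⟨u, x⟩ ≤ 2t, whence cap heights like δ² / 4 below. -/
theorem dist_lt_of_mem_cap {L s : ℕ} {u x : USphere L s} {t δ : ℝ} (hδ : 0 < δ)
    (ht : 2 * t < δ ^ 2) (hx : x ∈ cap u t) : dist x u < δ := by
  have h1 : 1 - inner ℝ (u : Space L s) (x : Space L s) ≤ t := hx
  have h2 : ‖(x : Space L s) - u‖ ^ 2 = 2 - 2 * inner ℝ (u : Space L s) (x : Space L s) := by
    rw [norm_sub_sq_real, mem_sphere_zero_iff_norm.1 x.2, mem_sphere_zero_iff_norm.1 u.2,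
      real_inner_comm]
    ring
  rw [Subtype.dist_eq, dist_eq_norm]
  exact lt_of_pow_lt_pow_left₀ 2 hδ.le (by rw [h2]; linarith)

theorem exists_cap_oscillation {L s : ℕ} {O V : Set (USphere L s)} (hO : IsCompact O)
    (hV : IsOpen V) (hOV : O ⊆ V) {ρ : USphere L s → ℝ≥0} (hρ : ContinuousOn ρ V) {ε : ℝ}
    (hε : 0 < ε) : ∃ t₀ : ℝ, 0 < t₀ ∧ ∀ u ∈ O, ∀ x ∈ cap u t₀, |(ρ x : ℝ) - ρ u| ≤ ε := by
  have hcont : ∀ u ∈ O, ContinuousAt (fun u => (ρ u : ℝ)) u := fun u hu =>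
    NNReal.continuous_coe.continuousAt.comp (hρ.continuousAt (hV.mem_nhds (hOV hu)))
  have h := hO.uniformContinuousAt_of_continuousAt (fun u => (ρ u : ℝ)) hcont
    (Metric.dist_mem_uniformity hε)
  obtain ⟨δ, hδ, hδ'⟩ := Metric.mem_uniformity_dist.1 h
  refine ⟨δ ^ 2 / 4, by positivity, fun u hu x hx => ?_⟩
  have hd := dist_lt_of_mem_cap hδ (by nlinarith [pow_pos hδ 2]) hx
  rw [dist_comm] at hd
  have := hδ' hd hu
  rw [abs_sub_comm]
  exact le_of_lt this

theorem abs_withDensity_real_sub_le {α : Type*} [MeasurableSpace α] {σ : Measure α}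
    [IsFiniteMeasure σ] {ρ : α → ℝ≥0} (hρ : Measurable ρ) {B : Set α} (hB : MeasurableSet B)
    {a ε : ℝ} (h : ∀ x ∈ B, |(ρ x : ℝ) - a| ≤ ε) :
    |(σ.withDensity fun x => (ρ x : ℝ≥0∞)).real B - a * σ.real B| ≤ ε * σ.real B := by
  have hm : Measurable fun x => (ρ x : ℝ) := hρ.coe_nnreal_real
  have h1 : (σ.withDensity fun x => (ρ x : ℝ≥0∞)).real B = ∫ x in B, (ρ x : ℝ) ∂σ := by
    rw [measureReal_def, withDensity_apply _ hB,
      integral_eq_lintegral_of_nonneg_ae (ae_of_all _ fun x => (ρ x).coe_nonneg)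
        hm.aestronglyMeasurable]
    simp_rw [ENNReal.ofReal_coe_nnreal]
  have hint : IntegrableOn (fun x => (ρ x : ℝ)) B σ := by
    refine Measure.integrableOn_of_bounded (M := |a| + ε) (measure_ne_top _ _)
      hm.aestronglyMeasurable ((ae_restrict_iff' hB).2 (ae_of_all _ fun x hx => ?_))
    rw [Real.norm_eq_abs]
    linarith [h x hx, abs_sub_abs_le_abs_sub (ρ x : ℝ) a]
  have h2 : ∫ x in B, (ρ x : ℝ) ∂σ - a * σ.real B = ∫ x in B, ((ρ x : ℝ) - a) ∂σ := by
    rw [integral_sub hint (integrable_const _)]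
    simp [mul_comm]
  rw [h1, h2]
  have h3 : ‖∫ x in B, ((ρ x : ℝ) - a) ∂σ‖ ≤ ε * σ.real B :=
    norm_setIntegral_le_of_norm_le_const (measure_lt_top _ _) h
  exact h3

/-! ### Asymptotics of cap areas -/

/-- 1 - (1 - t)² = t(2 - t), and the power k / 2 turns n^(2/k) into n. -/
theorem tendsto_mul_sqrt_pow {k : ℕ} (hk : 0 < k) {t : ℕ → ℝ} (ht0 : ∀ᶠ n in atTop, 0 ≤ t n)
    (ht : Tendsto t atTop (𝓝 0)) {τ : ℝ}
    (hτ : Tendsto (fun n : ℕ => (n : ℝ) ^ (2 / (k : ℝ)) * t n) atTop (𝓝 τ)) :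
    Tendsto (fun n : ℕ => (n : ℝ) * √(1 - (1 - t n) ^ 2) ^ k) atTop
      (𝓝 ((2 * τ) ^ ((k : ℝ) / 2))) := by
  have hk' : (0 : ℝ) < k := by exact_mod_cast hk
  have h1 : Tendsto (fun n : ℕ => ((n : ℝ) ^ (2 / (k : ℝ)) * t n) * (2 - t n)) atTop
      (𝓝 (τ * (2 - 0))) := hτ.mul (tendsto_const_nhds.sub ht)
  have h2 := ((Real.continuous_rpow_const (q := (k : ℝ) / 2) (by positivity)).tendsto _).comp h1
  rw [sub_zero, mul_comm τ] at h2
  refine h2.congr' ?_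
  filter_upwards [ht0, ht.eventually (Iic_mem_nhds zero_lt_one)] with n hn0 hn1
  have hn1' : t n ≤ 1 := hn1
  have hw : 0 ≤ 1 - (1 - t n) ^ 2 := by nlinarith
  have hw' : (n : ℝ) ^ (2 / (k : ℝ)) * t n * (2 - t n) =
      (n : ℝ) ^ (2 / (k : ℝ)) * (1 - (1 - t n) ^ 2) := by ring
  rw [Function.comp_apply, hw', Real.mul_rpow (by positivity) hw,
    ← Real.rpow_mul (Nat.cast_nonneg n), Real.sqrt_eq_rpow, ← Real.rpow_mul_natCast hw]
  congr 2
  · rw [div_mul_div_cancel₀ hk'.ne', div_self two_ne_zero, Real.rpow_one]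
  · ring

/-- Rescaled cap areas converge uniformly over the centers. -/
theorem tendsto_mul_surface_cap {L s k : ℕ} (hLs : 2 * L + s = k + 1) (hk : 0 < k) {t : ℕ → ℝ}
    (ht0 : ∀ᶠ n in atTop, 0 ≤ t n) (ht : Tendsto t atTop (𝓝 0)) {τ : ℝ}
    (hτ : Tendsto (fun n : ℕ => (n : ℝ) ^ (2 / (k : ℝ)) * t n) atTop (𝓝 τ)) {ε : ℝ} (hε : 0 < ε) :
    ∀ᶠ n : ℕ in atTop, ∀ u : USphere L s,
      |n * (surface L s).real (cap u (t n)) - ballVol k * (2 * τ) ^ ((k : ℝ) / 2)| ≤ ε := by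
  have h0 := (tendsto_mul_sqrt_pow hk ht0 ht hτ).const_mul (ballVol k)
  have h1 : Tendsto (fun n => 1 - t n) atTop (𝓝 1) := by
    simpa using tendsto_const_nhds (x := (1 : ℝ)).sub ht
  have hlo := h0.mul h1
  have hhi := h0.div (h1.pow k) (by simp)
  rw [mul_one] at hlo
  rw [one_pow, div_one] at hhi
  filter_upwards [ht0, ht.eventually (Iio_mem_nhds zero_lt_one),
    hlo.eventually (Metric.closedBall_mem_nhds _ hε),
    hhi.eventually (Metric.closedBall_mem_nhds _ hε)] with n hn0 hn1 hnlo hnhi u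
  rw [Real.dist_eq, abs_le] at hnlo hnhi
  obtain ⟨hb1, hb2⟩ := surface_cap_bounds hLs u hn0 hn1
  have hn : (0 : ℝ) ≤ n := Nat.cast_nonneg n
  have hb1' := mul_le_mul_of_nonneg_left hb1 hn
  have hb2' := mul_le_mul_of_nonneg_left hb2 hn
  have e1 : (n : ℝ) * (ballVol k * √(1 - (1 - t n) ^ 2) ^ k * (1 - t n)) =
      ballVol k * (n * √(1 - (1 - t n) ^ 2) ^ k) * (1 - t n) := by ring
  have e2 : (n : ℝ) * (ballVol k * √(1 - (1 - t n) ^ 2) ^ k / (1 - t n) ^ k) =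
      ballVol k * (n * √(1 - (1 - t n) ^ 2) ^ k) / (1 - t n) ^ k := by ring
  rw [e1] at hb1'
  rw [e2] at hb2'
  simp only [Pi.div_apply] at hnhi
  rw [abs_le]
  constructor <;> linarith [hnlo.1, hnhi.2]

/-- A non-asymptotic bound, for moment estimates that must hold for all windows at once. -/
theorem surface_cap_le {L s k : ℕ} (hLs : 2 * L + s = k + 1) (u : USphere L s) {t : ℝ}
    (ht0 : 0 ≤ t) (ht1 : t ≤ 1 / 2) :
    (surface L s).real (cap u t) ≤ ballVol k * 2 ^ k * (2 * t) ^ ((k : ℝ) / 2) := by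
  refine (surface_cap_bounds hLs u ht0 (by linarith)).2.trans ?_
  have hκ := ballVol_pos k
  have h1 : √(1 - (1 - t) ^ 2) ^ k ≤ (2 * t) ^ ((k : ℝ) / 2) := by
    rw [show (k : ℝ) / 2 = (1 / 2) * (k : ℕ) by ring, Real.rpow_mul_natCast (by positivity),
      ← Real.sqrt_eq_rpow]
    gcongr
    nlinarith
  have h2 : (1 / 2 : ℝ) ^ k ≤ (1 - t) ^ k := by
    gcongr
    linarith
  calc _ ≤ ballVol k * (2 * t) ^ ((k : ℝ) / 2) / (1 / 2) ^ k := by gcongr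
    _ = _ := by
      rw [one_div, inv_pow, div_inv_eq_mul]
      ring

/-! ### The point process of rescaled distances -/

section Keys

variable {L s : ℕ} {ϑ : Fin L → ℝ} {q : USphere L s} {Ω : Type*} [MeasurableSpace Ω]
  {P : Measure Ω} {x : ℤ → Ω → USphere L s} {m : ℕ} {ρ : USphere L s → ℝ≥0}

/-- The distance `b U_(i+1)` of a key to its target, rescaled by the inverse temperature. -/
def keyPoint (ϑ : Fin L → ℝ) (q : USphere L s) (x : ℤ → USphere L s) (b : ℝ) (i : ℕ) : ℝ≥0 :=
  (b * dist2target ϑ q x ((i : ℤ) + 1)).toNNReal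

theorem dist2target_nonneg (ϑ : Fin L → ℝ) (q : USphere L s) (x : ℤ → USphere L s) (i : ℤ) :
    0 ≤ dist2target ϑ q x i := by
  have h := real_inner_le_norm (target ϑ q i : Space L s) (x i : Space L s)
  rw [mem_sphere_zero_iff_norm.1 (target ϑ q i).2, mem_sphere_zero_iff_norm.1 (x i).2] at h
  unfold dist2target
  linarith

theorem keyPoint_le_iff {x : ℤ → USphere L s} {b : ℝ} (hb : 0 < b) {i : ℕ} {y : ℝ≥0} :
    keyPoint ϑ q x b i ≤ y ↔ x (i + 1) ∈ cap (target ϑ q (i + 1)) (y / b) := by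
  rw [keyPoint, Real.toNNReal_le_iff_le_coe, ← le_div_iff₀' hb]
  rfl

/-- Distances are nonnegative, so the truncation in `keyPoint` is harmless for `b > 0`. This holds
for `β n` only eventually. -/
theorem weight_eq {x : ℤ → USphere L s} {b : ℝ} (hb : 0 < b) (n : ℕ) :
    weight ϑ q x b n = fun i : Fin n => Real.exp (-(keyPoint ϑ q x b i : ℝ)) /
      ∑ j : Fin n, Real.exp (-(keyPoint ϑ q x b j : ℝ)) := by
  have h : ∀ i : ℕ, (keyPoint ϑ q x b i : ℝ) = b * dist2target ϑ q x ((i : ℤ) + 1) := fun i =>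
    Real.coe_toNNReal _ (mul_nonneg hb.le (dist2target_nonneg ϑ q x _))
  funext i
  simp_rw [weight, h, neg_mul]

theorem CorrelatedKeys.measurable_dist2target (hx : CorrelatedKeys ϑ q P x m ρ) (i : ℤ) :
    Measurable fun ω => dist2target ϑ q (fun i => x i ω) i := by
  have h := hx.measurable i
  unfold dist2target
  exact measurable_const.sub
    (Measurable.const_inner (𝕜 := ℝ) (c := (target ϑ q i : Space L s))
      (measurable_subtype_coe.comp h))

theorem CorrelatedKeys.measurable_keyPoint (hx : CorrelatedKeys ϑ q P x m ρ) (b : ℝ) (i : ℕ) :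
    Measurable fun ω => keyPoint ϑ q (fun i => x i ω) b i :=
  ((hx.measurable_dist2target _).const_mul b).real_toNNReal

theorem CorrelatedKeys.measurable_weight (hx : CorrelatedKeys ϑ q P x m ρ) (b : ℝ) (n : ℕ) :
    Measurable fun ω => weight ϑ q (fun i => x i ω) b n := by
  have h := fun i => ((hx.measurable_dist2target i).const_mul (-b)).exp
  exact measurable_pi_lambda _ fun i => (h _).div (Finset.measurable_sum _ fun j _ => h _)

/-- Indices below `j - m` are more than `m` away from `j`, exactly the gap that m-dependence asks
for. -/
theorem CorrelatedKeys.indepFun_keyPoint (hx : CorrelatedKeys ϑ q P x m ρ) (b : ℝ) (j : ℕ) :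
    IndepFun (fun ω (i : Fin (j - m)) => keyPoint ϑ q (fun i => x i ω) b i)
      (fun ω => keyPoint ϑ q (fun i => x i ω) b j) P := by
  have h := hx.m_dependent (Set.range fun i : Fin (j - m) => ((i : ℕ) : ℤ) + 1) {(j : ℤ) + 1} (by
    rintro _ ⟨i, rfl⟩ _ rfl
    have := i.2
    rw [lt_abs]
    right
    dsimp only
    omega)
  obtain ⟨f, hf⟩ : ∃ f : ℤ → USphere L s → ℝ≥0, ∀ i z, f i z =
      (b * (1 - inner ℝ (target ϑ q i : Space L s) (z : Space L s))).toNNReal :=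
    ⟨fun i z => _, fun i z => rfl⟩
  have hd : ∀ i : ℤ, Measurable (f i) := fun i => by
    rw [show f i = _ from funext (hf i)]
    exact (Continuous.measurable (by fun_prop)).real_toNNReal
  have hkey : ∀ (ω : Ω) (i : ℕ),
      keyPoint ϑ q (fun i => x i ω) b i = f ((i : ℤ) + 1) (x ((i : ℤ) + 1) ω) := fun ω i => by
    rw [hf]
    rfl
  simp_rw [hkey]
  let φ : (Set.range (fun i : Fin (j - m) => ((i : ℕ) : ℤ) + 1) → USphere L s) →
      Fin (j - m) → ℝ≥0 := fun z i => f (((i : ℕ) : ℤ) + 1) (z ⟨((i : ℕ) : ℤ) + 1, i, rfl⟩)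
  let ψ : (({(j : ℤ) + 1} : Set ℤ) → USphere L s) → ℝ≥0 := fun z =>
    f ((j : ℤ) + 1) (z ⟨(j : ℤ) + 1, rfl⟩)
  have hφ : Measurable φ := measurable_pi_lambda _ fun i => (hd _).comp (measurable_pi_apply _)
  have hψ : Measurable ψ := (hd _).comp (measurable_pi_apply _)
  exact h.comp hφ hψ

theorem CorrelatedKeys.measureReal_mem_cap (hx : CorrelatedKeys ϑ q P x m ρ) (i : ℤ)
    (u : USphere L s) (t : ℝ) : P.real {ω | x i ω ∈ cap u t} =
      ((surface L s).withDensity fun u => (ρ u : ℝ≥0∞)).real (cap u t) := by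
  rw [← hx.density i, map_measureReal_apply (hx.measurable i) (isClosed_cap u t).measurableSet]
  rfl

theorem CorrelatedKeys.continuousOn_density (hx : CorrelatedKeys ϑ q P x m ρ) :
    ContinuousOn (fun u => (ρ u : ℝ)) (orbitClosure ϑ q) := by
  obtain ⟨V, -, hOV, hρ, -⟩ := hx.density_local
  exact NNReal.continuous_coe.comp_continuousOn (hρ.mono hOV)

theorem CorrelatedKeys.exists_density_le (hx : CorrelatedKeys ϑ q P x m ρ) :
    ∃ R : ℝ, 0 ≤ R ∧ ∀ u ∈ orbitClosure ϑ q, (ρ u : ℝ) ≤ R := by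
  obtain ⟨R, hR⟩ := (isCompact_orbitClosure ϑ q).exists_bound_of_continuousOn
    hx.continuousOn_density
  refine ⟨max R 0, le_max_right _ _, fun u hu => ?_⟩
  exact (le_abs_self _).trans ((hR u hu).trans (le_max_left _ _))

theorem CorrelatedKeys.exists_oscillation (hx : CorrelatedKeys ϑ q P x m ρ) {ε : ℝ} (hε : 0 < ε) :
    ∃ t₀ : ℝ, 0 < t₀ ∧ ∀ u ∈ orbitClosure ϑ q, ∀ t ≤ t₀,
      |((surface L s).withDensity fun u => (ρ u : ℝ≥0∞)).real (cap u t) -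
        ρ u * (surface L s).real (cap u t)| ≤ ε * (surface L s).real (cap u t) := by
  obtain ⟨V, hV, hOV, hρ, -⟩ := hx.density_local
  obtain ⟨t₀, ht₀, h⟩ := exists_cap_oscillation (isCompact_orbitClosure ϑ q) hV hOV hρ hε
  exact ⟨t₀, ht₀, fun u hu t ht => abs_withDensity_real_sub_le hx.density_measurable
    (isClosed_cap u t).measurableSet fun z hz => h u hu z (mem_cap_mono u ht hz)⟩

/-- The rescaled one-point intensities converge uniformly along the orbit closure. -/
theorem CorrelatedKeys.tendsto_intensity (hx : CorrelatedKeys ϑ q P x m ρ) {k : ℕ}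
    (hLs : 2 * L + s = k + 1) (hk : 0 < k) {t : ℕ → ℝ} (ht0 : ∀ᶠ n in atTop, 0 ≤ t n)
    (ht : Tendsto t atTop (𝓝 0)) {τ : ℝ} (hτ0 : 0 ≤ τ)
    (hτ : Tendsto (fun n : ℕ => (n : ℝ) ^ (2 / (k : ℝ)) * t n) atTop (𝓝 τ)) {δ : ℝ} (hδ : 0 < δ) :
    ∀ᶠ n : ℕ in atTop, ∀ u ∈ orbitClosure ϑ q,
      |n * ((surface L s).withDensity fun u => (ρ u : ℝ≥0∞)).real (cap u (t n)) -
        ballVol k * (2 * τ) ^ ((k : ℝ) / 2) * ρ u| ≤ δ := by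
  set D := ballVol k * (2 * τ) ^ ((k : ℝ) / 2) with hD
  have hD0 : 0 ≤ D := mul_nonneg (ballVol_pos k).le (by positivity)
  obtain ⟨R, hR0, hR⟩ := hx.exists_density_le
  have hDR : 0 < D + 1 + R := by linarith
  -- The bound 1 keeps `n` times the cap area below `D + 1`; the total error is then at most ε (D +
  -- 1) + R ε.
  set ε := min 1 (δ / (D + 1 + R)) with hε
  have hε0 : 0 < ε := lt_min one_pos (div_pos hδ hDR)
  have hε1 : ε ≤ 1 := min_le_left _ _
  have hεδ : ε * (D + 1 + R) ≤ δ := (le_div_iff₀ hDR).1 (min_le_right _ _)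
  obtain ⟨t₀, ht₀, hosc⟩ := hx.exists_oscillation hε0
  filter_upwards [ht.eventually (Iic_mem_nhds ht₀), tendsto_mul_surface_cap hLs hk ht0 ht hτ hε0]
    with n hn hcap u hu
  have h1 := mul_le_mul_of_nonneg_left (hosc u hu (t n) hn) (Nat.cast_nonneg (α := ℝ) n)
  have h2 := hcap u
  have h3 : (n : ℝ) * (surface L s).real (cap u (t n)) ≤ D + 1 := by
    linarith [(abs_le.1 h2).2]
  set p := ((surface L s).withDensity fun u => (ρ u : ℝ≥0∞)).real (cap u (t n))
  set σ := (surface L s).real (cap u (t n))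
  have hρ0 : (0 : ℝ) ≤ ρ u := (ρ u).coe_nonneg
  calc |n * p - D * ρ u| = |n * (p - ρ u * σ) + ρ u * (n * σ - D)| := by ring_nf
    _ ≤ n * |p - ρ u * σ| + ρ u * |n * σ - D| := by
        refine (abs_add_le _ _).trans_eq ?_
        rw [abs_mul, abs_mul, abs_of_nonneg hρ0, Nat.abs_cast]
    _ ≤ ε * (D + 1) + R * ε := by
        refine add_le_add (h1.trans ?_) (mul_le_mul (hR u hu) h2 (abs_nonneg _) hR0)
        calc (n : ℝ) * (ε * σ) = ε * (n * σ) := by ring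
          _ ≤ _ := by gcongr
    _ ≤ δ := by linarith

/-- A bound on the one-point intensities at every scale. -/
theorem CorrelatedKeys.exists_measureReal_cap_le (hx : CorrelatedKeys ϑ q P x m ρ)
    [IsProbabilityMeasure P] {k : ℕ} (hLs : 2 * L + s = k + 1) :
    ∃ C : ℝ, 0 ≤ C ∧ ∀ (i : ℤ), ∀ u ∈ orbitClosure ϑ q, ∀ t : ℝ, 0 ≤ t →
      P.real {ω | x i ω ∈ cap u t} ≤ C * t ^ ((k : ℝ) / 2) := by
  obtain ⟨R, hR0, hR⟩ := hx.exists_density_le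
  obtain ⟨t₀, ht₀, hosc⟩ := hx.exists_oscillation one_pos
  have hb := ballVol_pos k
  -- Below `T` the density bound applies; above it the trivial bound 1 is absorbed by T^(-k/2)
  -- t^(k/2).
  set T := min t₀ (1 / 2)
  have hT : 0 < T := lt_min ht₀ (by norm_num)
  refine ⟨(R + 1) * (ballVol k * 2 ^ k * 2 ^ ((k : ℝ) / 2)) + (T ^ ((k : ℝ) / 2))⁻¹,
    by positivity, fun i u hu t ht => ?_⟩
  rw [add_mul]
  rcases le_total t T with h | h
  · have h1 := (abs_le.1 (hosc u hu t (h.trans (min_le_left _ _)))).2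
    have h2 := surface_cap_le hLs u ht (h.trans (min_le_right _ _))
    rw [Real.mul_rpow two_pos.le ht] at h2
    rw [hx.measureReal_mem_cap]
    have hσ : 0 ≤ (surface L s).real (cap u t) := measureReal_nonneg
    have h3 : ((surface L s).withDensity fun u => (ρ u : ℝ≥0∞)).real (cap u t) ≤
        (R + 1) * (surface L s).real (cap u t) := by
      have := mul_le_mul_of_nonneg_right (hR u hu) hσ
      linarith
    have h4 := mul_le_mul_of_nonneg_left h2 (show 0 ≤ R + 1 by linarith)
    have h5 : 0 ≤ (T ^ ((k : ℝ) / 2))⁻¹ * t ^ ((k : ℝ) / 2) := by positivity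
    linarith
  · have h1 : P.real {ω | x i ω ∈ cap u t} ≤ 1 := measureReal_le_one
    have h2 : 1 ≤ (T ^ ((k : ℝ) / 2))⁻¹ * t ^ ((k : ℝ) / 2) := by
      rw [inv_mul_eq_div, one_le_div (by positivity)]
      gcongr
    have h3 : 0 ≤ (R + 1) * (ballVol k * 2 ^ k * 2 ^ ((k : ℝ) / 2)) * t ^ ((k : ℝ) / 2) := by
      positivity
    linarith

theorem CorrelatedKeys.map_pair (hx : CorrelatedKeys ϑ q P x m ρ) (i j : ℤ) :
    P.map (fun ω => (x i ω, x j ω)) = P.map (fun ω => (x 0 ω, x (j - i) ω)) := by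
  have h := hx.stationary 2 ![0, j - i] i
  have hm : Measurable fun z : Fin 2 → USphere L s => (z 0, z 1) := by fun_prop
  have h1 : ∀ κ : Fin 2 → ℤ, Measurable fun ω a => x (κ a) ω := fun κ =>
    measurable_pi_lambda _ fun a => hx.measurable _
  have h2 := congrArg (Measure.map fun z : Fin 2 → USphere L s => (z 0, z 1)) h
  rw [Measure.map_map hm (h1 _), Measure.map_map hm (h1 fun a => ![0, j - i] a + i)] at h2
  simpa [Function.comp_def] using h2.symm

theorem exists_cap_prod_subset {O : Set (USphere L s)} (hO : IsCompact O)
    {V : Set (USphere L s × USphere L s)} (hV : IsOpen V) (hOV : O ×ˢ O ⊆ V) :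
    ∃ t₀ : ℝ, 0 < t₀ ∧ ∀ u ∈ O, ∀ v ∈ O, cap u t₀ ×ˢ cap v t₀ ⊆ V := by
  obtain ⟨δ, hδ, h⟩ := (hO.prod hO).exists_thickening_subset_open hV hOV
  have hδ2 : 2 * (δ ^ 2 / 4) < δ ^ 2 := by nlinarith [pow_pos hδ 2]
  refine ⟨δ ^ 2 / 4, by positivity, fun u hu v hv z hz => h ?_⟩
  refine Metric.mem_thickening_iff.2 ⟨(u, v), ⟨hu, hv⟩, ?_⟩
  rw [Prod.dist_eq]
  exact max_lt (dist_lt_of_mem_cap hδ hδ2 hz.1) (dist_lt_of_mem_cap hδ hδ2 hz.2)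

theorem withDensity_real_prod_le {α : Type*} [MeasurableSpace α] {σ : Measure α}
    [IsFiniteMeasure σ] {g : α × α → ℝ≥0∞} {M : ℝ≥0} {A B : Set α} (hA : MeasurableSet A)
    (hB : MeasurableSet B) (hg : ∀ p ∈ A ×ˢ B, g p ≤ M) :
    ((σ.prod σ).withDensity g).real (A ×ˢ B) ≤ M * (σ.real A * σ.real B) := by
  have h : ((σ.prod σ).withDensity g) (A ×ˢ B) ≤ M * (σ A * σ B) := by
    rw [withDensity_apply _ (hA.prod hB), ← Measure.prod_prod, ← setLIntegral_const]
    exact setLIntegral_mono' (hA.prod hB) hg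
  have hfin : (M : ℝ≥0∞) * (σ A * σ B) ≠ ∞ := by finiteness
  have := ENNReal.toReal_mono hfin h
  rwa [ENNReal.toReal_mul, ENNReal.toReal_mul] at this

/-- Pairs of keys at distance at most `m` rarely come close to their targets simultaneously. -/
theorem CorrelatedKeys.exists_pair_le (hx : CorrelatedKeys ϑ q P x m ρ) {k : ℕ}
    (hLs : 2 * L + s = k + 1) (hk : 0 < k) {t : ℕ → ℝ} (ht0 : ∀ᶠ n in atTop, 0 ≤ t n)
    (ht : Tendsto t atTop (𝓝 0)) {τ : ℝ} (hτ0 : 0 ≤ τ)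
    (hτ : Tendsto (fun n : ℕ => (n : ℝ) ^ (2 / (k : ℝ)) * t n) atTop (𝓝 τ)) :
    ∃ C : ℝ, 0 ≤ C ∧ ∀ᶠ n : ℕ in atTop, ∀ i j : ℤ, i < j → j ≤ i + m →
      ∀ u ∈ orbitClosure ϑ q, ∀ v ∈ orbitClosure ϑ q,
        P.real {ω | x i ω ∈ cap u (t n) ∧ x j ω ∈ cap v (t n)} ≤ C / n ^ 2 := by
  set D := ballVol k * (2 * τ) ^ ((k : ℝ) / 2) with hD
  have hD0 : 0 ≤ D := mul_nonneg (ballVol_pos k).le (by positivity)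
  -- For each lag, a bounded joint density compares the pair with the product of cap areas.
  -- Irrelevant lags receive `M = 0`.
  have hlag : ∀ l : ℕ, ∃ M : ℝ≥0, 1 ≤ l → l ≤ m → ∃ t₀ : ℝ, 0 < t₀ ∧
      ∀ u ∈ orbitClosure ϑ q, ∀ v ∈ orbitClosure ϑ q, ∀ t ≤ t₀,
        (P.map fun ω => (x 0 ω, x l ω)).real (cap u t ×ˢ cap v t) ≤
          M * ((surface L s).real (cap u t) * (surface L s).real (cap v t)) := by
    intro l
    by_cases hl : 1 ≤ l ∧ l ≤ m
    · obtain ⟨g, -, hlaw, V, hV, hOV, M, hM⟩ := hx.anti_clustering l hl.1 hl.2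
      obtain ⟨t₀, ht₀, hsub⟩ := exists_cap_prod_subset (isCompact_orbitClosure ϑ q) hV hOV
      refine ⟨M, fun _ _ => ⟨t₀, ht₀, fun u hu v hv t htt => ?_⟩⟩
      rw [hlaw]
      exact withDensity_real_prod_le (isClosed_cap u t).measurableSet
        (isClosed_cap v t).measurableSet fun p hp => hM p
          (hsub u hu v hv ⟨mem_cap_mono u htt hp.1, mem_cap_mono v htt hp.2⟩)
    · exact ⟨0, fun h1 h2 => absurd ⟨h1, h2⟩ hl⟩
  choose M hM using hlag
  -- There are finitely many lags, so the sum dominates every `M l`; each cap area is eventually at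
  -- most (D + 1) / n.
  refine ⟨(∑ l ∈ Finset.range (m + 1), (M l : ℝ)) * (D + 1) ^ 2, by positivity, ?_⟩
  have hsmall : ∀ᶠ n in atTop, ∀ l ∈ Finset.Icc 1 m,
      ∀ u ∈ orbitClosure ϑ q, ∀ v ∈ orbitClosure ϑ q,
        (P.map fun ω => (x 0 ω, x l ω)).real (cap u (t n) ×ˢ cap v (t n)) ≤
          M l * ((surface L s).real (cap u (t n)) * (surface L s).real (cap v (t n))) := by
    refine (Filter.eventually_all_finset _).2 fun l hl => ?_
    obtain ⟨t₀, ht₀, h⟩ := hM l (Finset.mem_Icc.1 hl).1 (Finset.mem_Icc.1 hl).2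
    filter_upwards [ht.eventually (Iic_mem_nhds ht₀)] with n hn u hu v hv
    exact h u hu v hv _ hn
  filter_upwards [hsmall, tendsto_mul_surface_cap hLs hk ht0 ht hτ one_pos, eventually_gt_atTop 0]
    with n hn hcap hn0 i j hij hjm u hu v hv
  have hn' : (0 : ℝ) < n := by exact_mod_cast hn0
  obtain ⟨l, hl⟩ := Int.eq_ofNat_of_zero_le (show 0 ≤ j - i by omega)
  have hcap' : ∀ w : USphere L s, (surface L s).real (cap w (t n)) ≤ (D + 1) / n := fun w => by
    rw [le_div_iff₀' hn']
    linarith [(abs_le.1 (hcap w)).2]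
  have hset : MeasurableSet (cap u (t n) ×ˢ cap v (t n)) :=
    (isClosed_cap u _).measurableSet.prod (isClosed_cap v _).measurableSet
  have h1 : P.real {ω | x i ω ∈ cap u (t n) ∧ x j ω ∈ cap v (t n)} =
      (P.map fun ω => (x 0 ω, x l ω)).real (cap u (t n) ×ˢ cap v (t n)) := by
    rw [show x (l : ℤ) = x (j - i) by rw [hl], ← hx.map_pair,
      map_measureReal_apply ((hx.measurable i).prodMk (hx.measurable j)) hset]
    rfl
  have hMl : (M l : ℝ) ≤ ∑ l ∈ Finset.range (m + 1), (M l : ℝ) :=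
    Finset.single_le_sum (f := fun l => (M l : ℝ)) (fun l _ => (M l).coe_nonneg)
      (Finset.mem_range.2 (by omega))
  calc _ ≤ _ := h1.le.trans (hn l (Finset.mem_Icc.2 ⟨by omega, by omega⟩) u hu v hv)
    _ ≤ (∑ l ∈ Finset.range (m + 1), (M l : ℝ)) * ((D + 1) / n * ((D + 1) / n)) := by
        gcongr
        · exact hcap' u
        · exact hcap' v
    _ = _ := by field_simp

/-- The density has a positive minimum on the compact orbit closure, which bounds all orbit averages
from below. In the formula, the area of the unit sphere of ℝ^k is k times the ball volume, which
cancels the denominator d - 1. -/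
theorem CorrelatedKeys.orbitConst_pos (hx : CorrelatedKeys ϑ q P x m ρ) {k : ℕ}
    (hLs : 2 * L + s = k + 1) (hk : 0 < k) : 0 < orbitConst ϑ q ρ ∧
      orbitConst ϑ q ρ = 2 ^ ((k : ℝ) / 2) * ballVol k * ∫ u, (ρ u : ℝ) ∂(phaseLaw ϑ q) := by
  have hk' : (0 : ℝ) < k := by exact_mod_cast hk
  have heq : orbitConst ϑ q ρ =
      2 ^ ((k : ℝ) / 2) * ballVol k * ∫ u, (ρ u : ℝ) ∂(phaseLaw ϑ q) := by
    rw [orbitConst, critExp, hLs, Nat.add_sub_cancel, sphereArea_eq]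
    push_cast
    rw [add_sub_cancel_right, one_div_div]
    field_simp
  refine ⟨heq ▸ mul_pos (mul_pos (by positivity) (ballVol_pos k)) ?_, heq⟩
  obtain ⟨V, hV, hOV, hρ, hpos⟩ := hx.density_local
  obtain ⟨u₀, hu₀, hmin⟩ := (isCompact_orbitClosure ϑ q).exists_isMinOn
    ⟨_, target_mem_orbitClosure ϑ q 0⟩ hx.continuousOn_density
  have hlow : (0 : ℝ) < ρ u₀ := hpos u₀ (hOV hu₀)
  refine hlow.trans_le (ge_of_tendsto (tendsto_target_average ϑ q
    hx.density_measurable.coe_nnreal_real hx.continuousOn_density) ?_)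
  filter_upwards [eventually_gt_atTop 0] with n hn
  rw [le_div_iff₀ (by exact_mod_cast hn)]
  have h1 := Finset.card_nsmul_le_sum Finset.univ
    (fun i : Fin n => (ρ (target ϑ q (((i : ℕ) : ℤ) + 1)) : ℝ)) (ρ u₀ : ℝ)
    fun i _ => hmin (target_mem_orbitClosure ϑ q _)
  simpa [mul_comm] using h1

end Keys

/-! ### Convergence of the largest attention weights -/

section Convergence

variable {k : ℕ} {β : ℕ → ℝ} {γ : ℝ}

theorem eventually_pos_of_tendsto_mul_rpow (hγ : 0 < γ)
    (hβ : Tendsto (fun n : ℕ => β n * (n : ℝ) ^ (-(2 / (k : ℝ)))) atTop (𝓝 γ)) :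
    ∀ᶠ n in atTop, 0 < β n := by
  filter_upwards [hβ.eventually (Ioi_mem_nhds hγ)] with n hn
  exact pos_of_mul_pos_left hn (by positivity)

theorem tendsto_rpow_mul_div (hγ : 0 < γ)
    (hβ : Tendsto (fun n : ℕ => β n * (n : ℝ) ^ (-(2 / (k : ℝ)))) atTop (𝓝 γ)) (y : ℝ) :
    Tendsto (fun n : ℕ => (n : ℝ) ^ (2 / (k : ℝ)) * (y / β n)) atTop (𝓝 (y / γ)) := by
  refine (tendsto_const_nhds.div hβ hγ.ne').congr fun n => ?_
  change y / (β n * (n : ℝ) ^ (-(2 / (k : ℝ)))) = _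
  rw [Real.rpow_neg (Nat.cast_nonneg n), ← div_eq_mul_inv, div_div_eq_mul_div]
  ring

theorem tendsto_div_zero (hk : 0 < k) (hγ : 0 < γ)
    (hβ : Tendsto (fun n : ℕ => β n * (n : ℝ) ^ (-(2 / (k : ℝ)))) atTop (𝓝 γ)) (y : ℝ) :
    Tendsto (fun n : ℕ => y / β n) atTop (𝓝 0) := by
  have hk' : (0 : ℝ) < 2 / k := div_pos two_pos (by exact_mod_cast hk)
  have h1 := (tendsto_rpow_neg_atTop hk').comp (tendsto_natCast_atTop_atTop (R := ℝ))
  have h2 := (tendsto_rpow_mul_div hγ hβ y).mul h1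
  rw [mul_zero] at h2
  refine h2.congr' ?_
  filter_upwards [eventually_gt_atTop 0] with n hn
  have hn' : (0 : ℝ) < (n : ℝ) ^ (2 / (k : ℝ)) := Real.rpow_pos_of_pos (by exact_mod_cast hn) _
  rw [Function.comp_apply, Real.rpow_neg (Nat.cast_nonneg n)]
  field_simp

variable {L s : ℕ} {ϑ : Fin L → ℝ} {q : USphere L s} {Ω : Type*} [MeasurableSpace Ω]
  {P : Measure Ω} {x : ℤ → Ω → USphere L s} {m : ℕ} {ρ : USphere L s → ℝ≥0}

theorem CorrelatedKeys.tendsto_keyPoint (hx : CorrelatedKeys ϑ q P x m ρ)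
    (hLs : 2 * L + s = k + 1) (hk : 0 < k) (hγ : 0 < γ)
    (hβ : Tendsto (fun n : ℕ => β n * (n : ℝ) ^ (-(2 / (k : ℝ)))) atTop (𝓝 γ)) (y : ℝ≥0) {δ : ℝ}
    (hδ : 0 < δ) : ∀ᶠ n : ℕ in atTop, ∀ i : ℕ,
      |n * P.real {ω | keyPoint ϑ q (fun i => x i ω) (β n) i ≤ y} -
        ballVol k * (2 * (y / γ)) ^ ((k : ℝ) / 2) * ρ (target ϑ q ((i : ℤ) + 1))| ≤ δ := by
  have hpos := eventually_pos_of_tendsto_mul_rpow hγ hβ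
  filter_upwards [hpos, hx.tendsto_intensity hLs hk
    (hpos.mono fun n hn => div_nonneg y.coe_nonneg hn.le) (tendsto_div_zero hk hγ hβ y)
    (div_nonneg y.coe_nonneg hγ.le) (tendsto_rpow_mul_div hγ hβ y) hδ] with n hn h i
  simp_rw [keyPoint_le_iff hn]
  rw [hx.measureReal_mem_cap]
  exact h _ (target_mem_orbitClosure ϑ q _)

theorem CorrelatedKeys.exists_keyPoint_le (hx : CorrelatedKeys ϑ q P x m ρ)
    (hLs : 2 * L + s = k + 1) (hk : 0 < k) (hγ : 0 < γ)
    (hβ : Tendsto (fun n : ℕ => β n * (n : ℝ) ^ (-(2 / (k : ℝ)))) atTop (𝓝 γ)) (y : ℝ≥0) :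
    ∃ C : ℝ, 0 ≤ C ∧ ∀ᶠ n : ℕ in atTop, ∀ i < n,
      P.real {ω | keyPoint ϑ q (fun i => x i ω) (β n) i ≤ y} ≤ C / n := by
  obtain ⟨R, hR0, hR⟩ := hx.exists_density_le
  have hD : 0 ≤ ballVol k * (2 * (y / γ)) ^ ((k : ℝ) / 2) := by
    have := ballVol_pos k
    positivity
  refine ⟨ballVol k * (2 * (y / γ)) ^ ((k : ℝ) / 2) * R + 1, by positivity, ?_⟩
  filter_upwards [hx.tendsto_keyPoint hLs hk hγ hβ y one_pos] with n h i hi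
  rw [le_div_iff₀' (by exact_mod_cast (Nat.zero_le i).trans_lt hi)]
  have h1 := mul_le_mul_of_nonneg_left (hR _ (target_mem_orbitClosure ϑ q ((i : ℤ) + 1))) hD
  linarith [(abs_le.1 (h i)).2]

theorem CorrelatedKeys.tendsto_sum_keyPoint (hx : CorrelatedKeys ϑ q P x m ρ)
    (hLs : 2 * L + s = k + 1) (hk : 0 < k) (hγ : 0 < γ)
    (hβ : Tendsto (fun n : ℕ => β n * (n : ℝ) ^ (-(2 / (k : ℝ)))) atTop (𝓝 γ)) (y : ℝ≥0) :
    Tendsto (fun n => ∑ i ∈ Finset.range n,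
      P.real {ω | keyPoint ϑ q (fun i => x i ω) (β n) i ≤ y}) atTop
      (𝓝 (orbitConst ϑ q ρ * (y / γ) ^ ((k : ℝ) / 2))) := by
  set D := ballVol k * (2 * (y / γ)) ^ ((k : ℝ) / 2) with hD
  have hlim : orbitConst ϑ q ρ * (y / γ) ^ ((k : ℝ) / 2) =
      D * ∫ u, (ρ u : ℝ) ∂(phaseLaw ϑ q) := by
    rw [(hx.orbitConst_pos hLs hk).2, hD,
      Real.mul_rpow two_pos.le (div_nonneg y.coe_nonneg hγ.le)]
    ring
  have havg := (tendsto_target_average ϑ q hx.density_measurable.coe_nnreal_real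
    hx.continuousOn_density).const_mul D
  rw [hlim]
  refine tendsto_of_tendsto_of_dist havg (tendsto_order.2 ⟨fun a ha => ?_, fun a ha => ?_⟩)
  · exact Eventually.of_forall fun n => ha.trans_le dist_nonneg
  · filter_upwards [hx.tendsto_keyPoint hLs hk hγ hβ y (half_pos ha), eventually_gt_atTop 0]
      with n h hn
    have hn' : (0 : ℝ) < n := by exact_mod_cast hn
    refine lt_of_le_of_lt ?_ (half_lt_self ha)
    rw [dist_comm, Real.dist_eq, Fin.sum_univ_eq_sum_range
      (fun i : ℕ => (ρ (target ϑ q ((i : ℤ) + 1)) : ℝ)), ← mul_div_assoc, Finset.mul_sum,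
      Finset.sum_div, ← Finset.sum_sub_distrib]
    refine (Finset.abs_sum_le_sum_abs _ _).trans ?_
    refine (Finset.sum_le_card_nsmul _ _ (a / 2 / n) fun i _ => ?_).trans_eq ?_
    · rw [le_div_iff₀ hn', ← abs_of_pos hn', ← abs_mul, abs_of_pos hn', sub_mul,
        div_mul_cancel₀ _ hn'.ne', mul_comm _ (n : ℝ)]
      exact h i
    · rw [Finset.card_range, nsmul_eq_mul]
      field_simp

theorem CorrelatedKeys.exists_keyPoint_pair_le (hx : CorrelatedKeys ϑ q P x m ρ)
    (hLs : 2 * L + s = k + 1) (hk : 0 < k) (hγ : 0 < γ)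
    (hβ : Tendsto (fun n : ℕ => β n * (n : ℝ) ^ (-(2 / (k : ℝ)))) atTop (𝓝 γ)) (y : ℝ≥0) :
    ∃ C : ℝ, 0 ≤ C ∧ ∀ᶠ n : ℕ in atTop, ∀ i j, i < j → j ≤ i + m → j < n →
      P.real {ω | keyPoint ϑ q (fun i => x i ω) (β n) i ≤ y ∧
        keyPoint ϑ q (fun i => x i ω) (β n) j ≤ y} ≤ C / n ^ 2 := by
  have hpos := eventually_pos_of_tendsto_mul_rpow hγ hβ
  obtain ⟨C, hC, h⟩ := hx.exists_pair_le hLs hk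
    (hpos.mono fun n hn => div_nonneg y.coe_nonneg hn.le) (tendsto_div_zero hk hγ hβ y)
    (div_nonneg y.coe_nonneg hγ.le) (tendsto_rpow_mul_div hγ hβ y)
  refine ⟨C, hC, ?_⟩
  filter_upwards [hpos, h] with n hn h i j hij hjm _
  simp_rw [keyPoint_le_iff hn]
  exact h _ _ (by omega) (by omega) _ (target_mem_orbitClosure ϑ q _) _
    (target_mem_orbitClosure ϑ q _)

/-- The bound must hold for all `y` simultaneously, hence the use of caps of every height. The
factor n (1 / β n)^(k/2) converges to γ^(-k/2), so it is eventually below `B`; the exponent k / 2 is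
raised to `k`. -/
theorem CorrelatedKeys.exists_lintegral_pointMeasure_le (hx : CorrelatedKeys ϑ q P x m ρ)
    [IsProbabilityMeasure P] (hLs : 2 * L + s = k + 1) (hk : 0 < k) (hγ : 0 < γ)
    (hβ : Tendsto (fun n : ℕ => β n * (n : ℝ) ^ (-(2 / (k : ℝ)))) atTop (𝓝 γ)) :
    ∃ C : ℝ≥0, ∀ᶠ n in atTop, ∀ y : ℕ,
      ∫⁻ ω, pointMeasure n (keyPoint ϑ q (fun i => x i ω) (β n)) (Set.Iic ((y : ℝ≥0) + 1)) ∂P ≤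
        C * ((y : ℝ≥0∞) + 1) ^ k := by
  obtain ⟨C, hC, h⟩ := hx.exists_measureReal_cap_le hLs
  have hpos := eventually_pos_of_tendsto_mul_rpow hγ hβ
  have hk' : (0 : ℝ) < k := by exact_mod_cast hk
  have hlim := ((Real.continuous_rpow_const (q := (k : ℝ) / 2) (by positivity)).tendsto _).comp
    (tendsto_rpow_mul_div hγ hβ 1)
  set B := (1 / γ) ^ ((k : ℝ) / 2) + 1
  have hB : 0 ≤ B := by positivity
  refine ⟨(C * B).toNNReal, ?_⟩
  filter_upwards [hpos, hlim.eventually (Iic_mem_nhds (lt_add_one _))] with n hn hnB y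
  have hb : (n : ℝ) * (1 / β n) ^ ((k : ℝ) / 2) ≤ B := by
    refine le_of_eq_of_le ?_ hnB
    rw [Function.comp_apply, Real.mul_rpow (by positivity) (by positivity),
      ← Real.rpow_mul (Nat.cast_nonneg n), div_mul_div_cancel₀ hk'.ne', div_self two_ne_zero,
      Real.rpow_one]
  have hset : ∀ i, MeasurableSet {ω | keyPoint ϑ q (fun i => x i ω) (β n) i ≤ (y : ℝ≥0) + 1} :=
    fun i => measurableSet_le (hx.measurable_keyPoint _ i) measurable_const
  have h1 : ∫⁻ ω, pointMeasure n (keyPoint ϑ q (fun i => x i ω) (β n))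
      (Set.Iic ((y : ℝ≥0) + 1)) ∂P =
      ∑ i ∈ Finset.range n, P {ω | keyPoint ϑ q (fun i => x i ω) (β n) i ≤ (y : ℝ≥0) + 1} := by
    simp_rw [pointMeasure_apply _ _ measurableSet_Iic]
    rw [lintegral_finsetSum _ fun i _ => ?_]
    · refine Finset.sum_congr rfl fun i _ => ?_
      rw [← lintegral_indicator_one (hset i)]
      rfl
    · exact (measurable_const.indicator measurableSet_Iic).comp (hx.measurable_keyPoint _ i)
  have h2 : ∀ i, P {ω | keyPoint ϑ q (fun i => x i ω) (β n) i ≤ (y : ℝ≥0) + 1} ≤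
      ENNReal.ofReal (C * (((y : ℝ) + 1) / β n) ^ ((k : ℝ) / 2)) := fun i => by
    rw [ENNReal.le_ofReal_iff_toReal_le (measure_ne_top _ _) (by positivity)]
    simp_rw [keyPoint_le_iff hn]
    exact_mod_cast h _ _ (target_mem_orbitClosure ϑ q _) _ (by positivity)
  have h3 : ((y : ℝ) + 1) ^ ((k : ℝ) / 2) ≤ ((y : ℝ) + 1) ^ k := by
    rw [← Real.rpow_natCast]
    exact Real.rpow_le_rpow_of_exponent_le (by simp) (by linarith)
  rw [h1]
  refine (Finset.sum_le_card_nsmul _ _ _ fun i _ => h2 i).trans ?_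
  rw [Finset.card_range, nsmul_eq_mul, ← ENNReal.ofReal_natCast,
    ← ENNReal.ofReal_mul (Nat.cast_nonneg n)]
  have h4 : ((C * B).toNNReal : ℝ≥0∞) * ((y : ℝ≥0∞) + 1) ^ k =
      ENNReal.ofReal (C * B * ((y : ℝ) + 1) ^ k) := by
    rw [ENNReal.ofReal_mul (by positivity), ENNReal.ofReal_pow (by positivity),
      ENNReal.ofReal_add (by positivity) zero_le_one, ENNReal.ofReal_natCast, ENNReal.ofReal_one]
    rfl
  rw [h4]
  refine ENNReal.ofReal_le_ofReal ?_
  calc (n : ℝ) * (C * (((y : ℝ) + 1) / β n) ^ ((k : ℝ) / 2))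
      = C * (n * (1 / β n) ^ ((k : ℝ) / 2)) * ((y : ℝ) + 1) ^ ((k : ℝ) / 2) := by
        rw [div_eq_mul_one_div, Real.mul_rpow (by positivity) (by positivity)]
        ring
    _ ≤ _ := by gcongr

end Convergence

end RopeAttention

end

/-! ### Assembly of the theorem -/

theorem theoremF3 {L s : ℕ} (hd : 2 ≤ 2 * L + s)
    (ϑ : Fin L → ℝ) (q : RopeAttention.USphere L s)
    {Ω : Type*} [MeasurableSpace Ω] (P : Measure Ω) [IsProbabilityMeasure P]
    (x : ℤ → Ω → RopeAttention.USphere L s) (m : ℕ) (ρ : RopeAttention.USphere L s → ℝ≥0)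
    (hx : RopeAttention.CorrelatedKeys ϑ q P x m ρ)
    (β : ℕ → ℝ) (γ : ℝ) (hγ : 0 < γ)
    (hβ : Tendsto (fun n : ℕ => β n * (n : ℝ) ^ (-RopeAttention.critExp (2 * L + s))) atTop (𝓝 γ))
    {Ω' : Type*} [MeasurableSpace Ω'] (P' : Measure Ω') [IsProbabilityMeasure P']
    (𝒳 : Ω' → Measure ℝ≥0)
    (h𝒳 : RopeAttention.IsPoissonPointProcess 𝒳
      (RopeAttention.powerIntensity (RopeAttention.orbitConst ϑ q ρ) γ
        (1 / RopeAttention.critExp (2 * L + s))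
        (RopeAttention.orbitConst_nonneg hd ϑ q ρ) hγ
        (one_div_pos.2 (RopeAttention.critExp_pos hd))) P') :
    (∀ᵐ ω ∂P', 0 < RopeAttention.arrival (𝒳 ω) 0 ∧
      StrictMono (RopeAttention.arrival (𝒳 ω)) ∧
      𝒳 ω = Measure.sum (fun j : ℕ => Measure.dirac (RopeAttention.arrival (𝒳 ω) j)) ∧
      Summable (fun j : ℕ => Real.exp (-(RopeAttention.arrival (𝒳 ω) j : ℝ)))) ∧
    ∀ k : ℕ, TendstoInDistribution
      (fun (n : ℕ) (ω : Ω) (j : Fin k) =>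
        RopeAttention.nthLargest
          (RopeAttention.weight ϑ q (fun i => x i ω) (β n) n) j)
      atTop
      (fun (ω : Ω') (j : Fin k) => RopeAttention.limitWeight (𝒳 ω) j)
      (fun _ => P) P' := by
  -- Here `d` is the dimension of the sphere, one less than that of the ambient space.
  obtain ⟨d, hLs⟩ : ∃ d, 2 * L + s = d + 1 := ⟨2 * L + s - 1, by omega⟩
  have hd0 : 0 < d := by omega
  have hcrit : RopeAttention.critExp (2 * L + s) = 2 / (d : ℝ) := by
    rw [RopeAttention.critExp, hLs]
    push_cast
    rw [add_sub_cancel_right]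
  have ha := one_div_pos.2 (RopeAttention.critExp_pos hd)
  have hinv : 1 / RopeAttention.critExp (2 * L + s) = (d : ℝ) / 2 := by rw [hcrit, one_div_div]
  have hc := (hx.orbitConst_pos hLs hd0).1
  rw [hcrit] at hβ
  have hfin := RopeAttention.powerIntensity_Iic_ne_top hc hγ ha
  have htop := RopeAttention.tendsto_powerIntensity_real_Iic hc hγ ha
  obtain ⟨C₁, hC₁⟩ := hx.exists_lintegral_pointMeasure_le hLs hd0 hγ hβ
  obtain ⟨C₂, hC₂⟩ := h𝒳.exists_lintegral_Iic_le hc hγ ha (by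
    rw [hinv]
    linarith [(Nat.cast_nonneg d : (0 : ℝ) ≤ d)] : 1 / RopeAttention.critExp (2 * L + s) ≤ (d : ℝ))
  have hmax : ∀ {a : ℝ≥0∞} {C C' : ℝ≥0} {y : ℕ}, a ≤ C * ((y : ℝ≥0∞) + 1) ^ d → C ≤ C' →
      a ≤ C' * ((y : ℝ≥0∞) + 1) ^ d := fun h hCC => h.trans (by gcongr)
  refine ⟨RopeAttention.ae_arrivals hc hγ ha h𝒳 hC₂, fun k => ?_⟩
  have hgood' : ∀ᵐ ω ∂P', RopeAttention.HasWeights (𝒳 ω)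
      fun j : Fin k => RopeAttention.limitWeight (𝒳 ω) j := by
    filter_upwards [h𝒳.ae_infinite hfin htop, h𝒳.ae_expMass_ne_top hC₂] with ω h1 h2
    exact RopeAttention.hasWeights_limitWeight (h𝒳.counting ω) h1 h2 k
  refine RopeAttention.tendstoInDistribution_weights
    (M := fun n ω => RopeAttention.pointMeasure n
      (RopeAttention.keyPoint ϑ q (fun i => x i ω) (β n)))
    (fun n => RopeAttention.measurable_pointMeasure n (hx.measurable_keyPoint (β n)))
    h𝒳.measurable (fun n => (measurable_pi_lambda _ fun j : Fin k =>
      (RopeAttention.measurable_nthLargest n j).comp (hx.measurable_weight (β n) n)).aemeasurable)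
    (h𝒳.aemeasurable_limitWeight hgood' (h𝒳.ae_infinite hfin htop)) ?_ hgood'
    (C := max C₁ C₂) (q := d) (hC₁.mono fun n h y => hmax (h y) (le_max_left _ _))
    (fun y => hmax (hC₂ y) (le_max_right _ _)) (fun r hr => ?_) ?_
  -- For `n < k` the ordered weights are padded with zeros, so the representation by `HasWeights` is
  -- claimed only eventually.
  · filter_upwards [RopeAttention.eventually_pos_of_tendsto_mul_rpow hγ hβ,
      eventually_ge_atTop k] with n hn hkn
    refine ae_of_all _ fun ω => ?_
    simp only [Function.comp_apply, RopeAttention.weight_eq hn]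
    exact RopeAttention.hasWeights_pointMeasure hkn _
  · refine RopeAttention.tendstoInDistribution_counts
      (Y := fun n i ω => RopeAttention.keyPoint ϑ q (fun i => x i ω) (β n) i)
      (fun n i => hx.measurable_keyPoint (β n) i) (fun n j => hx.indepFun_keyPoint (β n) j)
      (hx.exists_keyPoint_le hLs hd0 hγ hβ) (hx.exists_keyPoint_pair_le hLs hd0 hγ hβ) hfin
      (fun y => ?_) h𝒳 hr
    rw [RopeAttention.powerIntensity_real_Iic hc hγ ha, hinv]
    exact hx.tendsto_sum_keyPoint hLs hd0 hγ hβ y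
  · have h := h𝒳.tendsto_measure_lt hfin htop 1
    simpa only [not_le, Nat.cast_one] using h
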